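/- Let $c\in\mathbb{C}\setminus\{0\}$ and consider on $\mathbb{C}\setminus\{0\}$ the potential \[ \xi=\lambda^{-1}\begin{pmatrix}0&1\\ c z^{-1}&0\end{pmatrix}dz ,\qquad \lambda\in\mathbb{S}^1=\{\lambda\in\mathbb{C}: |\lambda|=1\}. \] Let $\Lambda SL_2\mathbb{C}_\sigma$ be the group of smooth maps $\mathbb{S}^1\to SL_2\mathbb{C}$ whose diagonal entries are even and whose off-diagonal entries are odd in $\lambda$, let $\Lambda G_\sigma$ be its subgroup of maps into a subgroup $G$ of $SL_2\mathbb{C}$, and let $\Lambda_+SL_2\mathbb{C}_\sigma$ be its subgroup of loops that extend to the closed unit disk as $SL_2\mathbb{C}$-valued maps, smooth up to the boundary and holomorphic inside. Put $\omega=\begin{pmatrix}0&-\lambda\\ \lambda^{-1}&0\end{pmatrix}$ and $\sigma_3=\mathrm{diag}(1,-1)$. Let $\Sigma\subset\mathbb{C}\setminus\{0\}$ be an annular domain (an open set homeomorphic to a round open annulus) containing a closed curve with nonzero winding number about $0$, and let $\tilde\Sigma$ be its universal cover. Let $G$ be one of $SU(2)$, $SU(1,1)$, $SL_2\mathbb{R}$,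 let $L:\tilde\Sigma\to\Lambda SL_2\mathbb{C}_\sigma$ be any solution of $dL=L\xi$, and suppose that $L$ has an Iwasawa splitting on $\tilde\Sigma$, that is, $L=F_0B$ on $\tilde\Sigma$ or, when $G=SU(1,1)$, $L=F_0\,\omega B$ on $\tilde\Sigma$, with $F_0:\tilde\Sigma\to\Lambda G_\sigma$ smooth in $(z,\lambda)$ and $B:\tilde\Sigma\to\Lambda_+SL_2\mathbb{C}_\sigma$. Let $F=F_0$ in the first case and $F=\omega^{-1}F_0\,\omega$ in the second, and define $f=f_\lambda$ on $\tilde\Sigma$ by \[ f=\frac{-i}{2H}\left[F\sigma_3F^{-1}-2\lambda(\partial_\lambda F)F^{-1}\right]\quad (H\in\mathbb{R}\setminus\{0\}) \] if $G=SU(2)$ (CMC $H$ surfaces in $\mathbb{R}^3$) or $G=SU(1,1)$ (spacelike CMC $H$ surfaces in Minkowski space $\mathbb{L}^3$), and by \[ f=-i\,\lambda(\partial_\lambda F)F^{-1} \] if $G=SL_2\mathbb{R}$ (timelike surfaces of constant negative Gauss curvature in $\mathbb{L}^3$). Here $\mathbb{R}^3$ and $\mathbb{L}^3$ are identified with the Lie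 algebra of $G$, and $\lambda\partial_\lambda=-i\partial_t$ for $\lambda=e^{it}$. Then for no value $\lambda_0\in\mathbb{S}^1$ is the resulting immersion $f_{\lambda_0}$ well defined on $\Sigma$: there is no map on $\Sigma$ whose pull-back to $\tilde\Sigma$ is $f_{\lambda_0}$. (For $G=SL_2\mathbb{R}$ it is assumed that $f_{\lambda_0}$ is an immersion on $\tilde\Sigma$; for the other two groups no such assumption is made.) -/

import Mathlib

open scoped ContDiff

noncomputable section

namespace DPW

/-- Complex `2 × 2` matrices. -/
abbrev Mat2 : Type := Matrix (Fin 2) (Fin 2) ℂ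

/-- Matrix-valued maps on the unit circle `|λ| = 1`. -/
abbrev Loop : Type := Circle → Mat2

/-- The matrix `diag (1, -1)`. -/
def sigma3 : Mat2 := !![1, 0; 0, -1]

/-- Smoothness of a loop, in the angle `t` of `λ = exp (i t)`. -/
def IsSmoothLoop (g : Loop) : Prop :=
  ∀ i j, ContDiff ℝ ∞ (fun t : ℝ => g (Circle.exp t) i j)

/-- The loop is twisted: the diagonal entries are even and the off-diagonal entries are odd in `λ`.
Here `Circle.exp Real.pi * l` is the point `-l` of the circle. -/
def IsTwisted (g : Loop) : Prop :=
  ∀ l : Circle,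
    g (Circle.exp Real.pi * l) 0 0 = g l 0 0 ∧ g (Circle.exp Real.pi * l) 1 1 = g l 1 1 ∧
    g (Circle.exp Real.pi * l) 0 1 = -g l 0 1 ∧ g (Circle.exp Real.pi * l) 1 0 = -g l 1 0

/-- The twisted loop group of smooth maps from the circle to `SL(2, ℂ)`. -/
def loopSL2 : Set Loop :=
  {g | IsSmoothLoop g ∧ IsTwisted g ∧ ∀ l, (g l).det = 1}

/-- The positive twisted loop group (not normalized at `λ = 0`): the loops that extend to the
closed unit disk as `SL(2, ℂ)`-valued maps, smooth up to the boundary and holomorphic inside. -/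
def loopPlus : Set Loop :=
  {g | g ∈ loopSL2 ∧ ∃ E : ℂ → Mat2,
    (∀ i j, ContDiffOn ℝ ∞ (fun z => E z i j) (Metric.closedBall 0 1)) ∧
    (∀ i j, DifferentiableOn ℂ (fun z => E z i j) (Metric.ball 0 1)) ∧
    (∀ z ∈ Metric.closedBall (0 : ℂ) 1, (E z).det = 1) ∧
    ∀ l : Circle, E (l : ℂ) = g l}

/-- The three surface classes: constant mean curvature surfaces in Euclidean 3-space, spacelike
constant mean curvature surfaces in Minkowski 3-space, and timelike surfaces of constant negative
Gauss curvature in Minkowski 3-space. -/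
inductive SurfaceClass : Type
  | cmcEuclidean
  | cmcSpacelike
  | cgcTimelike

/-- The real form of `SL(2, ℂ)` that belongs to a surface class: `SU(2)`, `SU(1,1)`, `SL(2, ℝ)`. -/
def realForm : SurfaceClass → Set Mat2
  | .cmcEuclidean => {A | A.det = 1 ∧ A.conjTranspose * A = 1}
  | .cmcSpacelike => {A | A.det = 1 ∧ A.conjTranspose * sigma3 * A = sigma3}
  | .cgcTimelike => {A | A.det = 1 ∧ ∀ i j, (A i j).im = 0}

/-- The twisted loop group of a real form. -/
def loopReal (T : SurfaceClass) : Set Loop :=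
  {g | g ∈ loopSL2 ∧ ∀ l, g l ∈ realForm T}

/-- The loop `ω` that describes the second open Iwasawa cell of `SU(1,1)`. -/
def omega : Loop := fun l => !![0, -(l : ℂ); (l : ℂ)⁻¹, 0]

/-- The coefficient of `dz` in the potential `ξ = λ⁻¹ (0, 1; c z⁻¹, 0) dz`. -/
def potential (c : ℂ) (l : Circle) (z : ℂ) : Mat2 :=
  (l : ℂ)⁻¹ • !![0, 1; c * z⁻¹, 0]

/-- The closed path `γ` in `ℂ \ {0}` has winding number `n` about `0`: along a continuous
logarithm, the end value exceeds the initial value by `2 π i n`. -/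
def HasWindingNumber {z : ℂ} (γ : Path z z) (n : ℤ) : Prop :=
  ∃ θ : C(unitInterval, ℂ), (∀ t, Complex.exp (θ t) = γ t) ∧
    θ 1 - θ 0 = 2 * Real.pi * Complex.I * n

/-- `S` is an annular domain in `ℂ \ {0}` (an open set homeomorphic to a round annulus) that
contains a loop with nonzero winding number about `0`. -/
def IsAnnularAroundZero (S : Set ℂ) : Prop :=
  IsOpen S ∧ (0 : ℂ) ∉ S ∧ Nonempty (S ≃ₜ {z : ℂ // 1 < ‖z‖ ∧ ‖z‖ < 2}) ∧
    ∃ (z : ℂ) (γ : Path z z) (n : ℤ), (∀ t, γ t ∈ S) ∧ HasWindingNumber γ n ∧ n ≠ 0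

/-- The universal cover of an annular domain `S` around `0`, in the coordinate `w = log z`:
the covering map is `w ↦ z = exp w`, the deck transformations are `w ↦ w + 2 π i k`. -/
def logCover (S : Set ℂ) : Set ℂ := Complex.exp ⁻¹' S

/-- `L` is a solution of `dL = L ξ` with values in the twisted loop group, on the set `U` of values
of the coordinate `w = log z`; the pull-back of `dz` is `exp w dw`. -/
def IsSolution (c : ℂ) (U : Set ℂ) (L : ℂ → Loop) : Prop :=
  (∀ w ∈ U, L w ∈ loopSL2) ∧
  ∀ w ∈ U, ∀ l : Circle, ∀ i j,
    HasDerivAt (fun v => L v l i j)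
      ((L w l * (Complex.exp w • potential c l (Complex.exp w))) i j) w

/-- A family of loops over `U` that is smooth in `(w, λ)`. -/
def IsSmoothFamily (U : Set ℂ) (F : ℂ → Loop) : Prop :=
  ∀ i j, ContDiffOn ℝ ∞ (fun p : ℂ × ℝ => F p.1 (Circle.exp p.2) i j) (U ×ˢ Set.univ)

/-- `F` is an extended frame obtained from `L` by Iwasawa splitting over `U`: either `L = F B`, or,
for `SU(1,1)` only, `L = F₀ ω B` and `F = ω⁻¹ F₀ ω`, with the real factor in the loop group of the
real form, smooth over `U`, and `B` in the positive loop group. -/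
def IsFrame (T : SurfaceClass) (U : Set ℂ) (L F : ℂ → Loop) : Prop :=
  ∃ F₀ B : ℂ → Loop,
    IsSmoothFamily U F₀ ∧ (∀ w ∈ U, F₀ w ∈ loopReal T) ∧ (∀ w ∈ U, B w ∈ loopPlus) ∧
    ((∀ w ∈ U, ∀ l, L w l = F₀ w l * B w l ∧ F w l = F₀ w l) ∨
      (T = .cmcSpacelike ∧ ∀ w ∈ U, ∀ l,
        L w l = F₀ w l * omega l * B w l ∧ F w l = (omega l)⁻¹ * F₀ w l * omega l))

/-- The derivative `λ ∂_λ g` of a smooth loop, that is `-i ∂_t` for `λ = exp (i t)`. -/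
def lambdaDeriv (g : Loop) (l : Circle) : Mat2 :=
  Matrix.of fun i j => -Complex.I * deriv (fun t : ℝ => g (Circle.exp t * l) i j) 0

/-- The Sym-Bobenko formula with mean curvature `H` for the two CMC classes, and the Sym formula
for the timelike class (which does not involve `H`). The values lie in the Lie algebra of the real
form, which is Euclidean or Minkowski 3-space. -/
def symMap (H : ℝ) : SurfaceClass → Loop → Loop
  | .cmcEuclidean, g => fun l =>
      (-Complex.I / (2 * H)) • (g l * sigma3 * (g l)⁻¹ - (2 : ℂ) • (lambdaDeriv g l * (g l)⁻¹))
  | .cmcSpacelike, g => fun l =>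
      (-Complex.I / (2 * H)) • (g l * sigma3 * (g l)⁻¹ - (2 : ℂ) • (lambdaDeriv g l * (g l)⁻¹))
  | .cgcTimelike, g => fun l => (-Complex.I) • (lambdaDeriv g l * (g l)⁻¹)

/-- The matrix-valued map `f` is an immersion on the open set `U` of the real plane `ℂ`. -/
def IsImmersionOn (U : Set ℂ) (f : ℂ → Mat2) : Prop :=
  ∀ w ∈ U, DifferentiableAt ℝ (fun v => (fun i j => f v i j : Fin 2 → Fin 2 → ℂ)) w ∧
    Function.Injective (fderiv ℝ (fun v => (fun i j => f v i j : Fin 2 → Fin 2 → ℂ)) w)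

/-- A map `f` on the universal cover of `S` is well defined on `S`: it factors through `S`. -/
def IsWellDefinedOn (S : Set ℂ) (f : ℂ → Mat2) : Prop :=
  ∃ fS : ℂ → Mat2, ∀ w ∈ logCover S, f w = fS (Complex.exp w)

end DPW

end

/-! In the coordinate w = log z the deck transformations are translations by τ = 2πin, and dL = Lξ
becomes the scalar equation x'' = cλ⁻² exp(w) x, of Bessel type, whose second solution contains a
logarithm. Hence L(w+τ) = L(w)(1+N) with N ≠ 0 and N² = 0, at every λ (`solution_monodromy`). A
single value λ₀ at which the surface closes contradicts this, as follows.

The splitting makes F⁻¹dF a Laurent polynomial in λ with powers −1, 0, 1. Its λ⁻¹-part is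
off-diagonal with entries p, q such that pq = c exp w (`SplitData.exists_form`), and the
differential of f is F · (explicit matrix in p, q, λ) · F⁻¹. If f has period τ at λ₀, comparing
differentials at w and w+τ shows that k(w) = F(w)⁻¹F(w+τ), taken at λ₀, is diagonal and gauges one
form into the other; in the timelike case τ may have to be doubled (`SplitData.exists_gauge`). The
same k then serves at all λ: the loop R(λ) = F(w+τ) k(w)⁻¹ F(w)⁻¹ does not depend on w
(`SplitData.gauge_loop_const`), and R(λ₀) = 1.

Consequently h(w) = L(w)⁻¹R⁻¹L(w+τ) = B(w)⁻¹k(w)B(w+τ) extends holomorphically to the disk, while dh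
= [h, ξ]. Let X = h − adj h. The lowest Fourier coefficient of a nonzero trace free solution of this
equation is a nowhere vanishing multiple of A = (0, exp w; c, 0) (`IsKilling.exists_leading`). Since
tr A² = 2c exp w ≠ 0, the product of two nonzero solutions has nonzero trace. The commutator of two
solutions is again a solution and is trace orthogonal to both, so it vanishes (`IsKilling.commute`).

Apply this to X(w) and X(w+τ) = (1+N)⁻¹X(w)(1+N). At a λ with det X ≠ 0 it forces N = 0
(`eq_zero_of_conj_commute`). If instead X vanishes identically, then at λ₀ the matrix h = 1+N equals
its adjugate 1−N, and again N = 0 (`SplitData.not_gauge`). -/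

noncomputable section

namespace DPW

open Matrix
open scoped Nat ComplexConjugate

/-! ### Entrywise derivatives of `2 × 2` matrices -/

section MatrixCalculus

variable {𝕜 R : Type*} [NontriviallyNormedField 𝕜] [NormedCommRing R] [NormedAlgebra 𝕜 R]

/-- Entrywise derivative of a curve of `2 × 2` matrices. -/
def HasMatDerivAt (g : 𝕜 → Matrix (Fin 2) (Fin 2) R) (g' : Matrix (Fin 2) (Fin 2) R) (x : 𝕜) :
    Prop :=
  ∀ i j, HasDerivAt (fun y => g y i j) (g' i j) x

theorem HasMatDerivAt.mul {g k : 𝕜 → Matrix (Fin 2) (Fin 2) R} {g' k' : Matrix (Fin 2) (Fin 2) R}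
    {x : 𝕜} (hg : HasMatDerivAt g g' x) (hk : HasMatDerivAt k k' x) :
    HasMatDerivAt (fun y => g y * k y) (g' * k x + g x * k') x := by
  intro i j
  have h := (((hg i 0).fun_mul (hk 0 j)).fun_add ((hg i 1).fun_mul (hk 1 j)))
  simp only [Matrix.mul_apply, Fin.sum_univ_two]
  refine h.congr_deriv ?_
  simp only [Matrix.add_apply, Matrix.mul_apply, Fin.sum_univ_two]; ring

theorem HasMatDerivAt.sub {g k : 𝕜 → Matrix (Fin 2) (Fin 2) R} {g' k' : Matrix (Fin 2) (Fin 2) R}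
    {x : 𝕜} (hg : HasMatDerivAt g g' x) (hk : HasMatDerivAt k k' x) :
    HasMatDerivAt (fun y => g y - k y) (g' - k') x :=
  fun i j => (hg i j).sub (hk i j)

theorem hasMatDerivAt_const (M : Matrix (Fin 2) (Fin 2) R) (x : 𝕜) :
    HasMatDerivAt (fun _ => M) 0 x :=
  fun i j => hasDerivAt_const x (M i j)

theorem HasMatDerivAt.const_smul {S : Type*} [NormedField S] [NormedAlgebra S R]
    [SMulCommClass 𝕜 S R] {g : 𝕜 → Matrix (Fin 2) (Fin 2) R} {g' : Matrix (Fin 2) (Fin 2) R}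
    {x : 𝕜} (a : S) (hg : HasMatDerivAt g g' x) :
    HasMatDerivAt (fun y => a • g y) (a • g') x :=
  fun i j => (hg i j).const_smul a

/-- In size two the adjugate is linear in the entries. On determinant one matrices it is the
inverse, so it replaces inversion throughout and also makes sense over C(S¹). -/
theorem HasMatDerivAt.adjugate {g : 𝕜 → Matrix (Fin 2) (Fin 2) R}
    {g' : Matrix (Fin 2) (Fin 2) R} {x : 𝕜} (hg : HasMatDerivAt g g' x) :
    HasMatDerivAt (fun y => (g y).adjugate) g'.adjugate x := by
  intro i j
  simp only [Matrix.adjugate_fin_two]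
  fin_cases i <;> fin_cases j
  · simpa using hg 1 1
  · simpa using (hg 0 1).fun_neg
  · simpa using (hg 1 0).fun_neg
  · simpa using hg 0 0

theorem HasMatDerivAt.unique {g : 𝕜 → Matrix (Fin 2) (Fin 2) R}
    {g' g'' : Matrix (Fin 2) (Fin 2) R} {x : 𝕜} (h : HasMatDerivAt g g' x)
    (h' : HasMatDerivAt g g'' x) : g' = g'' :=
  Matrix.ext fun i j => (h i j).unique (h' i j)

theorem HasMatDerivAt.congr {g k : 𝕜 → Matrix (Fin 2) (Fin 2) R}
    {g' : Matrix (Fin 2) (Fin 2) R} {x : 𝕜} (h : HasMatDerivAt g g' x)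
    (hk : ∀ᶠ y in nhds x, k y = g y) : HasMatDerivAt k g' x :=
  fun i j => (h i j).congr_of_eventuallyEq (hk.mono fun y hy => by simp only [hy])

/-- The trace of `adj g * g'` is the derivative of the determinant. -/
theorem HasMatDerivAt.trace_adjugate_mul {g : 𝕜 → Matrix (Fin 2) (Fin 2) R}
    {g' : Matrix (Fin 2) (Fin 2) R} {x : 𝕜} (h : HasMatDerivAt g g' x)
    (hdet : ∀ᶠ y in nhds x, (g y).det = 1) : ((g x).adjugate * g').trace = 0 := by
  have h1 := ((h 0 0).mul (h 1 1)).sub ((h 0 1).mul (h 1 0))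
  have h2 : HasDerivAt (fun y => (g y).det) 0 x :=
    (hasDerivAt_const x (1 : R)).congr_of_eventuallyEq hdet
  have h3 := h2.unique (h1.congr_of_eventuallyEq
    (Filter.Eventually.of_forall fun y => by simp [Matrix.det_fin_two]))
  rw [Matrix.trace_fin_two, Matrix.adjugate_fin_two]
  simp only [Matrix.mul_apply, Fin.sum_univ_two, Matrix.of_apply,
    Matrix.cons_val', Matrix.cons_val_zero, Matrix.cons_val_one, Matrix.cons_val_fin_one]
  rw [h3]; ring

end MatrixCalculus

/-! ### Adjugates of 2 × 2 matrices as inverses in SL₂ -/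

section Adjugate

variable {R : Type*} [CommRing R]

theorem adjugate_add_fin_two (M N : Matrix (Fin 2) (Fin 2) R) :
    (M + N).adjugate = M.adjugate + N.adjugate := by
  rw [adjugate_fin_two, adjugate_fin_two, adjugate_fin_two]
  ext i j; fin_cases i <;> fin_cases j <;> simp [add_comm]

theorem adjugate_neg_fin_two (M : Matrix (Fin 2) (Fin 2) R) :
    (-M).adjugate = -M.adjugate := by
  rw [adjugate_fin_two, adjugate_fin_two]
  ext i j; fin_cases i <;> fin_cases j <;> simp

theorem adjugate_adjugate_fin_two (M : Matrix (Fin 2) (Fin 2) R) : M.adjugate.adjugate = M := by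
  rw [adjugate_fin_two, adjugate_fin_two]
  ext i j; fin_cases i <;> fin_cases j <;> simp

theorem adjugate_eq_neg_of_trace_eq_zero {M : Matrix (Fin 2) (Fin 2) R} (h : M.trace = 0) :
    M.adjugate = -M := by
  rw [trace_fin_two] at h
  rw [adjugate_fin_two]
  ext i j; fin_cases i <;> fin_cases j <;> simp
  · linear_combination h
  · linear_combination h

theorem mul_adjugate_of_det {M : Matrix (Fin 2) (Fin 2) R} (h : M.det = 1) :
    M * M.adjugate = 1 := by rw [mul_adjugate, h, one_smul]

theorem adjugate_mul_of_det {M : Matrix (Fin 2) (Fin 2) R} (h : M.det = 1) :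
    M.adjugate * M = 1 := by rw [adjugate_mul, h, one_smul]

theorem inv_eq_adjugate {M : Mat2} (h : M.det = 1) : M⁻¹ = M.adjugate := by
  rw [Matrix.inv_def, h, Ring.inverse_one, one_smul]

end Adjugate

/-! ### Entire functions given by power series in `μ exp w` -/

/-- The coefficients of a power series with infinite radius of convergence. -/
def RapidDecay (a : ℕ → ℂ) : Prop := ∀ r : ℝ, 0 ≤ r → Summable fun n => ‖a n‖ * r ^ n

/-- The sum of the power series with coefficients `a`. -/
def entire (a : ℕ → ℂ) (ζ : ℂ) : ℂ := ∑' n, a n * ζ ^ n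

/-- The coefficients of `ζ f'(ζ)`. -/
def eulerCoeff (a : ℕ → ℂ) : ℕ → ℂ := fun n => n * a n

theorem RapidDecay.euler {a : ℕ → ℂ} (h : RapidDecay a) : RapidDecay (eulerCoeff a) := by
  intro r hr
  refine Summable.of_nonneg_of_le (fun n => by positivity) (fun n => ?_)
    (h (2 * r) (by positivity))
  have : (n : ℝ) ≤ 2 ^ n := by exact_mod_cast Nat.lt_two_pow_self.le
  simp only [eulerCoeff, norm_mul, Complex.norm_natCast, mul_pow]
  nlinarith [mul_le_mul_of_nonneg_right this (by positivity : 0 ≤ ‖a n‖ * r ^ n)]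

theorem RapidDecay.summable {a : ℕ → ℂ} (h : RapidDecay a) (ζ : ℂ) :
    Summable fun n => a n * ζ ^ n := by
  refine Summable.of_norm ?_
  simpa using h ‖ζ‖ (norm_nonneg _)

theorem RapidDecay.continuous {a : ℕ → ℂ} (h : RapidDecay a) : Continuous (entire a) := by
  rw [continuous_iff_continuousAt]
  intro ζ
  have : ContinuousOn (entire a) (Metric.ball 0 (‖ζ‖ + 1)) := by
    refine continuousOn_tsum (fun n => by fun_prop) (h (‖ζ‖ + 1) (by positivity)) ?_
    intro n x hx
    rw [norm_mul, norm_pow]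
    have : ‖x‖ ≤ ‖ζ‖ + 1 := by simpa using (mem_ball_zero_iff.1 hx).le
    gcongr
  exact this.continuousAt (Metric.isOpen_ball.mem_nhds (by simp))

/-- The operator d/dw multiplies (μ exp w)ⁿ by n, so in the logarithmic coordinate differentiation
is the Euler operator on coefficients. -/
theorem RapidDecay.hasDerivAt {a : ℕ → ℂ} (h : RapidDecay a) (μ w : ℂ) :
    HasDerivAt (fun w => entire a (μ * Complex.exp w))
      (entire (eulerCoeff a) (μ * Complex.exp w)) w := by
  -- This bounds |μ exp v| on the unit ball around w and so gives a summable majorant for the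
  -- differentiated series.
  set r : ℝ := ‖μ‖ * Real.exp (w.re + 1)
  have key := hasDerivAt_tsum_of_isPreconnected
    (u := fun n => ‖eulerCoeff a n‖ * r ^ n) (t := Metric.ball w 1)
    (g := fun n v => a n * (μ * Complex.exp v) ^ n)
    (g' := fun n v => eulerCoeff a n * (μ * Complex.exp v) ^ n) (y₀ := w) (y := w)
    (h.euler r (by positivity)) Metric.isOpen_ball (convex_ball w 1).isPreconnected ?_ ?_
    (by simp) (h.summable _) (by simp)
  · exact key
  · intro n v _
    have h1 := ((((Complex.hasDerivAt_exp v).const_mul μ).fun_pow n).const_mul (a n))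
    refine h1.congr_deriv ?_
    rcases n with _ | n
    · simp [eulerCoeff]
    · simp only [eulerCoeff, Nat.add_sub_cancel]; ring
  · intro n v hv
    rw [norm_mul, norm_pow, norm_mul, Complex.norm_exp]
    have : v.re ≤ w.re + 1 := by
      have h2 := (Complex.abs_re_le_norm (v - w)).trans (mem_ball_iff_norm.1 hv).le
      rw [Complex.sub_re] at h2
      linarith [le_abs_self (v.re - w.re)]
    have h3 : ‖μ‖ * Real.exp v.re ≤ r := by simp only [r]; gcongr
    gcongr

theorem entire_zero (a : ℕ → ℂ) : entire a 0 = a 0 := by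
  rw [entire, tsum_eq_single 0]
  · simp
  · intro n hn; simp [hn]

/-- The coefficients of the power series solution of `x'' = exp w * x` in `exp w`. -/
def regCoeff : ℕ → ℂ := fun n => 1 / (n ! : ℂ) ^ 2

/-- The coefficients of the power series part of the logarithmic solution of `x'' = exp w * x`. -/
def logCoeff : ℕ → ℂ := fun n => -2 * (harmonic n : ℂ) / (n ! : ℂ) ^ 2

theorem regCoeff_decay : RapidDecay regCoeff := by
  intro r hr
  refine Summable.of_nonneg_of_le (fun n => by positivity) (fun n => ?_)
    (Real.summable_pow_div_factorial r)
  have h1 : (1 : ℝ) ≤ n ! := by exact_mod_cast Nat.one_le_iff_ne_zero.2 (Nat.factorial_ne_zero n)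
  have : ‖regCoeff n‖ = 1 / (n ! : ℝ) ^ 2 := by simp [regCoeff]
  rw [this, div_mul_eq_mul_div, one_mul]
  gcongr
  nlinarith

theorem harmonic_le_self (n : ℕ) : 0 ≤ harmonic n ∧ harmonic n ≤ n := by
  induction n with
  | zero => simp
  | succ n ih =>
    have h1 : 0 ≤ ((n + 1 : ℕ) : ℚ)⁻¹ := by positivity
    have h2 : ((n + 1 : ℕ) : ℚ)⁻¹ ≤ 1 := inv_le_one_of_one_le₀ (by simp)
    rw [harmonic_succ]
    push_cast at *
    constructor <;> linarith

theorem logCoeff_decay : RapidDecay logCoeff := by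
  intro r hr
  refine Summable.of_nonneg_of_le (fun n => by positivity) (fun n => ?_)
    ((regCoeff_decay.euler r hr).mul_left 2)
  have h0 := harmonic_le_self n
  have h1 : ‖(harmonic n : ℂ)‖ ≤ n := by
    have : (harmonic n : ℂ) = ((harmonic n : ℝ) : ℂ) := by push_cast; rfl
    rw [this, Complex.norm_real, Real.norm_eq_abs, abs_of_nonneg (by exact_mod_cast h0.1)]
    exact_mod_cast h0.2
  have h2 : ‖logCoeff n‖ ≤ 2 * ‖eulerCoeff regCoeff n‖ := by
    simp only [logCoeff, eulerCoeff, regCoeff, norm_div, norm_mul, norm_neg, Complex.norm_natCast,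
      norm_pow, norm_one, Complex.norm_ofNat]
    rw [← mul_assoc, mul_one_div]
    gcongr
  rw [← mul_assoc]
  gcongr

theorem entire_succ {a : ℕ → ℂ} (h : RapidDecay a) (ζ : ℂ) :
    entire a ζ = a 0 + ∑' n, a (n + 1) * ζ ^ (n + 1) := by
  rw [entire, (h.summable ζ).tsum_eq_zero_add]; simp

/-- The recursion n² aₙ = aₙ₋₁ says that x = Σ ζⁿ/n!² solves x'' = exp(w) x. -/
theorem entire_euler_euler_reg (ζ : ℂ) :
    entire (eulerCoeff (eulerCoeff regCoeff)) ζ = ζ * entire regCoeff ζ := by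
  rw [entire_succ regCoeff_decay.euler.euler, entire, ← tsum_mul_left]
  simp only [eulerCoeff, regCoeff, Nat.cast_zero, zero_mul, zero_add]
  congr 1; ext n
  have : (n ! : ℂ) ≠ 0 := by exact_mod_cast n.factorial_ne_zero
  have h1 : ((n : ℂ) + 1) ≠ 0 := by exact_mod_cast n.succ_ne_zero
  rw [Nat.factorial_succ]; push_cast
  field_simp
  ring

/-- The term −2x' cancels the cross term in (w x)'' = w x'' + 2x', so that w x plus this series is
the second solution. The harmonic numbers solve the resulting recursion. -/
theorem entire_euler_euler_log (ζ : ℂ) :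
    entire (eulerCoeff (eulerCoeff logCoeff)) ζ =
      ζ * entire logCoeff ζ - 2 * entire (eulerCoeff regCoeff) ζ := by
  rw [entire_succ logCoeff_decay.euler.euler, entire_succ regCoeff_decay.euler]
  simp only [eulerCoeff, Nat.cast_zero, zero_mul, zero_add]
  rw [entire, ← tsum_mul_left, ← tsum_mul_left, ← Summable.tsum_sub]
  · congr 1; ext n
    have : (n ! : ℂ) ≠ 0 := by exact_mod_cast n.factorial_ne_zero
    have h1 : ((n : ℂ) + 1) ≠ 0 := by exact_mod_cast n.succ_ne_zero
    simp only [logCoeff, regCoeff, harmonic_succ, Nat.factorial_succ]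
    push_cast
    field_simp
    ring
  · exact (logCoeff_decay.summable ζ).mul_left ζ
  · exact (((summable_nat_add_iff 1).2 (regCoeff_decay.euler.summable ζ))).mul_left 2

/-! ### The fundamental solution and its monodromy -/

/-- The coefficient matrix of `λ • exp w • ξ` in the coordinate `w = log z`. -/
def coeffMat (c w : ℂ) : Mat2 := !![0, Complex.exp w; c, 0]

theorem exp_smul_potential (c w : ℂ) (l : Circle) :
    Complex.exp w • potential c l (Complex.exp w) = (l : ℂ)⁻¹ • coeffMat c w := by
  have := Complex.exp_ne_zero w
  ext i j; fin_cases i <;> fin_cases j <;> simp [potential, coeffMat]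
  · ring
  · field_simp

theorem coeffMat_periodic (c w : ℂ) (n : ℤ) :
    coeffMat c (w + 2 * Real.pi * Complex.I * n) = coeffMat c w := by
  have : Complex.exp (w + 2 * Real.pi * Complex.I * n) = Complex.exp w :=
    Complex.exp_eq_exp_iff_exists_int.2 ⟨n, by ring⟩
  rw [coeffMat, this, coeffMat]

theorem trace_coeffMat (c w : ℂ) : (coeffMat c w).trace = 0 := by
  simp [coeffMat, trace_fin_two]

/-- The equation x'' = exp(w) x has no first order term, so the Wronskian is constant; the explicit
multiples of w cancel in it, which leaves an expression in ζ alone. -/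
theorem wronskian_eq_one (ζ : ℂ) :
    entire regCoeff ζ * (entire regCoeff ζ + entire (eulerCoeff logCoeff) ζ) -
      entire (eulerCoeff regCoeff) ζ * entire logCoeff ζ = 1 := by
  set D : ℂ → ℂ := fun ζ =>
    entire regCoeff ζ * (entire regCoeff ζ + entire (eulerCoeff logCoeff) ζ) -
      entire (eulerCoeff regCoeff) ζ * entire logCoeff ζ with hD
  have hDc : Continuous D := by
    have h1 := regCoeff_decay.continuous
    have h2 := regCoeff_decay.euler.continuous
    have h3 := logCoeff_decay.continuous
    have h4 := logCoeff_decay.euler.continuous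
    fun_prop
  have hd : ∀ w, HasDerivAt (fun w => D (1 * Complex.exp w)) 0 w := by
    intro w
    have h1 := regCoeff_decay.hasDerivAt 1 w
    have h2 := regCoeff_decay.euler.hasDerivAt 1 w
    have h3 := logCoeff_decay.hasDerivAt 1 w
    have h4 := logCoeff_decay.euler.hasDerivAt 1 w
    rw [entire_euler_euler_reg] at h2
    rw [entire_euler_euler_log] at h4
    refine ((h1.fun_mul (h1.fun_add h4)).fun_sub (h2.fun_mul h3)).congr_deriv ?_
    ring
  have hconst : ∀ w, D (1 * Complex.exp w) = D (1 * Complex.exp 0) := fun w =>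
    is_const_of_deriv_eq_zero (fun w => (hd w).differentiableAt) (fun w => (hd w).deriv) w 0
  have hne : ∀ ζ ∈ ({0}ᶜ : Set ℂ), D ζ = D (1 * Complex.exp 0) := by
    intro ζ hζ
    rw [← hconst (Complex.log ζ), Complex.exp_log hζ, one_mul]
  -- The exponential misses only ζ = 0. Continuity carries the constant to that point, where the
  -- value can be read off the series.
  have hall : D = fun _ => D (1 * Complex.exp 0) :=
    Continuous.ext_on (dense_compl_singleton 0) hDc continuous_const hne
  have h0 : D 0 = 1 := by
    simp [hD, entire_zero, regCoeff, eulerCoeff]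
  calc D ζ = D 0 := by rw [congrFun hall ζ, ← congrFun hall 0]
    _ = 1 := h0

/-- The fundamental solution of `Φ' = λ⁻¹ Φ A` with a logarithmic second row. -/
def fundSol (c : ℂ) (l : Circle) (w : ℂ) : Mat2 :=
  !![entire regCoeff (c * (l : ℂ)⁻¹ ^ 2 * Complex.exp w),
    (l / c) * entire (eulerCoeff regCoeff) (c * (l : ℂ)⁻¹ ^ 2 * Complex.exp w);
    w * entire regCoeff (c * (l : ℂ)⁻¹ ^ 2 * Complex.exp w) +
      entire logCoeff (c * (l : ℂ)⁻¹ ^ 2 * Complex.exp w),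
    (l / c) * (entire regCoeff (c * (l : ℂ)⁻¹ ^ 2 * Complex.exp w) +
      w * entire (eulerCoeff regCoeff) (c * (l : ℂ)⁻¹ ^ 2 * Complex.exp w) +
      entire (eulerCoeff logCoeff) (c * (l : ℂ)⁻¹ ^ 2 * Complex.exp w))]

theorem hasMatDerivAt_fundSol {c : ℂ} (hc : c ≠ 0) (l : Circle) (w : ℂ) :
    HasMatDerivAt (fundSol c l) (fundSol c l w * ((l : ℂ)⁻¹ • coeffMat c w)) w := by
  have hl : (l : ℂ) ≠ 0 := l.coe_ne_zero
  have h1 := regCoeff_decay.hasDerivAt (c * (l : ℂ)⁻¹ ^ 2) w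
  have h2 := regCoeff_decay.euler.hasDerivAt (c * (l : ℂ)⁻¹ ^ 2) w
  have h3 := logCoeff_decay.hasDerivAt (c * (l : ℂ)⁻¹ ^ 2) w
  have h4 := logCoeff_decay.euler.hasDerivAt (c * (l : ℂ)⁻¹ ^ 2) w
  have h5 := hasDerivAt_id' w
  rw [entire_euler_euler_reg] at h2
  rw [entire_euler_euler_log] at h4
  intro i j
  fin_cases i <;> fin_cases j
  · refine h1.congr_deriv ?_
    simp [fundSol, coeffMat, mul_apply, Fin.sum_univ_two]
    field_simp
  · refine (h2.const_mul ((l : ℂ) / c)).congr_deriv ?_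
    simp [fundSol, coeffMat, mul_apply, Fin.sum_univ_two]
    field_simp
  · refine ((h5.fun_mul h1).fun_add h3).congr_deriv ?_
    simp [fundSol, coeffMat, mul_apply, Fin.sum_univ_two]
    field_simp
  · refine (((h1.fun_add (h5.fun_mul h2)).fun_add h4).const_mul ((l : ℂ) / c)).congr_deriv ?_
    simp [fundSol, coeffMat, mul_apply, Fin.sum_univ_two]
    field_simp
    ring

theorem det_fundSol (c : ℂ) (l : Circle) (w : ℂ) : (fundSol c l w).det = l / c := by
  have := wronskian_eq_one (c * (l : ℂ)⁻¹ ^ 2 * Complex.exp w)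
  simp only [fundSol, det_fin_two_of]
  linear_combination (l / c : ℂ) * this

theorem continuous_fundSol (c : ℂ) (i j : Fin 2) :
    Continuous fun p : ℂ × Circle => fundSol c p.2 p.1 i j := by
  have h1 := regCoeff_decay.continuous
  have h2 := regCoeff_decay.euler.continuous
  have h3 := logCoeff_decay.continuous
  have h4 := logCoeff_decay.euler.continuous
  have h5 : Continuous fun p : ℂ × Circle => c * (p.2 : ℂ)⁻¹ ^ 2 * Complex.exp p.1 := by
    refine (continuous_const.mul (Continuous.pow ?_ 2)).mul (by fun_prop)
    exact Continuous.inv₀ (by fun_prop) fun p => p.2.coe_ne_zero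
  fin_cases i <;> fin_cases j <;> simp [fundSol, -inv_pow] <;> fun_prop

/-- Only the explicit w in the second row sees the translation; it adds a multiple of the first row
to the second. -/
theorem fundSol_add_period (c : ℂ) (l : Circle) (w : ℂ) (n : ℤ) :
    fundSol c l (w + 2 * Real.pi * Complex.I * n) =
      (1 + (2 * Real.pi * Complex.I * n : ℂ) • !![0, 0; 1, 0]) * fundSol c l w := by
  have : Complex.exp (w + 2 * Real.pi * Complex.I * n) = Complex.exp w :=
    Complex.exp_eq_exp_iff_exists_int.2 ⟨n, by ring⟩
  simp only [fundSol, this]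
  ext i j; fin_cases i <;> fin_cases j <;> simp [mul_apply, Fin.sum_univ_two, one_apply] <;> ring

/-- Two solutions differ by a constant matrix on the left. -/
theorem solution_mul_adjugate_const {c : ℂ} {l : Circle} {U : Set ℂ} (hU : IsOpen U)
    (hUc : IsPreconnected U) {L M : ℂ → Mat2}
    (hL : ∀ w ∈ U, HasMatDerivAt L (L w * ((l : ℂ)⁻¹ • coeffMat c w)) w)
    (hM : ∀ w ∈ U, HasMatDerivAt M (M w * ((l : ℂ)⁻¹ • coeffMat c w)) w) {w w₀ : ℂ}
    (hw : w ∈ U) (hw₀ : w₀ ∈ U) : L w * (M w).adjugate = L w₀ * (M w₀).adjugate := by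
  have hd : ∀ w ∈ U, HasMatDerivAt (fun w => L w * (M w).adjugate) 0 w := by
    intro w hw
    have h := (hL w hw).mul (hM w hw).adjugate
    have h0 : ((l : ℂ)⁻¹ • coeffMat c w).adjugate = -((l : ℂ)⁻¹ • coeffMat c w) :=
      adjugate_eq_neg_of_trace_eq_zero (by rw [trace_smul, trace_coeffMat, smul_zero])
    rw [adjugate_mul_distrib, h0] at h
    have e : L w * ((l : ℂ)⁻¹ • coeffMat c w) * (M w).adjugate +
      L w * (-((l : ℂ)⁻¹ • coeffMat c w) * (M w).adjugate) = 0 := by noncomm_ring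
    rwa [e] at h
  ext i j
  exact hU.is_const_of_deriv_eq_zero hUc
    (fun w hw => (hd w hw i j).differentiableAt.differentiableWithinAt)
    (fun w hw => (hd w hw i j).deriv) hw hw₀

/-- A solution is determined by its value at one point of a preconnected open set. -/
theorem solution_eq_mul_fundSol {c : ℂ} (hc : c ≠ 0) {l : Circle} {U : Set ℂ} (hU : IsOpen U)
    (hUc : IsPreconnected U) {L : ℂ → Mat2}
    (hL : ∀ w ∈ U, HasMatDerivAt L (L w * ((l : ℂ)⁻¹ • coeffMat c w)) w) {w w₀ : ℂ}
    (hw : w ∈ U) (hw₀ : w₀ ∈ U) :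
    L w = (c / l : ℂ) • (L w₀ * (fundSol c l w₀).adjugate * fundSol c l w) := by
  have hconst := solution_mul_adjugate_const hU hUc hL
    (fun w _ => hasMatDerivAt_fundSol hc l w) hw hw₀
  have hl : (l : ℂ) ≠ 0 := l.coe_ne_zero
  rw [← hconst, mul_assoc, adjugate_mul, det_fundSol, mul_smul_comm, smul_smul, mul_one]
  have : (c / l : ℂ) * (l / c) = 1 := by field_simp
  rw [this, one_smul]

/-- The monodromy of every solution is unipotent and nontrivial. -/
theorem solution_monodromy {c : ℂ} (hc : c ≠ 0) {l : Circle} {U : Set ℂ} (hU : IsOpen U)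
    (hUc : IsPreconnected U) {L : ℂ → Mat2}
    (hL : ∀ w ∈ U, HasMatDerivAt L (L w * ((l : ℂ)⁻¹ • coeffMat c w)) w) {w : ℂ}
    {n : ℤ} (hn : n ≠ 0) (hw : w ∈ U) (hw' : w + 2 * Real.pi * Complex.I * n ∈ U) :
    ∃ N : Mat2, N ≠ 0 ∧ N * N = 0 ∧ L (w + 2 * Real.pi * Complex.I * n) = L w * (1 + N) := by
  have hl : (l : ℂ) ≠ 0 := l.coe_ne_zero
  set τ : ℂ := 2 * Real.pi * Complex.I * n with hτ
  have hτ0 : τ ≠ 0 := by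
    rw [hτ]
    exact mul_ne_zero Complex.two_pi_I_ne_zero (by exact_mod_cast hn)
  set P := fundSol c l w with hP
  set e : Mat2 := !![0, 0; 1, 0]
  have he : e * e = 0 := by
    ext i j; fin_cases i <;> fin_cases j <;> simp [e, mul_apply, Fin.sum_univ_two]
  have hPa : P * P.adjugate = (l / c : ℂ) • 1 := by rw [mul_adjugate, det_fundSol]
  have haP : P.adjugate * P = (l / c : ℂ) • 1 := by rw [adjugate_mul, det_fundSol]
  have hcl : (c / l : ℂ) * (l / c) = 1 := by field_simp
  -- This is τ P⁻¹ e P, because det P = l / c. It is the left monodromy 1 + τ e of the fundamental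
  -- solution, moved to the right side of L(w).
  refine ⟨(c / l * τ : ℂ) • (P.adjugate * e * P), ?_, ?_, ?_⟩
  · intro h0
    have h1 : P * ((c / l * τ : ℂ) • (P.adjugate * e * P)) * P.adjugate = τ • (l / c : ℂ) • e := by
      calc _ = (c / l * τ : ℂ) • (P * P.adjugate * e * (P * P.adjugate)) := by
            simp only [mul_smul_comm, smul_mul_assoc, mul_assoc]
        _ = _ := by
            rw [hPa]; simp only [mul_smul_comm, smul_mul_assoc, mul_one, one_mul, smul_smul]
            congr 1; field_simp
    rw [h0, mul_zero, zero_mul] at h1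
    have h2 := congrFun (congrFun h1 1) 0
    simp [e, hτ0, hl, hc] at h2
  · have : P.adjugate * e * P * (P.adjugate * e * P) = 0 := by
      calc _ = P.adjugate * e * (P * P.adjugate) * e * P := by simp only [mul_assoc]
        _ = (l / c : ℂ) • (P.adjugate * (e * e) * P) := by
          rw [hPa]; simp only [mul_smul_comm, smul_mul_assoc, mul_one, mul_assoc]
        _ = 0 := by rw [he]; simp
    rw [smul_mul_smul_comm, this, smul_zero]
  · rw [solution_eq_mul_fundSol hc hU hUc hL hw' hw, fundSol_add_period]
    rw [← hP, mul_assoc, ← mul_assoc P.adjugate, mul_add, mul_one, add_mul, haP, mul_add, mul_add,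
      smul_add]
    simp only [mul_smul_comm, smul_mul_assoc, mul_one, smul_smul, hcl, one_smul, mul_assoc, hτ, e]

section DiskAlgebra

open MeasureTheory AddCircle

/-! ### Continuous functions on the circle and the disk algebra -/

/-- Continuous functions on the unit circle. -/
abbrev CircFun : Type := C(Circle, ℂ)

/-- The coordinate function `λ` on the circle. -/
def lam : CircFun := ⟨fun l => (l : ℂ), by fun_prop⟩

/-- The function `λ⁻¹` on the circle. -/
def lamInv : CircFun := ⟨fun l => (l : ℂ)⁻¹, Continuous.inv₀ (by fun_prop) fun l => l.coe_ne_zero⟩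

@[simp] theorem lam_apply (l : Circle) : lam l = l := rfl

@[simp] theorem lamInv_apply (l : Circle) : lamInv l = (l : ℂ)⁻¹ := rfl

theorem lam_mul_lamInv : lam * lamInv = 1 := by
  ext l; simp

local instance : Fact (0 < 2 * Real.pi) := ⟨Real.two_pi_pos⟩

theorem integrable_fourier_mul (n : ℤ) (f : CircFun) :
    Integrable (fun x : AddCircle (2 * Real.pi) => fourier (-n) x * f (toCircle x))
      haarAddCircle := by
  have : Continuous fun x : AddCircle (2 * Real.pi) => fourier (-n) x * f (toCircle x) :=
    (map_continuous (fourier (-n))).mul ((map_continuous f).comp continuous_toCircle)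
  exact this.integrable_of_hasCompactSupport (HasCompactSupport.of_compactSpace _)

/-- The `n`-th Fourier coefficient of a continuous function on the circle. -/
def coef (n : ℤ) : CircFun →L[ℂ] ℂ :=
  LinearMap.mkContinuous
    { toFun := fun f => ∫ x : AddCircle (2 * Real.pi), fourier (-n) x * f (toCircle x)
        ∂haarAddCircle
      map_add' := fun f g => by
        rw [← integral_add (integrable_fourier_mul n f) (integrable_fourier_mul n g)]
        simp [mul_add]
      map_smul' := fun a f => by
        rw [RingHom.id_apply, smul_eq_mul, ← integral_const_mul]
        simp [mul_left_comm] } 1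
    fun f => by
      have := norm_integral_le_of_norm_le_const 
        (μ := (haarAddCircle : Measure (AddCircle (2 * Real.pi))))
        (f := fun x => fourier (-n) x * f (toCircle x)) (C := ‖f‖)
        (Filter.Eventually.of_forall fun x => by
          rw [norm_mul, fourier_apply, Circle.norm_coe, one_mul]; exact f.norm_coe_le_norm _)
      simpa using this

theorem coef_apply (n : ℤ) (f : CircFun) :
    coef n f = ∫ x : AddCircle (2 * Real.pi), fourier (-n) x * f (toCircle x) ∂haarAddCircle :=
  rfl

theorem coef_eq_fourierCoeff (n : ℤ) (f : CircFun) :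
    coef n f = fourierCoeff (fun x : AddCircle (2 * Real.pi) => f (toCircle x)) n := rfl

theorem coef_lam_mul (n : ℤ) (f : CircFun) : coef n (lam * f) = coef (n - 1) f := by
  rw [coef_apply, coef_apply]
  congr 1; ext x
  have : (fourier (-(n - 1)) x : ℂ) = fourier (-n) x * toCircle x := by
    rw [show -(n - 1) = -n + 1 by ring, fourier_add, fourier_one]
  rw [this, ContinuousMap.mul_apply, lam_apply, mul_assoc]

theorem coef_lam_pow_mul (n : ℤ) (k : ℕ) (f : CircFun) :
    coef n (lam ^ k * f) = coef (n - k) f := by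
  induction k generalizing n with
  | zero => simp
  | succ k ih =>
    rw [pow_succ', mul_assoc, coef_lam_mul, ih]
    congr 2; push_cast; ring

theorem coef_one (n : ℤ) : coef n 1 = if n = 0 then 1 else 0 := by
  rw [coef_eq_fourierCoeff]
  have h := congrFun (fourierCoeff_fourier (T := 2 * Real.pi) 0) n
  have h' : (fun x : AddCircle (2 * Real.pi) => (1 : CircFun) (toCircle x)) =
      fourier (T := 2 * Real.pi) 0 := by
    ext x; simp
  rw [h', h, Pi.single_apply]

theorem coef_lam_pow (n : ℤ) (k : ℕ) : coef n (lam ^ k) = if n = k then 1 else 0 := by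
  have := coef_lam_pow_mul n k 1
  rw [mul_one, coef_one] at this
  rw [this]; simp [sub_eq_zero]

/-- Vanishing coefficients are summable, so the Fourier series converges to the function itself and
not merely in mean square. -/
theorem circFun_eq_zero {f : CircFun} (h : ∀ n, coef n f = 0) : f = 0 := by
  set g : C(AddCircle (2 * Real.pi), ℂ) :=
    ⟨fun x => f (toCircle x), (map_continuous f).comp continuous_toCircle⟩ with hg
  have h0 : fourierCoeff g = 0 := funext fun n => h n
  have h1 := hasSum_fourier_series_of_summable (f := g) (by rw [h0]; exact summable_zero)
  rw [h0] at h1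
  simp only [Pi.zero_apply, zero_smul] at h1
  have h2 : g = 0 := h1.unique hasSum_zero
  ext l
  obtain ⟨x, rfl⟩ := homeomorphCircle'.surjective l
  have h3 := DFunLike.congr_fun h2 x
  have h4 : toCircle x = homeomorphCircle' x := by
    induction x using QuotientAddGroup.induction_on with
    | H t =>
      rw [homeomorphCircle'_apply_mk]
      erw [toCircle_apply_mk]
      congr 1
      field_simp
  rw [← h4]; exact h3

theorem circFun_ext {f g : CircFun} (h : ∀ n, coef n f = coef n g) : f = g :=
  sub_eq_zero.1 (circFun_eq_zero fun n => by rw [map_sub, h, sub_self])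

theorem coef_star (n : ℤ) (f : CircFun) :
    coef n (star f) = (starRingEnd ℂ) (coef (-n) f) := by
  rw [coef_apply, coef_apply, ← integral_conj]
  congr 1; ext x
  simp only [map_mul, ContinuousMap.star_apply, RCLike.star_def]
  rw [← fourier_neg, neg_neg]

theorem toCircle_pi : toCircle ((Real.pi : ℝ) : AddCircle (2 * Real.pi)) = Circle.exp Real.pi := by
  rw [toCircle_apply_mk]; congr 1; field_simp

/-- Fourier coefficients of even and odd functions. -/
theorem coef_parity {f : CircFun} {s : ℂ} (h : ∀ l, f (Circle.exp Real.pi * l) = s * f l) (n : ℤ) :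
    coef n f = s * (-1) ^ n * coef n f := by
  conv_lhs => rw [coef_apply, ← integral_add_left_eq_self _
    ((Real.pi : ℝ) : AddCircle (2 * Real.pi))]
  rw [coef_apply, ← integral_const_mul]
  congr 1; ext x
  rw [toCircle_add, toCircle_pi, h, fourier_apply, fourier_apply, smul_add, toCircle_add,
    toCircle_zsmul, toCircle_pi]
  have : ((Circle.exp Real.pi ^ (-n) : Circle) : ℂ) = (-1) ^ n := by
    rw [Circle.coe_zpow, Circle.coe_exp, Complex.exp_pi_mul_I, _root_.zpow_neg, ← _root_.inv_zpow]
    norm_num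
  rw [Circle.coe_mul, this]; ring

/-- The disk algebra: the closed subalgebra of the continuous functions on the circle that is
generated by `λ`. -/
def diskAlg : Subalgebra ℂ CircFun := Algebra.elemental ℂ lam

theorem isClosed_diskAlg : IsClosed (diskAlg : Set CircFun) := Algebra.elemental.isClosed ℂ lam

theorem lam_mem_diskAlg : lam ∈ diskAlg := Algebra.elemental.self_mem ℂ lam

/-- Density principle: a closed linear condition on the disk algebra need only be tested on the
powers of λ. -/
theorem diskAlg_le {K : Submodule ℂ CircFun} (hK : IsClosed (K : Set CircFun))
    (h : ∀ k : ℕ, lam ^ k ∈ K) {f : CircFun} (hf : f ∈ diskAlg) : f ∈ K := by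
  have h1 : (Algebra.adjoin ℂ {lam} : Set CircFun) ⊆ K := by
    intro g hg
    rw [Algebra.adjoin_singleton_eq_range_aeval] at hg
    obtain ⟨p, rfl⟩ := hg
    simp only [AlgHom.toRingHom_eq_coe, RingHom.coe_coe, Polynomial.aeval_eq_sum_range]
    exact Submodule.sum_mem _ fun k _ => K.smul_mem _ (h k)
  exact closure_minimal h1 hK hf

theorem coef_eq_zero_of_neg {f : CircFun} (hf : f ∈ diskAlg) {n : ℤ} (hn : n < 0) :
    coef n f = 0 := by
  refine diskAlg_le (K := (coef n).ker) (coef n).isClosed_ker (fun k => ?_) hf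
  rw [LinearMap.mem_ker, ContinuousLinearMap.coe_coe, coef_lam_pow, if_neg]
  omega

/-- The Fourier coefficients of a product in the disk algebra. -/
theorem coef_mul {f g : CircFun} (hf : f ∈ diskAlg) (hg : g ∈ diskAlg) (n : ℕ) :
    coef n (f * g) = ∑ p ∈ Finset.HasAntidiagonal.antidiagonal n, coef p.1 f * coef p.2 g := by
  -- For fixed g both sides are continuous and linear in f, so it suffices to take f = λᵏ, where
  -- multiplication merely shifts the coefficients of g.
  set T : CircFun →L[ℂ] ℂ := (coef n).comp ((ContinuousLinearMap.mul ℂ CircFun).flip g) -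
    ∑ p ∈ Finset.HasAntidiagonal.antidiagonal n, coef p.2 g • coef p.1 with hT
  have hT' : ∀ f, T f = coef n (f * g) -
      ∑ p ∈ Finset.HasAntidiagonal.antidiagonal n, coef p.1 f * coef p.2 g := by
    intro f; simp [hT, mul_comm]
  have : f ∈ T.ker := by
    refine diskAlg_le (K := T.ker) T.isClosed_ker (fun k => ?_) hf
    rw [LinearMap.mem_ker, ContinuousLinearMap.coe_coe, hT', coef_lam_pow_mul, sub_eq_zero]
    by_cases hk : k ≤ n
    · rw [Finset.sum_eq_single (k, n - k)]
      · rw [coef_lam_pow, if_pos rfl, one_mul]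
        push_cast [hk]; rfl
      · rintro ⟨i, j⟩ hij hne
        rw [Finset.HasAntidiagonal.mem_antidiagonal] at hij
        rw [coef_lam_pow, if_neg, zero_mul]
        intro h
        apply hne
        have : i = k := by exact_mod_cast h
        simp only [Prod.mk.injEq]; simp only at hij; omega
      · intro h; exact absurd (Finset.HasAntidiagonal.mem_antidiagonal.2 (by simp; omega)) h
    · rw [coef_eq_zero_of_neg hg (by omega), Finset.sum_eq_zero]
      rintro ⟨i, j⟩ hij
      rw [Finset.HasAntidiagonal.mem_antidiagonal] at hij
      rw [coef_lam_pow, if_neg, zero_mul]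
      simp only at hij ⊢; omega
  rw [LinearMap.mem_ker, ContinuousLinearMap.coe_coe, hT', sub_eq_zero] at this
  exact this

theorem coef_zero_mul {f g : CircFun} (hf : f ∈ diskAlg) (hg : g ∈ diskAlg) :
    coef 0 (f * g) = coef 0 f * coef 0 g := by
  have := coef_mul hf hg 0
  simpa using this

/-- The leading coefficient of a product in the disk algebra. -/
theorem coef_add_mul {f g : CircFun} (hf : f ∈ diskAlg) (hg : g ∈ diskAlg) {m n : ℕ}
    (hm : ∀ k < m, coef k f = 0) (hn : ∀ k < n, coef k g = 0) :
    coef ((m + n : ℕ) : ℤ) (f * g) = coef m f * coef n g := by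
  rw [coef_mul hf hg, Finset.sum_eq_single (m, n)]
  · rintro ⟨i, j⟩ hij hne
    rw [Finset.HasAntidiagonal.mem_antidiagonal] at hij
    simp only at hij
    rcases lt_or_ge i m with h | h
    · rw [hm i h, zero_mul]
    · have : j < n := by
        by_contra hj
        apply hne
        simp only [Prod.mk.injEq]; omega
      rw [hn j this, mul_zero]
  · intro h
    exact absurd (Finset.HasAntidiagonal.mem_antidiagonal.2 (by simp)) h

/-- Boundary values of functions that are continuous on the closed disk and holomorphic inside
belong to the disk algebra. -/
theorem mem_diskAlg_of_extension {f : CircFun} {E : ℂ → ℂ}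
    (hc : ContinuousOn E (Metric.closedBall 0 1)) (hd : DifferentiableOn ℂ E (Metric.ball 0 1))
    (hf : ∀ l : Circle, E l = f l) : f ∈ diskAlg := by
  refine isClosed_diskAlg.closure_subset (Metric.mem_closure_iff.2 fun ε hε => ?_)
  have huc := (isCompact_closedBall (0 : ℂ) 1).uniformContinuousOn_of_continuous hc
  obtain ⟨δ, hδ, hδ'⟩ := Metric.uniformContinuousOn_iff.1 huc (ε / 3) (by positivity)
  -- The function is approximated by its dilate E(rλ), and the dilate by Taylor polynomials, which
  -- converge uniformly on the ball of radius r' > r.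
  obtain ⟨r, hr0, hr1, hrδ⟩ : ∃ r : ℝ, 0 < r ∧ r < 1 ∧ 1 - r < δ :=
    ⟨max (1 / 2) (1 - δ / 2), by positivity, by
      rw [max_lt_iff]; constructor <;> linarith [hδ], by
      linarith [le_max_right (1 / 2) (1 - δ / 2)]⟩
  obtain ⟨r', hr', hr'1⟩ := exists_between hr1
  have hcl : DiffContOnCl ℂ E (Metric.ball 0 1) := by
    refine ⟨hd, ?_⟩
    rwa [closure_ball _ one_ne_zero]
  have hps := DiffContOnCl.hasFPowerSeriesOnBall (R := 1) (c := 0) (f := E)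
    (by simpa using hcl) one_pos
  have hun := hps.tendstoUniformlyOn (r' := ⟨r', by linarith⟩)
    (ENNReal.coe_lt_coe.2 hr'1)
  obtain ⟨n, hn⟩ := (Metric.tendstoUniformlyOn_iff.1 hun (ε / 3) (by positivity)).exists
  set p := cauchyPowerSeries E 0 ((1 : NNReal) : ℝ)
  refine ⟨∑ k ∈ Finset.range n, (p.coeff k * (r : ℂ) ^ k) • lam ^ k, ?_, ?_⟩
  · exact Subalgebra.sum_mem _ fun k _ => Subalgebra.smul_mem _ (pow_mem lam_mem_diskAlg k) _
  · rw [ContinuousMap.dist_lt_iff hε]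
    intro l
    have hrl : ‖(r : ℂ) * l‖ = r := by
      rw [norm_mul, Circle.norm_coe, Complex.norm_real, Real.norm_eq_abs, abs_of_pos hr0, mul_one]
    have h1 : dist (E l) (E (r * l)) < ε / 3 := by
      apply hδ'
      · rw [mem_closedBall_zero_iff, Circle.norm_coe]
      · rw [mem_closedBall_zero_iff, hrl]; exact hr1.le
      · have : (l : ℂ) - r * l = ((1 - r : ℝ) : ℂ) * l := by push_cast; ring
        rw [dist_eq_norm, this, norm_mul, Circle.norm_coe, mul_one, Complex.norm_real,
          Real.norm_eq_abs, abs_of_pos (by linarith)]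
        exact hrδ
    have h2 := hn (r * l) (by rw [mem_ball_zero_iff, hrl]; exact hr')
    rw [zero_add] at h2
    have h3 : (∑ k ∈ Finset.range n, (p.coeff k * (r : ℂ) ^ k) • lam ^ k : CircFun) l =
        p.partialSum n (r * l) := by
      rw [ContinuousMap.sum_apply, FormalMultilinearSeries.partialSum]
      refine Finset.sum_congr rfl fun k _ => ?_
      rw [FormalMultilinearSeries.apply_eq_pow_smul_coeff]
      simp only [ContinuousMap.smul_apply, ContinuousMap.pow_apply, lam_apply, smul_eq_mul]
      ring
    rw [h3, ← hf]
    linarith [dist_triangle (E l) (E (r * l)) (p.partialSum n (r * l))]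

end DiskAlgebra

/-! ### Curves of loops in the Banach algebra of continuous functions -/

/-- A scalar loop as a continuous function (zero if it is not continuous). -/
def circFunOf (g : Circle → ℂ) : CircFun :=
  open scoped Classical in if h : Continuous g then ⟨g, h⟩ else 0

theorem circFunOf_apply {g : Circle → ℂ} (h : Continuous g) (l : Circle) :
    circFunOf g l = g l := by
  rw [circFunOf, dif_pos h]; rfl

/-- A matrix loop as a matrix of continuous functions. -/
def loopFun (g : Loop) : Matrix (Fin 2) (Fin 2) CircFun :=
  Matrix.of fun i j => circFunOf fun l => g l i j

/-- Evaluation of a continuous function at a point of the circle. -/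
def ev (l : Circle) : CircFun →+* ℂ where
  toFun f := f l
  map_one' := rfl
  map_mul' _ _ := rfl
  map_zero' := rfl
  map_add' _ _ := rfl

@[simp] theorem ev_apply (l : Circle) (f : CircFun) : ev l f = f l := rfl

/-- A matrix loop all of whose entries are continuous. -/
def IsContLoop (g : Loop) : Prop := ∀ i j, Continuous fun l => g l i j

theorem loopFun_apply {g : Loop} (h : IsContLoop g) (i j : Fin 2) (l : Circle) :
    loopFun g i j l = g l i j := circFunOf_apply (h i j) l

theorem map_loopFun {g : Loop} (h : IsContLoop g) (l : Circle) :
    (loopFun g).map (ev l) = g l := by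
  ext i j; exact loopFun_apply h i j l

theorem circMat_ext {M N : Matrix (Fin 2) (Fin 2) CircFun}
    (h : ∀ l, M.map (ev l) = N.map (ev l)) : M = N := by
  ext i j l
  exact congrFun (congrFun (h l) i) j

theorem map_ev_mul (M N : Matrix (Fin 2) (Fin 2) CircFun) (l : Circle) :
    (M * N).map (ev l) = M.map (ev l) * N.map (ev l) := Matrix.map_mul

theorem map_ev_adjugate (M : Matrix (Fin 2) (Fin 2) CircFun) (l : Circle) :
    M.adjugate.map (ev l) = (M.map (ev l)).adjugate := by
  have := RingHom.map_adjugate (ev l) M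
  simpa using this

theorem det_loopFun {g : Loop} (h : IsContLoop g) (hd : ∀ l, (g l).det = 1) :
    (loopFun g).det = 1 := by
  ext l
  have h1 := RingHom.map_det (ev l) (loopFun g)
  rw [RingHom.mapMatrix_apply, map_loopFun h, hd] at h1
  exact h1

/-- The map t ↦ exp(it) is open, so every neighbourhood in the angle covers a neighbourhood on the
circle and continuity descends. -/
theorem continuousAt_of_comp_exp {f : ℂ × Circle → ℂ} {w : ℂ} {t : ℝ}
    (h : ContinuousAt (fun p : ℂ × ℝ => f (p.1, Circle.exp p.2)) (w, t)) :
    ContinuousAt f (w, Circle.exp t) := by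
  have ho : IsOpenMap (Prod.map id Circle.exp : ℂ × ℝ → ℂ × Circle) :=
    IsOpenMap.id.prodMap isLocalHomeomorph_circleExp.isOpenMap
  have h1 := ho.nhds_le (w, t)
  exact (Filter.tendsto_map' h).mono_left h1

theorem continuous_of_comp_exp {f : Circle → ℂ} (h : Continuous fun t : ℝ => f (Circle.exp t)) :
    Continuous f := by
  rw [continuous_iff_continuousAt]
  intro l
  obtain ⟨t, rfl⟩ := Circle.exp_surjective l
  exact (Filter.tendsto_map' h.continuousAt).mono_left
    (isLocalHomeomorph_circleExp.isOpenMap.nhds_le t)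

theorem IsSmoothLoop.isContLoop {g : Loop} (h : IsSmoothLoop g) : IsContLoop g :=
  fun i j => continuous_of_comp_exp (h i j).continuous

/-- Pointwise derivatives that are jointly continuous give a derivative in the supremum norm.
Compactness of the circle makes g' close to g' x uniformly in λ, and the mean value inequality turns
this into an estimate of the remainder. -/
theorem hasDerivAt_circFunOf {𝕜 : Type*} [RCLike 𝕜] [NormedSpace 𝕜 ℂ]
    {g g' : 𝕜 → Circle → ℂ} {x : 𝕜} {V : Set 𝕜} (hV : V ∈ nhds x)
    (hg : ∀ s ∈ V, ∀ l, HasDerivAt (fun s => g s l) (g' s l) s)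
    (hc : ∀ s ∈ V, Continuous (g s))
    (hg' : ContinuousOn (fun p : 𝕜 × Circle => g' p.1 p.2) (V ×ˢ Set.univ)) :
    HasDerivAt (fun s => circFunOf (g s)) (circFunOf (g' x)) x := by
  have hxV : x ∈ V := mem_of_mem_nhds hV
  have hc' : Continuous (g' x) := by
    rw [← continuousOn_univ]
    exact hg'.comp (f := fun l => (x, l)) (by fun_prop) fun l _ => ⟨hxV, trivial⟩
  have htu : TendstoUniformly g' (g' x) (nhds x) := ContinuousOn.tendstoUniformly hV hg'
  rw [hasDerivAt_iff_isLittleO, Asymptotics.isLittleO_iff]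
  intro ε hε
  obtain ⟨δ, hδ, hδ'⟩ := Metric.mem_nhds_iff.1
    (Filter.inter_mem hV (Metric.tendstoUniformly_iff.1 htu ε hε))
  filter_upwards [Metric.ball_mem_nhds x hδ] with s hs
  rw [ContinuousMap.norm_le _ (by positivity)]
  intro l
  have h1 := Convex.norm_image_sub_le_of_norm_hasDerivWithin_le (𝕜 := 𝕜) (C := ε)
    (s := Metric.ball x δ) (f := fun s => g s l - (s - x) • g' x l)
    (f' := fun s => g' s l - g' x l) (x := x) (y := s)
    (fun y hy => by
      have h2 := ((hg y (hδ' hy).1 l).fun_sub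
        (((hasDerivAt_id' y).sub_const x).smul_const (g' x l)))
      rw [one_smul] at h2
      exact h2.hasDerivWithinAt)
    (fun y hy => by
      rw [← dist_eq_norm, dist_comm]
      exact ((hδ' hy).2 l).le)
    (convex_ball x δ) (Metric.mem_ball_self hδ) hs
  have e : (circFunOf (g s) - circFunOf (g x) - (s - x) • circFunOf (g' x)) l =
      g s l - (s - x) • g' x l - (g x l - (x - x) • g' x l) := by
    simp only [ContinuousMap.sub_apply, ContinuousMap.smul_apply,
      circFunOf_apply (hc s (hδ' hs).1), circFunOf_apply (hc x hxV), circFunOf_apply hc',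
      sub_self, zero_smul]
    ring
  rw [e]; exact h1

/-- Matrix version of `hasDerivAt_circFunOf`. -/
theorem hasMatDerivAt_loopFun {𝕜 : Type*} [RCLike 𝕜] [NormedAlgebra 𝕜 ℂ]
    {g g' : 𝕜 → Loop} {x : 𝕜} {V : Set 𝕜} (hV : V ∈ nhds x)
    (hg : ∀ s ∈ V, ∀ l, HasMatDerivAt (fun s => g s l) (g' s l) s)
    (hc : ∀ s ∈ V, IsContLoop (g s))
    (hg' : ∀ i j, ContinuousOn (fun p : 𝕜 × Circle => g' p.1 p.2 i j) (V ×ˢ Set.univ)) :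
    HasMatDerivAt (fun s => loopFun (g s)) (loopFun (g' x)) x :=
  fun i j => hasDerivAt_circFunOf (g := fun s l => g s l i j) (g' := fun s l => g' s l i j) hV
    (fun s hs l => hg s hs l i j) (fun s hs => hc s hs i j) (hg' i j)

/-! ### Directional derivatives of smooth families -/

/-- The derivative of a family of loops at `w` in the direction `v`. -/
def dirDeriv (F : ℂ → Loop) (v w : ℂ) : Loop :=
  fun l => Matrix.of fun i j => deriv (fun s : ℝ => F (w + s * v) l i j) 0

/-- The derivative of a loop with respect to the angle. -/
def angleDeriv (g : Loop) (l : Circle) : Mat2 :=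
  Matrix.of fun i j => deriv (fun t : ℝ => g (Circle.exp t * l) i j) 0

theorem IsSmoothFamily.contDiffAt {U : Set ℂ} (hU : IsOpen U) {F : ℂ → Loop}
    (hF : IsSmoothFamily U F) {w : ℂ} (hw : w ∈ U) (t : ℝ) (i j : Fin 2) :
    ContDiffAt ℝ ∞ (fun p : ℂ × ℝ => F p.1 (Circle.exp p.2) i j) (w, t) :=
  (hF i j).contDiffAt ((hU.prod isOpen_univ).mem_nhds ⟨hw, trivial⟩)

theorem hasDerivAt_line (w v : ℂ) (t s : ℝ) :
    HasDerivAt (fun s : ℝ => ((w + s * v, t) : ℂ × ℝ)) (v, 0) s := by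
  have h1 : HasDerivAt (fun s : ℝ => w + (s : ℂ) * v) v s := by
    have := ((Complex.ofRealCLM.hasDerivAt (x := s)).mul_const v).const_add w
    simpa using this
  exact h1.prodMk (hasDerivAt_const s t)

theorem IsSmoothFamily.hasDerivAt_fderiv {U : Set ℂ} (hU : IsOpen U) {F : ℂ → Loop}
    (hF : IsSmoothFamily U F) {w v : ℂ} {s : ℝ} (hw : w + s * v ∈ U) (t : ℝ) (i j : Fin 2) :
    HasDerivAt (fun s : ℝ => F (w + s * v) (Circle.exp t) i j)
      (fderiv ℝ (fun p : ℂ × ℝ => F p.1 (Circle.exp p.2) i j) (w + s * v, t) (v, 0)) s := by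
  have h1 := (hF.contDiffAt hU hw t i j).differentiableAt (by simp)
  exact h1.hasFDerivAt.comp_hasDerivAt s (hasDerivAt_line w v t s)

theorem IsSmoothFamily.dirDeriv_apply {U : Set ℂ} (hU : IsOpen U) {F : ℂ → Loop}
    (hF : IsSmoothFamily U F) {w : ℂ} (hw : w ∈ U) (v : ℂ) (t : ℝ) (i j : Fin 2) :
    dirDeriv F v w (Circle.exp t) i j =
      fderiv ℝ (fun p : ℂ × ℝ => F p.1 (Circle.exp p.2) i j) (w, t) (v, 0) := by
  have := hF.hasDerivAt_fderiv hU (w := w) (v := v) (s := 0) (by simpa using hw) t i j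
  simpa [dirDeriv] using this.deriv

theorem IsSmoothFamily.hasMatDerivAt {U : Set ℂ} (hU : IsOpen U) {F : ℂ → Loop}
    (hF : IsSmoothFamily U F) {w v : ℂ} {s : ℝ} (hw : w + s * v ∈ U) (l : Circle) :
    HasMatDerivAt (fun s : ℝ => F (w + s * v) l) (dirDeriv F v (w + s * v) l) s := by
  intro i j
  obtain ⟨t, rfl⟩ := Circle.exp_surjective l
  rw [hF.dirDeriv_apply hU hw]
  exact hF.hasDerivAt_fderiv hU hw t i j

theorem IsSmoothFamily.continuousAt_dirDeriv {U : Set ℂ} (hU : IsOpen U) {F : ℂ → Loop}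
    (hF : IsSmoothFamily U F) {w : ℂ} (hw : w ∈ U) (v : ℂ) (l : Circle) (i j : Fin 2) :
    ContinuousAt (fun p : ℂ × Circle => dirDeriv F v p.1 p.2 i j) (w, l) := by
  obtain ⟨t, rfl⟩ := Circle.exp_surjective l
  apply continuousAt_of_comp_exp
  have hUo : IsOpen (U ×ˢ (Set.univ : Set ℝ)) := hU.prod isOpen_univ
  have h1 := ((hF i j).continuousOn_fderiv_of_isOpen hUo (by simp)).continuousAt
    (hUo.mem_nhds (show (w, t) ∈ U ×ˢ Set.univ from ⟨hw, trivial⟩))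
  have h2 := h1.clm_apply (continuousAt_const (y := ((v, 0) : ℂ × ℝ)))
  refine h2.congr ?_
  filter_upwards [hUo.mem_nhds (show (w, t) ∈ U ×ˢ Set.univ from ⟨hw, trivial⟩)] with p hp
  rw [hF.dirDeriv_apply hU hp.1]

theorem IsSmoothFamily.continuousAt {U : Set ℂ} (hU : IsOpen U) {F : ℂ → Loop}
    (hF : IsSmoothFamily U F) {w : ℂ} (hw : w ∈ U) (l : Circle) (i j : Fin 2) :
    ContinuousAt (fun p : ℂ × Circle => F p.1 p.2 i j) (w, l) := by
  obtain ⟨t, rfl⟩ := Circle.exp_surjective l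
  exact continuousAt_of_comp_exp (hF.contDiffAt hU hw t i j).continuousAt

theorem IsSmoothFamily.isContLoop {U : Set ℂ} (hU : IsOpen U) {F : ℂ → Loop}
    (hF : IsSmoothFamily U F) {w : ℂ} (hw : w ∈ U) : IsContLoop (F w) := by
  intro i j
  rw [continuous_iff_continuousAt]
  intro l
  exact (hF.continuousAt hU hw l i j).comp (f := fun l => (w, l)) (by fun_prop)

theorem IsSmoothFamily.isContLoop_dirDeriv {U : Set ℂ} (hU : IsOpen U) {F : ℂ → Loop}
    (hF : IsSmoothFamily U F) {w : ℂ} (hw : w ∈ U) (v : ℂ) : IsContLoop (dirDeriv F v w) := by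
  intro i j
  rw [continuous_iff_continuousAt]
  intro l
  exact (hF.continuousAt_dirDeriv hU hw v l i j).comp (f := fun l => (w, l)) (by fun_prop)

theorem line_mem_nhds {U : Set ℂ} (hU : IsOpen U) {w : ℂ} (hw : w ∈ U) (v : ℂ) :
    {s : ℝ | w + s * v ∈ U} ∈ nhds (0 : ℝ) := by
  have : Continuous fun s : ℝ => w + (s : ℂ) * v := by fun_prop
  exact (hU.preimage this).mem_nhds (by simpa using hw)

theorem IsSmoothFamily.hasMatDerivAt_loopFun {U : Set ℂ} (hU : IsOpen U) {F : ℂ → Loop}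
    (hF : IsSmoothFamily U F) {w : ℂ} (hw : w ∈ U) (v : ℂ) :
    HasMatDerivAt (fun s : ℝ => loopFun (F (w + s * v))) (loopFun (dirDeriv F v w)) 0 := by
  have h := DPW.hasMatDerivAt_loopFun (𝕜 := ℝ) (g := fun s : ℝ => F (w + s * v))
    (g' := fun s : ℝ => dirDeriv F v (w + s * v)) (x := 0) (line_mem_nhds hU hw v)
    (fun s hs l => hF.hasMatDerivAt hU hs l) (fun s hs => hF.isContLoop hU hs) ?_
  · simpa using h
  · intro i j p hp
    have h1 := hF.continuousAt_dirDeriv hU hp.1 v p.2 i j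
    exact (ContinuousAt.comp (f := fun p : ℝ × Circle => (w + (p.1 : ℂ) * v, p.2)) h1
      (by fun_prop)).continuousWithinAt

theorem hasDerivAt_angle (w : ℂ) (t s : ℝ) :
    HasDerivAt (fun s : ℝ => ((w, s + t) : ℂ × ℝ)) (0, 1) s :=
  (hasDerivAt_const s w).prodMk ((hasDerivAt_id s).add_const t)

theorem hasDerivAt_fderiv_apply {E : Type*} [NormedAddCommGroup E] [NormedSpace ℝ E] {f : E → ℂ}
    {x a : E} {γ : ℝ → E} {s : ℝ} (hD : DifferentiableAt ℝ (fderiv ℝ f) x)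
    (hγ : HasDerivAt γ a s) (hx : γ s = x) (b : E) :
    HasDerivAt (fun s => fderiv ℝ f (γ s) b) (fderiv ℝ (fderiv ℝ f) x a b) s := by
  subst hx
  exact (ContinuousLinearMap.apply ℝ ℂ b).hasFDerivAt.comp_hasDerivAt s
    (hD.hasFDerivAt.comp_hasDerivAt s hγ)

/-- Directional derivatives and the angular derivative commute. -/
theorem IsSmoothFamily.hasMatDerivAt_angleDeriv {U : Set ℂ} (hU : IsOpen U) {F : ℂ → Loop}
    (hF : IsSmoothFamily U F) {w : ℂ} (hw : w ∈ U) (v : ℂ) (l : Circle) {M : Mat2}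
    (hM : HasMatDerivAt (fun t : ℝ => dirDeriv F v w (Circle.exp t * l)) M 0) :
    HasMatDerivAt (fun s : ℝ => angleDeriv (F (w + s * v)) l) M 0 := by
  intro i j
  obtain ⟨t, rfl⟩ := Circle.exp_surjective l
  set f : ℂ × ℝ → ℂ := fun p => F p.1 (Circle.exp p.2) i j with hf
  have hC : ContDiffAt ℝ ∞ f (w, t) := hF.contDiffAt hU hw t i j
  -- The claim is the symmetry of the second derivative in (w, t): `h1` is one order of
  -- differentiation and `h2` the other.
  have hsym := hC.isSymmSndFDerivAt (by
    simp only [minSmoothness_of_isRCLikeNormedField]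
    exact WithTop.coe_le_coe.2 (le_top (a := (2 : ℕ∞))))
  have hD : DifferentiableAt ℝ (fderiv ℝ f) (w, t) :=
    (hC.fderiv_right (m := 1) (by norm_cast)).differentiableAt (by simp)
  have h1 := hasDerivAt_fderiv_apply hD (hasDerivAt_angle w t 0) (by simp) ((v, 0) : ℂ × ℝ)
  have h2 := hasDerivAt_fderiv_apply hD (hasDerivAt_line w v t 0) (by simp) ((0, 1) : ℂ × ℝ)
  have hMe : M i j = fderiv ℝ (fderiv ℝ f) (w, t) (v, 0) (0, 1) := by
    rw [hsym (v, 0) (0, 1)]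
    refine (hM i j).unique (h1.congr_of_eventuallyEq (Filter.Eventually.of_forall fun s => ?_))
    simp only [← Circle.exp_add]
    exact hF.dirDeriv_apply hU hw v (s + t) i j
  rw [hMe]
  refine h2.congr_of_eventuallyEq ?_
  filter_upwards [line_mem_nhds hU hw v] with s hs
  have h3 : HasFDerivAt f (fderiv ℝ f (w + s * v, t)) (w + s * v, (0 : ℝ) + t) := by
    rw [zero_add]
    exact ((hF.contDiffAt hU hs t i j).differentiableAt (by simp)).hasFDerivAt
  have h4 := h3.comp_hasDerivAt (0 : ℝ) (hasDerivAt_angle (w + s * v) t 0)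
  rw [← h4.deriv]
  simp only [angleDeriv, of_apply, ← Circle.exp_add, hf, Function.comp_def]

/-! ### Matrices over the disk algebra -/

/-- All entries lie in the disk algebra. -/
def InDisk (M : Matrix (Fin 2) (Fin 2) CircFun) : Prop := ∀ i j, M i j ∈ diskAlg

theorem InDisk.mul {M N : Matrix (Fin 2) (Fin 2) CircFun} (hM : InDisk M) (hN : InDisk N) :
    InDisk (M * N) := by
  intro i j
  rw [mul_apply]
  exact sum_mem fun k _ => mul_mem (hM i k) (hN k j)

theorem InDisk.sub {M N : Matrix (Fin 2) (Fin 2) CircFun} (hM : InDisk M) (hN : InDisk N) :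
    InDisk (M - N) := fun i j => sub_mem (hM i j) (hN i j)

theorem InDisk.smul {M : Matrix (Fin 2) (Fin 2) CircFun} (hM : InDisk M) (a : ℂ) :
    InDisk (a • M) := fun i j => Subalgebra.smul_mem _ (hM i j) a

theorem InDisk.lam_smul {M : Matrix (Fin 2) (Fin 2) CircFun} (hM : InDisk M) :
    InDisk (lam • M) := fun i j => mul_mem lam_mem_diskAlg (hM i j)

theorem InDisk.adjugate {M : Matrix (Fin 2) (Fin 2) CircFun} (hM : InDisk M) :
    InDisk M.adjugate := by
  intro i j
  rw [adjugate_fin_two]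
  fin_cases i <;> fin_cases j
  · exact hM 1 1
  · exact neg_mem (hM 0 1)
  · exact neg_mem (hM 1 0)
  · exact hM 0 0

/-- A constant matrix as a matrix of functions on the circle. -/
def constMat (M : Mat2) : Matrix (Fin 2) (Fin 2) CircFun := M.map (algebraMap ℂ CircFun)

theorem constMat_apply (M : Mat2) (i j : Fin 2) (l : Circle) : constMat M i j l = M i j := by
  simp [constMat, algebraMap_apply]

theorem map_constMat (M : Mat2) (l : Circle) : (constMat M).map (ev l) = M := by
  ext i j; exact constMat_apply M i j l

theorem inDisk_constMat (M : Mat2) : InDisk (constMat M) :=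
  fun i j => diskAlg.algebraMap_mem (M i j)

/-- The matrix of the `n`-th Fourier coefficients. -/
def coefMat (n : ℤ) (M : Matrix (Fin 2) (Fin 2) CircFun) : Mat2 :=
  Matrix.of fun i j => coef n (M i j)

theorem coefMat_apply (n : ℤ) (M : Matrix (Fin 2) (Fin 2) CircFun) (i j : Fin 2) :
    coefMat n M i j = coef n (M i j) := rfl

theorem coefMat_sub (n : ℤ) (M N : Matrix (Fin 2) (Fin 2) CircFun) :
    coefMat n (M - N) = coefMat n M - coefMat n N := by
  ext i j; simp [coefMat_apply]

theorem coefMat_smul (n : ℤ) (a : ℂ) (M : Matrix (Fin 2) (Fin 2) CircFun) :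
    coefMat n (a • M) = a • coefMat n M := by
  ext i j; simp [coefMat_apply]

theorem coefMat_lam_smul (n : ℤ) (M : Matrix (Fin 2) (Fin 2) CircFun) :
    coefMat n (lam • M) = coefMat (n - 1) M := by
  ext i j
  simp only [coefMat_apply, Matrix.smul_apply, smul_eq_mul, coef_lam_mul]

theorem coefMat_zero_mul {M N : Matrix (Fin 2) (Fin 2) CircFun} (hM : InDisk M) (hN : InDisk N) :
    coefMat 0 (M * N) = coefMat 0 M * coefMat 0 N := by
  ext i j
  simp only [coefMat_apply, mul_apply, Fin.sum_univ_two, map_add]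
  rw [coef_zero_mul (hM _ _) (hN _ _), coef_zero_mul (hM _ _) (hN _ _)]

theorem coefMat_adjugate (n : ℤ) (M : Matrix (Fin 2) (Fin 2) CircFun) :
    coefMat n M.adjugate = (coefMat n M).adjugate := by
  rw [adjugate_fin_two, adjugate_fin_two]
  ext i j; fin_cases i <;> fin_cases j <;> simp [coefMat_apply]

theorem coefMat_mul_constMat (n : ℤ) (M : Matrix (Fin 2) (Fin 2) CircFun) (A : Mat2) :
    coefMat n (M * constMat A) = coefMat n M * A := by
  ext i j
  simp only [coefMat_apply, mul_apply, Fin.sum_univ_two, map_add, constMat, map_apply,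
    Algebra.algebraMap_eq_smul_one, mul_smul_comm, mul_one, map_smul, smul_eq_mul]
  ring

theorem coefMat_constMat_mul (n : ℤ) (M : Matrix (Fin 2) (Fin 2) CircFun) (A : Mat2) :
    coefMat n (constMat A * M) = A * coefMat n M := by
  ext i j
  simp only [coefMat_apply, mul_apply, Fin.sum_univ_two, map_add, constMat, map_apply,
    Algebra.algebraMap_eq_smul_one, smul_mul_assoc, one_mul, map_smul, smul_eq_mul]

theorem coefMat_zero_one : coefMat 0 (1 : Matrix (Fin 2) (Fin 2) CircFun) = 1 := by
  ext i j
  rw [coefMat_apply, one_apply, one_apply]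
  split_ifs <;> simp [coef_one]

/-- Derivatives of curves in the disk algebra stay in the disk algebra. -/
theorem mem_diskAlg_of_hasDerivAt
    {g : ℝ → CircFun} {g' : CircFun} {x : ℝ} (h : HasDerivAt g g' x)
    (hg : ∀ᶠ s in nhds x, g s ∈ diskAlg) : g' ∈ diskAlg := by
  rw [hasDerivAt_iff_tendsto_slope] at h
  refine isClosed_diskAlg.mem_of_tendsto h ?_
  filter_upwards [hg.filter_mono nhdsWithin_le_nhds] with s hs
  rw [slope_def_module]
  have : ((s - x)⁻¹ : ℝ) • (g s - g x) = (((s - x)⁻¹ : ℝ) : ℂ) • (g s - g x) := by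
    ext l; simp
  rw [this]
  exact Subalgebra.smul_mem _ (sub_mem hs hg.self_of_nhds) _

theorem coef_lamInv (n : ℤ) : coef n lamInv = if n = -1 then 1 else 0 := by
  have := coef_lam_mul (n + 1) lamInv
  rw [lam_mul_lamInv, coef_one, add_sub_cancel_right] at this
  rw [← this]
  congr 1
  exact propext ⟨fun h => by omega, fun h => by omega⟩

/-- A function whose Fourier coefficients vanish except at `-1`, `0` and `1`. -/
theorem eq_three_terms {f : CircFun} (h1 : lam * f ∈ diskAlg) (h2 : lam * star f ∈ diskAlg) :
    f = coef (-1) f • lamInv + coef 0 f • (1 : CircFun) + coef 1 f • lam := by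
  apply circFun_ext
  intro n
  have hl : coef n lam = if n = 1 then 1 else 0 := by simpa using coef_lam_pow n 1
  simp only [map_add, map_smul, smul_eq_mul, coef_lamInv, coef_one, hl]
  rcases lt_trichotomy n 0 with hn | rfl | hn
  · rcases eq_or_ne n (-1) with rfl | hn1
    · simp
    · have := coef_lam_mul (n + 1) f
      rw [coef_eq_zero_of_neg h1 (by omega), add_sub_cancel_right] at this
      rw [← this, if_neg hn1, if_neg (by omega), if_neg (by omega)]; simp
  · simp
  · rcases eq_or_ne n 1 with rfl | hn1
    · simp
    -- Conjugation reverses the frequencies, so the hypothesis on the conjugate kills all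
    -- frequencies above 1.
    · have h3 := coef_lam_mul (-n + 1) (star f)
      rw [coef_eq_zero_of_neg h2 (by omega), add_sub_cancel_right, coef_star, neg_neg] at h3
      have h4 : coef n f = 0 := (map_eq_zero _).1 h3.symm
      rw [h4, if_neg hn1, if_neg (by omega), if_neg (by omega)]; simp

/-! ### Real forms -/

/-- Entrywise description of the real form of the matrix algebra that belongs to a real form of
`SL(2, ℂ)`. -/
def IsRealMat : SurfaceClass → Mat2 → Prop
  | .cmcEuclidean, M => conj (M 0 0) = M 1 1 ∧ conj (M 0 1) = -M 1 0
  | .cmcSpacelike, M => conj (M 0 0) = M 1 1 ∧ conj (M 0 1) = M 1 0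
  | .cgcTimelike, M => ∀ i j, conj (M i j) = M i j

/-- The group condition is traded for a real linear condition on matrices, using that the inverse is
the adjugate. The linear condition passes to derivatives of curves, which leave the group. -/
theorem isRealMat_of_mem_realForm {T : SurfaceClass} {M : Mat2} (h : M ∈ realForm T) :
    IsRealMat T M := by
  cases T with
  | cmcEuclidean =>
    obtain ⟨hd, h⟩ := h
    have h1 : M.conjTranspose = M.adjugate := by
      have := congrArg (· * M.adjugate) h
      simpa [mul_assoc, mul_adjugate_of_det hd] using this
    rw [adjugate_fin_two] at h1
    have h00 := congrFun (congrFun h1 0) 0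
    have h10 := congrFun (congrFun h1 1) 0
    simp [conjTranspose_apply] at h00 h10
    exact ⟨h00, h10⟩
  | cmcSpacelike =>
    obtain ⟨hd, h⟩ := h
    have h1 : M.conjTranspose * sigma3 = sigma3 * M.adjugate := by
      have := congrArg (· * M.adjugate) h
      simpa [mul_assoc, mul_adjugate_of_det hd] using this
    rw [adjugate_fin_two] at h1
    have h00 := congrFun (congrFun h1 0) 0
    have h10 := congrFun (congrFun h1 1) 0
    simp [conjTranspose_apply, sigma3, mul_apply, Fin.sum_univ_two] at h00 h10
    exact ⟨h00, h10⟩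
  | cgcTimelike => exact fun i j => Complex.conj_eq_iff_im.2 (h.2 i j)

theorem IsRealMat.adjugate_mul {T : SurfaceClass} {M N : Mat2} (hM : IsRealMat T M)
    (hN : IsRealMat T N) : IsRealMat T (M.adjugate * N) := by
  rw [adjugate_fin_two]
  cases T with
  | cmcEuclidean =>
    obtain ⟨h1, h2⟩ := hM
    obtain ⟨h3, h4⟩ := hN
    have h1' : conj (M 1 1) = M 0 0 := by rw [← h1, Complex.conj_conj]
    have h3' : conj (N 1 1) = N 0 0 := by rw [← h3, Complex.conj_conj]
    have h4' : conj (N 1 0) = -N 0 1 := by rw [← neg_neg (N 1 0), ← h4]; simp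
    constructor <;> simp [mul_apply, Fin.sum_univ_two, h2, h3, h4, h1', h3', h4'] <;> ring
  | cmcSpacelike =>
    obtain ⟨h1, h2⟩ := hM
    obtain ⟨h3, h4⟩ := hN
    have h1' : conj (M 1 1) = M 0 0 := by rw [← h1, Complex.conj_conj]
    have h3' : conj (N 1 1) = N 0 0 := by rw [← h3, Complex.conj_conj]
    have h4' : conj (N 1 0) = N 0 1 := by rw [← h4, Complex.conj_conj]
    constructor <;> simp [mul_apply, Fin.sum_univ_two, h2, h3, h4, h1', h3', h4'] <;> ring
  | cgcTimelike =>
    intro i j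
    fin_cases i <;> fin_cases j <;>
      simp [mul_apply, Fin.sum_univ_two, hM _ _, hN _ _]

theorem IsRealMat.of_hasMatDerivAt {T : SurfaceClass} {g : ℝ → Mat2} {g' : Mat2} {x : ℝ}
    (h : HasMatDerivAt g g' x) (hg : ∀ᶠ s in nhds x, IsRealMat T (g s)) : IsRealMat T g' := by
  have hconj : ∀ i j, HasDerivAt (fun s => conj (g s i j)) (conj (g' i j)) x := fun i j =>
    (Complex.conjCLE : ℂ →L[ℝ] ℂ).hasFDerivAt.comp_hasDerivAt x (h i j)
  cases T with
  | cmcEuclidean =>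
    exact ⟨(hconj 0 0).unique ((h 1 1).congr_of_eventuallyEq (hg.mono fun s hs => hs.1)),
      (hconj 0 1).unique ((h 1 0).fun_neg.congr_of_eventuallyEq (hg.mono fun s hs => hs.2))⟩
  | cmcSpacelike =>
    exact ⟨(hconj 0 0).unique ((h 1 1).congr_of_eventuallyEq (hg.mono fun s hs => hs.1)),
      (hconj 0 1).unique ((h 1 0).congr_of_eventuallyEq (hg.mono fun s hs => hs.2))⟩
  | cgcTimelike =>
    exact fun i j =>
      (hconj i j).unique ((h i j).congr_of_eventuallyEq (hg.mono fun s hs => hs i j))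

/-! ### The Maurer-Cartan form of the extended frame -/

/-- A solution of `dL = L ξ` with its Iwasawa splitting `L = F B` over a connected open set. -/
structure SplitData (T : SurfaceClass) (c : ℂ) (U : Set ℂ) (L F B : ℂ → Loop) : Prop where
  isOpen : IsOpen U
  isPreconnected : IsPreconnected U
  ne_zero : c ≠ 0
  isSolution : IsSolution c U L
  smooth : IsSmoothFamily U F
  real : ∀ w ∈ U, F w ∈ loopReal T
  pos : ∀ w ∈ U, B w ∈ loopPlus
  split : ∀ w ∈ U, ∀ l, L w l = F w l * B w l

namespace SplitData

variable {T : SurfaceClass} {c : ℂ} {U : Set ℂ} {L F B : ℂ → Loop} (D : SplitData T c U L F B)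
  {w : ℂ} (hw : w ∈ U)

include D

theorem hasMatDerivAt_L (l : Circle) {w : ℂ} (hw : w ∈ U) :
    HasMatDerivAt (fun w => L w l) (L w l * ((l : ℂ)⁻¹ • coeffMat c w)) w := by
  intro i j
  have := D.isSolution.2 w hw l i j
  rwa [exp_smul_potential] at this

include hw

theorem det_L (l : Circle) : (L w l).det = 1 := (D.isSolution.1 w hw).2.2 l

theorem det_F (l : Circle) : (F w l).det = 1 := (D.real w hw).1.2.2 l

theorem det_B (l : Circle) : (B w l).det = 1 := (D.pos w hw).1.2.2 l

theorem isContLoop_L : IsContLoop (L w) := (D.isSolution.1 w hw).1.isContLoop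

theorem isContLoop_F : IsContLoop (F w) := (D.real w hw).1.1.isContLoop

theorem isContLoop_B : IsContLoop (B w) := (D.pos w hw).1.1.isContLoop

omit hw

/-- The differential equation is given for each λ separately. Joint continuity comes from L(w) =
L(w₀)Φ(w₀)⁻¹Φ(w), with Φ the explicit fundamental solution and λ-smoothness needed only at w₀. -/
theorem continuousOn_L (i j : Fin 2) :
    ContinuousOn (fun p : ℂ × Circle => L p.1 p.2 i j) (U ×ˢ Set.univ) := by
  rcases U.eq_empty_or_nonempty with rfl | ⟨w₀, hw₀⟩
  · simp
  have h1 : ∀ i j, Continuous fun l : Circle => (L w₀ l * (fundSol c l w₀).adjugate) i j := by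
    have hf : ∀ i j, Continuous fun l : Circle => fundSol c l w₀ i j := fun i j =>
      (continuous_fundSol c i j).comp (f := fun l => (w₀, l)) (by fun_prop)
    have hL := D.isContLoop_L hw₀
    intro i j
    simp only [mul_apply, Fin.sum_univ_two, adjugate_fin_two]
    refine ((hL i 0).mul ?_).add ((hL i 1).mul ?_)
    · fin_cases j
      · exact hf 1 1
      · exact (hf 0 1).neg
    · fin_cases j
      · exact (hf 1 0).neg
      · exact hf 0 0
  have h2 : Continuous fun p : ℂ × Circle =>
      ((c / p.2 : ℂ) • (L w₀ p.2 * (fundSol c p.2 w₀).adjugate * fundSol c p.2 p.1)) i j := by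
    simp only [Matrix.smul_apply, smul_eq_mul]
    rw [show (fun p : ℂ × Circle => (c / p.2 : ℂ) *
      (L w₀ p.2 * (fundSol c p.2 w₀).adjugate * fundSol c p.2 p.1) i j) = fun p : ℂ × Circle =>
      (c / p.2 : ℂ) * ((L w₀ p.2 * (fundSol c p.2 w₀).adjugate) i 0 * fundSol c p.2 p.1 0 j +
        (L w₀ p.2 * (fundSol c p.2 w₀).adjugate) i 1 * fundSol c p.2 p.1 1 j) by
      ext p; rw [mul_apply, Fin.sum_univ_two]]
    refine Continuous.mul (continuous_const.div (by fun_prop) fun p => p.2.coe_ne_zero)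
      (Continuous.add (Continuous.mul ?_ (continuous_fundSol c 0 j))
        (Continuous.mul ?_ (continuous_fundSol c 1 j)))
    · exact (h1 i 0).comp continuous_snd
    · exact (h1 i 1).comp continuous_snd
  refine h2.continuousOn.congr fun p hp => ?_
  simp only
  rw [solution_eq_mul_fundSol D.ne_zero D.isOpen D.isPreconnected
    (fun w hw => D.hasMatDerivAt_L p.2 hw) hp.1 hw₀]

include hw

theorem hasMatDerivAt_loopFun_L :
    HasMatDerivAt (fun w => loopFun (L w))
      (loopFun (L w) * (lamInv • constMat (coeffMat c w))) w := by
  have h := hasMatDerivAt_loopFun (𝕜 := ℂ) (g := L)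
    (g' := fun w l => L w l * ((l : ℂ)⁻¹ • coeffMat c w)) (x := w) (D.isOpen.mem_nhds hw)
    (fun s hs l => D.hasMatDerivAt_L l hs) (fun s hs => D.isContLoop_L hs) ?_
  · have hcont : IsContLoop fun l => L w l * ((l : ℂ)⁻¹ • coeffMat c w) := by
      intro i j
      simp only [mul_apply, Fin.sum_univ_two, Matrix.smul_apply, smul_eq_mul]
      have h1 := D.isContLoop_L hw i 0
      have h2 := D.isContLoop_L hw i 1
      have h3 := lamInv.continuous
      exact (h1.mul (h3.mul continuous_const)).add (h2.mul (h3.mul continuous_const))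
    have e : loopFun (L w) * (lamInv • constMat (coeffMat c w)) =
        loopFun fun l => L w l * ((l : ℂ)⁻¹ • coeffMat c w) := by
      apply circMat_ext
      intro l
      rw [map_loopFun hcont, map_ev_mul, map_loopFun (D.isContLoop_L hw)]
      congr 1
    rw [e]
    exact h
  · intro i j
    simp only [mul_apply, Fin.sum_univ_two, Matrix.smul_apply, smul_eq_mul]
    have h3 : Continuous fun p : ℂ × Circle => (p.2 : ℂ)⁻¹ :=
      lamInv.continuous.comp continuous_snd
    have h4 : ∀ i j, Continuous fun p : ℂ × Circle => coeffMat c p.1 i j := by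
      intro i j
      fin_cases i <;> fin_cases j <;> simp [coeffMat] <;> fun_prop
    exact ((D.continuousOn_L i 0).mul (h3.mul (h4 0 j)).continuousOn).add
      ((D.continuousOn_L i 1).mul (h3.mul (h4 1 j)).continuousOn)

theorem hasMatDerivAt_line_L (v : ℂ) :
    HasMatDerivAt (fun s : ℝ => loopFun (L (w + s * v)))
      (v • (loopFun (L w) * (lamInv • constMat (coeffMat c w)))) 0 := by
  intro i j
  have h1 := D.hasMatDerivAt_loopFun_L hw i j
  have h2 : HasDerivAt (fun s : ℝ => w + (s : ℂ) * v) v 0 := by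
    have := ((Complex.ofRealCLM.hasDerivAt (x := (0 : ℝ))).mul_const v).const_add w
    simpa using this
  exact HasDerivAt.scomp (0 : ℝ) (h := fun s : ℝ => w + (s : ℂ) * v)
    (g₁ := fun w => loopFun (L w) i j) (by simpa using h1) h2

theorem loopFun_B : loopFun (B w) = (loopFun (F w)).adjugate * loopFun (L w) := by
  apply circMat_ext
  intro l
  rw [map_loopFun (D.isContLoop_B hw), map_ev_mul, map_ev_adjugate,
    map_loopFun (D.isContLoop_F hw), map_loopFun (D.isContLoop_L hw), D.split w hw, ← mul_assoc,
    adjugate_mul_of_det (D.det_F hw l), one_mul]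

theorem inDisk_B : InDisk (loopFun (B w)) := by
  obtain ⟨_, E, hE1, hE2, _, hE4⟩ := D.pos w hw
  intro i j
  refine mem_diskAlg_of_extension (E := fun z => E z i j) (hE1 i j).continuousOn (hE2 i j) ?_
  intro l
  rw [loopFun_apply (D.isContLoop_B hw), hE4]

theorem line_mem (v : ℂ) : ∀ᶠ s : ℝ in nhds 0, w + s * v ∈ U := line_mem_nhds D.isOpen hw v

theorem hasMatDerivAt_F (v : ℂ) (l : Circle) :
    HasMatDerivAt (fun s : ℝ => F (w + s * v) l) (dirDeriv F v w l) 0 := by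
  have := D.smooth.hasMatDerivAt D.isOpen (w := w) (v := v) (s := 0) (by simpa using hw) l
  simpa using this

/-- The Maurer-Cartan form of the frame in the direction `v`, as a matrix of functions of `λ`. -/
theorem lam_smul_maurerCartan (v : ℂ) :
    InDisk (lam • ((loopFun (F w)).adjugate * loopFun (dirDeriv F v w))) ∧
      coefMat 0 (lam • ((loopFun (F w)).adjugate * loopFun (dirDeriv F v w))) =
        v • (coefMat 0 (loopFun (B w)) * coeffMat c w * (coefMat 0 (loopFun (B w))).adjugate) := by
  set f := loopFun (F w) with hf
  set f' := loopFun (dirDeriv F v w) with hf'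
  set b := loopFun (B w) with hb
  set A := constMat (coeffMat c w) with hA
  have hFd := D.smooth.hasMatDerivAt_loopFun D.isOpen hw v
  have hdetF : f.det = 1 := det_loopFun (D.isContLoop_F hw) (D.det_F hw)
  have hdetB : b.det = 1 := det_loopFun (D.isContLoop_B hw) (D.det_B hw)
  have htr : (f.adjugate * f').trace = 0 := by
    have := hFd.trace_adjugate_mul ((D.line_mem hw v).mono fun s hs =>
      det_loopFun (D.isContLoop_F hs) (D.det_F hs))
    simpa using this
  have hB := hFd.adjugate.mul (D.hasMatDerivAt_line_L hw v)
  have hB' := hB.congr (k := fun s : ℝ => loopFun (B (w + s * v)))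
    ((D.line_mem hw v).mono fun s hs => D.loopFun_B hs)
  set b' := f'.adjugate * loopFun (L (w + ((0 : ℝ) : ℂ) * v)) +
    (loopFun (F (w + ((0 : ℝ) : ℂ) * v))).adjugate * v • (loopFun (L w) * (lamInv • A)) with hb'
  -- Difference quotients of B lie in the disk algebra, and the disk algebra is closed, so the
  -- derivative of B lies in it too.
  have hb'D : InDisk b' := fun i j => mem_diskAlg_of_hasDerivAt (hB' i j)
    ((D.line_mem hw v).mono fun s hs => D.inDisk_B hs i j)
  have hL : loopFun (L w) = f * b := by
    rw [hb, D.loopFun_B hw, ← mul_assoc, mul_adjugate_of_det hdetF, one_mul]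
  have hb'e : b' = -(f.adjugate * f' * b) + v • (b * (lamInv • A)) := by
    rw [hb', Complex.ofReal_zero, zero_mul, add_zero, hL, ← hf, mul_smul_comm, mul_assoc f b,
      ← mul_assoc f.adjugate f, adjugate_mul_of_det hdetF, one_mul, ← mul_assoc]
    congr 1
    rw [← neg_mul, ← adjugate_eq_neg_of_trace_eq_zero htr, adjugate_mul_distrib,
      adjugate_adjugate_fin_two]
  -- This is λ times F⁻¹dF = B ξ B⁻¹ − dB B⁻¹. Both terms lie in the disk algebra, and the second
  -- has no constant term, so the λ⁻¹-part of F⁻¹dF comes from the constant term of B alone.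
  have key : lam • (f.adjugate * f') = v • (b * A * b.adjugate) - lam • (b' * b.adjugate) := by
    rw [hb'e, add_mul, neg_mul, mul_assoc (f.adjugate * f'), mul_adjugate_of_det hdetB, mul_one,
      smul_add, smul_neg, smul_mul_assoc, mul_smul_comm, smul_mul_assoc,
      smul_comm lam v (lamInv • (b * A * b.adjugate)), smul_smul lam lamInv, lam_mul_lamInv,
      one_smul]
    abel
  have hbD := D.inDisk_B hw
  have hAD : InDisk A := inDisk_constMat _
  constructor
  · rw [key]
    exact (((hbD.mul hAD).mul hbD.adjugate).smul v).sub (hb'D.mul hbD.adjugate).lam_smul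
  · have hneg : coefMat (0 - 1) (b' * b.adjugate) = 0 := by
      ext i j
      exact coef_eq_zero_of_neg ((hb'D.mul hbD.adjugate) i j) (by norm_num)
    rw [key, coefMat_sub, coefMat_lam_smul, hneg, sub_zero, coefMat_smul,
      coefMat_zero_mul (hbD.mul hAD) hbD.adjugate, coefMat_mul_constMat, coefMat_adjugate]

end SplitData

/-- The upper right entry of the `λ`-coefficient that the reality condition attaches to the
`λ⁻¹`-coefficient with off-diagonal entries `p`, `q`. -/
def hatP : SurfaceClass → ℂ → ℂ → ℂ
  | .cmcEuclidean, _, q => -conj q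
  | .cmcSpacelike, _, q => conj q
  | .cgcTimelike, p, _ => conj p

/-- The lower left entry of the `λ`-coefficient that the reality condition attaches to the
`λ⁻¹`-coefficient with off-diagonal entries `p`, `q`. -/
def hatQ : SurfaceClass → ℂ → ℂ → ℂ
  | .cmcEuclidean, p, _ => -conj p
  | .cmcSpacelike, p, _ => conj p
  | .cgcTimelike, _, q => conj q

/-- The value of the Maurer-Cartan form of an extended frame on the tangent vector `v`. -/
def formMat (T : SurfaceClass) (p q v a : ℂ) (l : Circle) : Mat2 :=
  !![a, v * p * (l : ℂ)⁻¹ + conj v * hatP T p q * l;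
    v * q * (l : ℂ)⁻¹ + conj v * hatQ T p q * l, -a]

theorem trace_formMat (T : SurfaceClass) (p q v a : ℂ) (l : Circle) :
    (formMat T p q v a l).trace = 0 := by
  simp [formMat, trace_fin_two]

theorem coef_zero_of_odd {f : CircFun} (h : ∀ l, f (Circle.exp Real.pi * l) = -f l) :
    coef 0 f = 0 := by
  have := coef_parity (f := f) (s := -1) (fun l => by rw [h]; ring) 0
  rw [zpow_zero, mul_one] at this
  linear_combination (1 / 2 : ℂ) * this

theorem coef_one_of_even {f : CircFun} (h : ∀ l, f (Circle.exp Real.pi * l) = f l) :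
    coef 1 f = 0 ∧ coef (-1) f = 0 := by
  have h1 := coef_parity (f := f) (s := 1) (fun l => by rw [h]; ring) 1
  have h2 := coef_parity (f := f) (s := 1) (fun l => by rw [h]; ring) (-1)
  norm_num at h1 h2
  exact ⟨by linear_combination (1 / 2 : ℂ) * h1, by linear_combination (1 / 2 : ℂ) * h2⟩

theorem isTwisted_adjugate_mul {g k : Loop} (hg : IsTwisted g) (hk : IsTwisted k) :
    IsTwisted fun l => (g l).adjugate * k l := by
  intro l
  obtain ⟨h1, h2, h3, h4⟩ := hg l
  obtain ⟨h5, h6, h7, h8⟩ := hk l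
  simp only [adjugate_fin_two, mul_apply, Fin.sum_univ_two, of_apply, cons_val', cons_val_zero,
    cons_val_one, cons_val_fin_one, h1, h2, h3, h4, h5, h6, h7, h8]
  refine ⟨?_, ?_, ?_, ?_⟩ <;> ring

namespace SplitData

variable {T : SurfaceClass} {c : ℂ} {U : Set ℂ} {L F B : ℂ → Loop} (D : SplitData T c U L F B)
  {w : ℂ} (hw : w ∈ U)

include D hw

theorem isTwisted_dirDeriv (v : ℂ) : IsTwisted (dirDeriv F v w) := by
  intro l
  have h1 := D.hasMatDerivAt_F hw v l
  have h2 := D.hasMatDerivAt_F hw v (Circle.exp Real.pi * l)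
  have ht : ∀ᶠ s : ℝ in nhds 0, IsTwisted (F (w + s * v)) :=
    (D.line_mem hw v).mono fun s hs => (D.real _ hs).1.2.1
  exact ⟨(h2 0 0).unique ((h1 0 0).congr_of_eventuallyEq (ht.mono fun s hs => (hs l).1)),
    (h2 1 1).unique ((h1 1 1).congr_of_eventuallyEq (ht.mono fun s hs => (hs l).2.1)),
    (h2 0 1).unique ((h1 0 1).fun_neg.congr_of_eventuallyEq (ht.mono fun s hs => (hs l).2.2.1)),
    (h2 1 0).unique ((h1 1 0).fun_neg.congr_of_eventuallyEq (ht.mono fun s hs => (hs l).2.2.2))⟩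

theorem isRealMat_F (l : Circle) : IsRealMat T (F w l) :=
  isRealMat_of_mem_realForm ((D.real w hw).2 l)

theorem isRealMat_dirDeriv (v : ℂ) (l : Circle) : IsRealMat T (dirDeriv F v w l) :=
  IsRealMat.of_hasMatDerivAt (D.hasMatDerivAt_F hw v l)
    ((D.line_mem hw v).mono fun _ hs => D.isRealMat_F hs l)

theorem trace_maurerCartan (v : ℂ) (l : Circle) :
    ((F w l).adjugate * dirDeriv F v w l).trace = 0 := by
  have := (D.hasMatDerivAt_F hw v l).trace_adjugate_mul
    ((D.line_mem hw v).mono fun s hs => D.det_F hs l)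
  simpa using this

/-- Twisting makes the off-diagonal entries odd, which kills their constant terms; taking constant
terms is multiplicative on the disk algebra, so the determinant stays 1. -/
theorem coefMat_zero_B : ∃ b d : ℂ, b * d = 1 ∧ coefMat 0 (loopFun (B w)) = !![b, 0; 0, d] := by
  set M := coefMat 0 (loopFun (B w)) with hM
  have hc := D.isContLoop_B hw
  have htw := (D.pos w hw).1.2.1
  have h01 : M 0 1 = 0 := coef_zero_of_odd fun l => by
    rw [loopFun_apply hc, loopFun_apply hc]; exact (htw l).2.2.1
  have h10 : M 1 0 = 0 := coef_zero_of_odd fun l => by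
    rw [loopFun_apply hc, loopFun_apply hc]; exact (htw l).2.2.2
  have hdet : M * M.adjugate = 1 := by
    rw [hM, ← coefMat_adjugate, ← coefMat_zero_mul (D.inDisk_B hw) (D.inDisk_B hw).adjugate,
      mul_adjugate_of_det (det_loopFun hc (D.det_B hw)), coefMat_zero_one]
  have h := congrFun (congrFun hdet 0) 0
  rw [adjugate_fin_two] at h
  simp [mul_apply, Fin.sum_univ_two, h01] at h
  refine ⟨M 0 0, M 1 1, h, ?_⟩
  ext i j; fin_cases i <;> fin_cases j <;> simp [h01, h10]

/-- The Maurer-Cartan form of the extended frame. -/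
theorem exists_form : ∃ p q : ℂ, p * q = c * Complex.exp w ∧ ∀ v, ∃ a, ∀ l,
    (F w l).adjugate * dirDeriv F v w l = formMat T p q v a l := by
  obtain ⟨b, d, hbd, hB⟩ := D.coefMat_zero_B hw
  -- These are the off-diagonal entries of diag(b, d) A diag(b, d)⁻¹, where d = b⁻¹. Their product
  -- is invariant under the conjugation.
  refine ⟨b ^ 2 * Complex.exp w, c * d ^ 2, by
    linear_combination (c * Complex.exp w) * (b * d + 1) * hbd, fun v => ?_⟩
  set p := b ^ 2 * Complex.exp w with hp
  set q := c * d ^ 2 with hq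
  obtain ⟨hdisk, hcoef⟩ := D.lam_smul_maurerCartan hw v
  set α := (loopFun (F w)).adjugate * loopFun (dirDeriv F v w) with hα
  have hαl : ∀ l, α.map (ev l) = (F w l).adjugate * dirDeriv F v w l := by
    intro l
    rw [hα, map_ev_mul, map_ev_adjugate, map_loopFun (D.isContLoop_F hw),
      map_loopFun (D.smooth.isContLoop_dirDeriv D.isOpen hw v)]
  have hαe : ∀ i j l, α i j l = ((F w l).adjugate * dirDeriv F v w l) i j := fun i j l => by
    rw [← hαl]; rfl
  rw [coefMat_lam_smul, hB] at hcoef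
  have hc01 : coef (-1) (α 0 1) = v * p := by
    have := congrFun (congrFun hcoef 0) 1
    simp [coefMat_apply, adjugate_fin_two, coeffMat] at this
    rw [this, hp]; ring
  have hc10 : coef (-1) (α 1 0) = v * q := by
    have := congrFun (congrFun hcoef 1) 0
    simp [coefMat_apply, adjugate_fin_two, coeffMat] at this
    rw [this, hq]; ring
  have htw := isTwisted_adjugate_mul (D.real w hw).1.2.1 (D.isTwisted_dirDeriv hw v)
  have hreal : ∀ l, IsRealMat T ((F w l).adjugate * dirDeriv F v w l) := fun l =>
    (D.isRealMat_F hw l).adjugate_mul (D.isRealMat_dirDeriv hw v l)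
  have h001 := coef_one_of_even (f := α 0 0) fun l => by rw [hαe, hαe]; exact (htw l).1
  have h010 := coef_zero_of_odd (f := α 0 1) fun l => by rw [hαe, hαe]; exact (htw l).2.2.1
  have h100 := coef_zero_of_odd (f := α 1 0) fun l => by rw [hαe, hαe]; exact (htw l).2.2.2
  have hmem : ∀ i j, lam * α i j ∈ diskAlg := hdisk
  -- The reality condition expresses the conjugate of each entry as plus or minus some entry. This
  -- bounds the frequencies from above and determines the λ-coefficients by the λ⁻¹-coefficients.
  have hstar : (∀ i j, lam * star (α i j) ∈ diskAlg) ∧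
      coef 1 (α 0 1) = conj v * hatP T p q ∧ coef 1 (α 1 0) = conj v * hatQ T p q := by
    have hcs : ∀ i j, coef 1 (α i j) = conj (coef (-1) (star (α i j))) := fun i j => by
      rw [coef_star]; simp
    cases T with
    | cmcEuclidean =>
      have e00 : star (α 0 0) = α 1 1 := by
        ext l; rw [ContinuousMap.star_apply, hαe, hαe]; exact (hreal l).1
      have e01 : star (α 0 1) = -α 1 0 := by
        ext l; rw [ContinuousMap.star_apply, ContinuousMap.neg_apply, hαe, hαe]
        exact (hreal l).2
      have e11 : star (α 1 1) = α 0 0 := by rw [← e00, star_star]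
      have e10 : star (α 1 0) = -α 0 1 := by
        rw [← neg_neg (α 1 0), ← e01, star_neg, star_star]
      refine ⟨fun i j => ?_, ?_, ?_⟩
      · fin_cases i <;> fin_cases j
        · simpa only [Fin.zero_eta, e00] using hmem 1 1
        · simpa only [Fin.zero_eta, Fin.mk_one, e01, mul_neg] using neg_mem (hmem 1 0)
        · simpa only [Fin.zero_eta, Fin.mk_one, e10, mul_neg] using neg_mem (hmem 0 1)
        · simpa only [Fin.mk_one, e11] using hmem 0 0
      · rw [hcs, e01, map_neg, hc10]; simp [hatP]
      · rw [hcs, e10, map_neg, hc01]; simp [hatQ]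
    | cmcSpacelike =>
      have e00 : star (α 0 0) = α 1 1 := by
        ext l; rw [ContinuousMap.star_apply, hαe, hαe]; exact (hreal l).1
      have e01 : star (α 0 1) = α 1 0 := by
        ext l; rw [ContinuousMap.star_apply, hαe, hαe]
        exact (hreal l).2
      have e11 : star (α 1 1) = α 0 0 := by rw [← e00, star_star]
      have e10 : star (α 1 0) = α 0 1 := by rw [← e01, star_star]
      refine ⟨fun i j => ?_, ?_, ?_⟩
      · fin_cases i <;> fin_cases j
        · simpa only [Fin.zero_eta, e00] using hmem 1 1
        · simpa only [Fin.zero_eta, Fin.mk_one, e01] using hmem 1 0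
        · simpa only [Fin.zero_eta, Fin.mk_one, e10] using hmem 0 1
        · simpa only [Fin.mk_one, e11] using hmem 0 0
      · rw [hcs, e01, hc10]; simp [hatP]
      · rw [hcs, e10, hc01]; simp [hatQ]
    | cgcTimelike =>
      have e : ∀ i j, star (α i j) = α i j := fun i j => by
        ext l; rw [ContinuousMap.star_apply, hαe]; exact hreal l i j
      refine ⟨fun i j => by rw [e]; exact hmem i j, ?_, ?_⟩
      · rw [hcs, e, hc01]; simp [hatP]
      · rw [hcs, e, hc10]; simp [hatQ]
  obtain ⟨hst, hh01, hh10⟩ := hstar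
  refine ⟨coef 0 (α 0 0), fun l => ?_⟩
  have t00 := DFunLike.congr_fun (eq_three_terms (hmem 0 0) (hst 0 0)) l
  have t01 := DFunLike.congr_fun (eq_three_terms (hmem 0 1) (hst 0 1)) l
  have t10 := DFunLike.congr_fun (eq_three_terms (hmem 1 0) (hst 1 0)) l
  rw [h001.1, h001.2] at t00
  rw [hc01, h010, hh01] at t01
  rw [hc10, h100, hh10] at t10
  simp only [ContinuousMap.add_apply, ContinuousMap.smul_apply, lam_apply, lamInv_apply,
    ContinuousMap.one_apply, smul_eq_mul, zero_mul, mul_one, add_zero, zero_add] at t00 t01 t10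
  have htr := D.trace_maurerCartan hw v l
  rw [trace_fin_two, ← hαe, ← hαe, t00] at htr
  rw [← hαl]
  ext i j; fin_cases i <;> fin_cases j
  · exact t00
  · exact t01
  · exact t10
  · change α 1 1 l = -(coef 0 (α 0 0))
    linear_combination htr

end SplitData

/-! ### The differential of the immersion -/

/-- The off-diagonal matrix `-i ∂_t` of the Maurer-Cartan form. -/
def diffMat (T : SurfaceClass) (p q v : ℂ) (l : Circle) : Mat2 :=
  !![0, -(v * p * (l : ℂ)⁻¹) + conj v * hatP T p q * l;
    -(v * q * (l : ℂ)⁻¹) + conj v * hatQ T p q * l, 0]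

theorem hasMatDerivAt_formMat (T : SurfaceClass) (p q v a : ℂ) (l : Circle) :
    HasMatDerivAt (fun t : ℝ => formMat T p q v a (Circle.exp t * l))
      (Complex.I • diffMat T p q v l) 0 := by
  have h1 : HasDerivAt (fun t : ℝ => ((Circle.exp t * l : Circle) : ℂ)) (Complex.I * l) 0 := by
    have h := ((Complex.ofRealCLM.hasDerivAt (x := (0 : ℝ))).mul_const Complex.I).cexp.mul_const
      (l : ℂ)
    simpa using h
  have h2 : HasDerivAt (fun t : ℝ => ((Circle.exp t * l : Circle) : ℂ)⁻¹)
      (-(Complex.I * (l : ℂ)⁻¹)) 0 := by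
    have hl : (l : ℂ) ≠ 0 := l.coe_ne_zero
    have h := HasDerivAt.fun_inv h1 (by simp [hl])
    refine h.congr_deriv ?_
    simp only [Circle.exp_zero, one_mul]
    field_simp
  intro i j
  fin_cases i <;> fin_cases j
  · simpa [formMat, diffMat] using hasDerivAt_const (0 : ℝ) a
  · refine ((h2.const_mul (v * p)).fun_add (h1.const_mul (conj v * hatP T p q))).congr_deriv ?_
    simp [diffMat]; ring
  · refine ((h2.const_mul (v * q)).fun_add (h1.const_mul (conj v * hatQ T p q))).congr_deriv ?_
    simp [diffMat]; ring
  · simpa [formMat, diffMat] using hasDerivAt_const (0 : ℝ) (-a)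

theorem IsSmoothLoop.hasMatDerivAt_angleDeriv {g : Loop} (hg : IsSmoothLoop g) (l : Circle) :
    HasMatDerivAt (fun t : ℝ => g (Circle.exp t * l)) (angleDeriv g l) 0 := by
  intro i j
  obtain ⟨t₀, rfl⟩ := Circle.exp_surjective l
  have h1 : Differentiable ℝ fun t : ℝ => g (Circle.exp t) i j := (hg i j).differentiable (by simp)
  have h2 : Differentiable ℝ fun t : ℝ => g (Circle.exp (t + t₀)) i j :=
    h1.comp (by fun_prop : Differentiable ℝ fun t : ℝ => t + t₀)
  simp only [Circle.exp_add] at h2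
  exact (h2 0).hasDerivAt

theorem lambdaDeriv_eq (g : Loop) (l : Circle) :
    lambdaDeriv g l = (-Complex.I) • angleDeriv g l := by
  ext i j; simp [lambdaDeriv, angleDeriv]

/-- The tangent vectors of the immersion in the moving frame. -/
def tangentMat (H : ℝ) : SurfaceClass → ℂ → ℂ → ℂ → Circle → Mat2
  | .cgcTimelike, p, q, v, l => (-Complex.I) • diffMat .cgcTimelike p q v l
  | T, p, q, v, l => (2 * Complex.I / H : ℂ) •
      !![0, conj v * hatP T p q * l; -(v * q * (l : ℂ)⁻¹), 0]

/-- The commutator with σ₃ multiplies the off-diagonal entries by −2 and 2, while `diffMat` flips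
the sign of the λ⁻¹-terms. In the combination, one power of λ cancels in each entry and the diagonal
drops out. -/
theorem formMat_sigma3_sub (T : SurfaceClass) (p q v a : ℂ) (l : Circle) (H : ℝ) :
    (-Complex.I / (2 * H)) • ((formMat T p q v a l * sigma3 - sigma3 * formMat T p q v a l) -
      (2 : ℂ) • diffMat T p q v l) = (2 * Complex.I / H : ℂ) •
      !![0, conj v * hatP T p q * l; -(v * q * (l : ℂ)⁻¹), 0] := by
  ext i j
  fin_cases i <;> fin_cases j <;>
    simp [formMat, diffMat, sigma3] <;> ring

namespace SplitData

variable {T : SurfaceClass} {c : ℂ} {U : Set ℂ} {L F B : ℂ → Loop} (D : SplitData T c U L F B)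
  {w : ℂ} (hw : w ∈ U)

include D hw

/-- If dF = Fα then d(∂ₜF · F⁻¹) = F (∂ₜα) F⁻¹: the terms with ∂ₜF cancel. -/
theorem hasMatDerivAt_angle_mul_adjugate {p q v a : ℂ}
    (hform : ∀ l, (F w l).adjugate * dirDeriv F v w l = formMat T p q v a l) (l : Circle) :
    HasMatDerivAt (fun s : ℝ => angleDeriv (F (w + s * v)) l * (F (w + s * v) l).adjugate)
      (F w l * (Complex.I • diffMat T p q v l) * (F w l).adjugate) 0 := by
  have hdir : ∀ l, dirDeriv F v w l = F w l * formMat T p q v a l := fun l => by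
    rw [← hform, ← mul_assoc, mul_adjugate_of_det (D.det_F hw l), one_mul]
  have h1 := ((D.real w hw).1.1.hasMatDerivAt_angleDeriv l).mul
    (hasMatDerivAt_formMat T p q v a l)
  have h2 := D.smooth.hasMatDerivAt_angleDeriv D.isOpen hw v l
    (h1.congr (Filter.Eventually.of_forall fun t => hdir _))
  have h3 := h2.mul (D.hasMatDerivAt_F hw v l).adjugate
  rw [hdir, adjugate_mul_distrib, adjugate_eq_neg_of_trace_eq_zero (trace_formMat T p q v a l)]
    at h3
  simp only [Circle.exp_zero, one_mul, Complex.ofReal_zero, zero_mul, add_zero] at h3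
  convert h3 using 1
  noncomm_ring

theorem hasMatDerivAt_sigma3 {p q v a : ℂ}
    (hform : ∀ l, (F w l).adjugate * dirDeriv F v w l = formMat T p q v a l) (l : Circle) :
    HasMatDerivAt (fun s : ℝ => F (w + s * v) l * sigma3 * (F (w + s * v) l).adjugate)
      (F w l * (formMat T p q v a l * sigma3 - sigma3 * formMat T p q v a l) *
        (F w l).adjugate) 0 := by
  have hdir : ∀ l, dirDeriv F v w l = F w l * formMat T p q v a l := fun l => by
    rw [← hform, ← mul_assoc, mul_adjugate_of_det (D.det_F hw l), one_mul]
  have h1 := D.hasMatDerivAt_F hw v l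
  have h3 := (h1.mul (hasMatDerivAt_const sigma3 0)).mul h1.adjugate
  rw [hdir, adjugate_mul_distrib, adjugate_eq_neg_of_trace_eq_zero (trace_formMat T p q v a l)]
    at h3
  simp only [Complex.ofReal_zero, zero_mul, add_zero] at h3
  convert h3 using 1
  noncomm_ring

theorem hasMatDerivAt_symMap {p q v a : ℂ}
    (hform : ∀ l, (F w l).adjugate * dirDeriv F v w l = formMat T p q v a l) (H : ℝ)
    (l : Circle) :
    HasMatDerivAt (fun s : ℝ => symMap H T (F (w + s * v)) l)
      (F w l * tangentMat H T p q v l * (F w l).adjugate) 0 := by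
  have h1 := D.hasMatDerivAt_angle_mul_adjugate hw hform l
  have h2 := D.hasMatDerivAt_sigma3 hw hform l
  have hI : (-Complex.I) * Complex.I = 1 := by rw [neg_mul, Complex.I_mul_I, neg_neg]
  have h4 : F w l * (Complex.I • diffMat T p q v l) * (F w l).adjugate =
      Complex.I • (F w l * diffMat T p q v l * (F w l).adjugate) := by
    rw [mul_smul_comm, smul_mul_assoc]
  have hcmc : HasMatDerivAt (fun s : ℝ => (-Complex.I / (2 * H)) •
      (F (w + s * v) l * sigma3 * (F (w + s * v) l)⁻¹ -
        (2 : ℂ) • (lambdaDeriv (F (w + s * v)) l * (F (w + s * v) l)⁻¹)))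
      (F w l * ((2 * Complex.I / H : ℂ) •
        !![0, conj v * hatP T p q * l; -(v * q * (l : ℂ)⁻¹), 0]) * (F w l).adjugate) 0 := by
    have h3 := (h2.sub ((h1.const_smul (-Complex.I)).const_smul (2 : ℂ))).const_smul
      (-Complex.I / (2 * H))
    rw [h4, smul_smul (-Complex.I), hI, one_smul] at h3
    rw [← formMat_sigma3_sub T p q v a l H]
    have e : F w l * (-Complex.I / (2 * ↑H)) • (formMat T p q v a l * sigma3 -
        sigma3 * formMat T p q v a l - (2 : ℂ) • diffMat T p q v l) * (F w l).adjugate =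
        (-Complex.I / (2 * ↑H)) • (F w l * (formMat T p q v a l * sigma3 -
          sigma3 * formMat T p q v a l) * (F w l).adjugate -
          (2 : ℂ) • (F w l * diffMat T p q v l * (F w l).adjugate)) := by
      rw [mul_smul_comm, smul_mul_assoc, mul_sub _ _ ((2 : ℂ) • _), sub_mul _ (F w l * _),
        mul_smul_comm, smul_mul_assoc]
    rw [e]
    refine h3.congr ((D.line_mem hw v).mono fun s hs => ?_)
    rw [inv_eq_adjugate (D.det_F hs l), lambdaDeriv_eq, smul_mul_assoc]
  cases T with
  | cmcEuclidean => exact hcmc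
  | cmcSpacelike => exact hcmc
  | cgcTimelike =>
    have h3 := (h1.const_smul (-Complex.I)).const_smul (-Complex.I)
    rw [h4, smul_smul (-Complex.I) Complex.I, hI, one_smul] at h3
    simp only [tangentMat]
    rw [mul_smul_comm, smul_mul_assoc]
    refine h3.congr ((D.line_mem hw v).mono fun s hs => ?_)
    simp only [symMap]
    rw [inv_eq_adjugate (D.det_F hs l), lambdaDeriv_eq, smul_mul_assoc]

end SplitData

/-! ### Comparing the frame at two points with the same tangent plane -/

/-- The diagonal matrix `G` relates the Maurer-Cartan forms with coefficients `p`, `q` and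
`p'`, `q'`. -/
def IsGauge (T : SurfaceClass) (p q p' q' : ℂ) (G : Mat2) : Prop :=
  G 0 1 = 0 ∧ G 1 0 = 0 ∧ p' * G 0 0 = G 1 1 * p ∧ q' * G 1 1 = G 0 0 * q ∧
    hatP T p' q' * G 0 0 = G 1 1 * hatP T p q ∧ hatQ T p' q' * G 1 1 = G 0 0 * hatQ T p q

/-- The tangent matrix contains only q' and `hatP`, one in each off-diagonal entry, multiplied by v
and conj v. Testing on v = 1 and v = i separates them and makes G diagonal. The relation for p comes
from pq = p'q', that is, equal Hopf differentials, and the relation for `hatQ` by conjugation in the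
real form. -/
theorem isGauge_of_cmc {T : SurfaceClass} (hT : T ≠ .cgcTimelike) {H : ℝ} (hH : H ≠ 0)
    {p q p' q' : ℂ} (hpq : p * q = p' * q') (hne : p * q ≠ 0) {l : Circle} {G : Mat2}
    (hG : IsRealMat T G)
    (h : ∀ v, G * tangentMat H T p' q' v l = tangentMat H T p q v l * G) :
    IsGauge T p q p' q' G := by
  have hl : (l : ℂ) ≠ 0 := l.coe_ne_zero
  have hH' : (2 * Complex.I / H : ℂ) ≠ 0 := by
    simp [hH, Complex.I_ne_zero]
  have hp : p ≠ 0 := left_ne_zero_of_mul hne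
  have hq : q ≠ 0 := right_ne_zero_of_mul hne
  have hq' : q' ≠ 0 := right_ne_zero_of_mul (hpq ▸ hne)
  have hE : ∀ v, G * !![0, conj v * hatP T p' q' * l; -(v * q' * (l : ℂ)⁻¹), 0] =
      !![0, conj v * hatP T p q * l; -(v * q * (l : ℂ)⁻¹), 0] * G := by
    intro v
    have := h v
    cases T with
    | cgcTimelike => exact absurd rfl hT
    | cmcEuclidean =>
      simp only [tangentMat] at this
      rw [mul_smul_comm, smul_mul_assoc] at this
      exact smul_right_injective _ hH' this
    | cmcSpacelike =>
      simp only [tangentMat] at this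
      rw [mul_smul_comm, smul_mul_assoc] at this
      exact smul_right_injective _ hH' this
  have hP : hatP T p q ≠ 0 := by
    cases T <;> simp [hatP, hp, hq]
  have e00 := congrFun (congrFun (hE 1) 0) 0
  have f00 := congrFun (congrFun (hE Complex.I) 0) 0
  have e01 := congrFun (congrFun (hE 1) 0) 1
  have e10 := congrFun (congrFun (hE 1) 1) 0
  simp [mul_apply, Fin.sum_univ_two] at e00 f00 e01 e10
  have hI := Complex.I_ne_zero
  have h10 : hatP T p q * l * G 1 0 = 0 := by
    have : Complex.I * (hatP T p q * l * G 1 0) = 0 := by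
      linear_combination (-1 / 2 : ℂ) * f00 - (Complex.I / 2) * e00
    exact (mul_eq_zero.1 this).resolve_left hI
  have g10 : G 1 0 = 0 := (mul_eq_zero.1 h10).resolve_left (mul_ne_zero hP hl)
  have g01 : G 0 1 = 0 := by
    rw [g10] at e00
    simpa [hq', hl] using e00
  have r1 : hatP T p' q' * G 0 0 = G 1 1 * hatP T p q :=
    mul_right_cancel₀ hl (by linear_combination e01)
  have r2 : q' * G 1 1 = G 0 0 * q := by
    have : (l : ℂ)⁻¹ * (q' * G 1 1) = (l : ℂ)⁻¹ * (G 0 0 * q) := by linear_combination e10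
    exact mul_left_cancel₀ (inv_ne_zero hl) this
  have r3 : p' * G 0 0 = G 1 1 * p :=
    mul_right_cancel₀ hq (by linear_combination (-p') * r2 - G 1 1 * hpq)
  refine ⟨g01, g10, r3, r2, r1, ?_⟩
  have r4 := congrArg conj r3
  simp only [map_mul] at r4
  cases T with
  | cgcTimelike => exact absurd rfl hT
  | cmcEuclidean =>
    have h11 : conj (G 1 1) = G 0 0 := by rw [← hG.1, Complex.conj_conj]
    rw [hG.1, h11] at r4
    simp only [hatQ]; linear_combination -r4
  | cmcSpacelike =>
    have h11 : conj (G 1 1) = G 0 0 := by rw [← hG.1, Complex.conj_conj]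
    rw [hG.1, h11] at r4
    simp only [hatQ]; linear_combination r4

/-- The two off-diagonal entries of the tangent matrix have the same shape here, so an antidiagonal
G, which exchanges the roles of p and q, cannot be excluded. Real independence of p' and q' rules
out a mixture. -/
theorem isGauge_or_of_timelike {H : ℝ} {p q p' q' : ℂ} (hne : p * q ≠ 0)
    (hind : p' * conj q' ≠ conj p' * q') {l : Circle} {G : Mat2}
    (h : ∀ v, G * tangentMat H .cgcTimelike p' q' v l =
      tangentMat H .cgcTimelike p q v l * G) :
    IsGauge .cgcTimelike p q p' q' G ∨ (G 0 0 = 0 ∧ G 1 1 = 0) := by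
  have hl : (l : ℂ) ≠ 0 := l.coe_ne_zero
  have hp : p ≠ 0 := left_ne_zero_of_mul hne
  have hq : q ≠ 0 := right_ne_zero_of_mul hne
  have hE : ∀ v, G * diffMat .cgcTimelike p' q' v l = diffMat .cgcTimelike p q v l * G := by
    intro v
    have := h v
    simp only [tangentMat] at this
    rw [mul_smul_comm, smul_mul_assoc] at this
    exact smul_right_injective _ (neg_ne_zero.2 Complex.I_ne_zero) this
  have hI := Complex.I_ne_zero
  have hI2 := Complex.I_mul_I
  have e := fun i j => congrFun (congrFun (hE 1) i) j
  have f := fun i j => congrFun (congrFun (hE Complex.I) i) j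
  have e00 := e 0 0
  have e01 := e 0 1
  have e10 := e 1 0
  have e11 := e 1 1
  have f00 := f 0 0
  have f01 := f 0 1
  have f10 := f 1 0
  have f11 := f 1 1
  simp [mul_apply, Fin.sum_univ_two, diffMat, hatP, hatQ] at e00 e01 e10 e11 f00 f01 f10 f11
  have cancel1 : ∀ {x y : ℂ}, (l : ℂ)⁻¹ * x = (l : ℂ)⁻¹ * y → x = y := fun h =>
    mul_left_cancel₀ (inv_ne_zero hl) h
  have cancel2 : ∀ {x y : ℂ}, (l : ℂ) * x = (l : ℂ) * y → x = y := fun h =>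
    mul_left_cancel₀ hl h
  -- Each entry of the intertwining relation is real linear in v; the combinations of v = 1 and v =
  -- i isolate its λ⁻¹-part and its λ-part.
  have a01 : p' * G 0 0 = G 1 1 * p := cancel1 (by
    linear_combination (-1 / 2 : ℂ) * e01 + (Complex.I / 2) * f01 +
      (1 / 2 : ℂ) * (G 0 0 * (p' * (l : ℂ)⁻¹ + conj p' * l) -
        G 1 1 * (p * (l : ℂ)⁻¹ + conj p * l)) * hI2)
  have b01 : conj p' * G 0 0 = G 1 1 * conj p := cancel2 (by
    linear_combination (1 / 2 : ℂ) * e01 + (Complex.I / 2) * f01 +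
      (1 / 2 : ℂ) * (G 0 0 * (p' * (l : ℂ)⁻¹ + conj p' * l) -
        G 1 1 * (p * (l : ℂ)⁻¹ + conj p * l)) * hI2)
  have a10 : q' * G 1 1 = G 0 0 * q := cancel1 (by
    linear_combination (-1 / 2 : ℂ) * e10 + (Complex.I / 2) * f10 +
      (1 / 2 : ℂ) * (G 1 1 * (q' * (l : ℂ)⁻¹ + conj q' * l) -
        G 0 0 * (q * (l : ℂ)⁻¹ + conj q * l)) * hI2)
  have b10 : conj q' * G 1 1 = G 0 0 * conj q := cancel2 (by
    linear_combination (1 / 2 : ℂ) * e10 + (Complex.I / 2) * f10 +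
      (1 / 2 : ℂ) * (G 1 1 * (q' * (l : ℂ)⁻¹ + conj q' * l) -
        G 0 0 * (q * (l : ℂ)⁻¹ + conj q * l)) * hI2)
  have a00 : q' * G 0 1 = G 1 0 * p := cancel1 (by
    linear_combination (-1 / 2 : ℂ) * e00 + (Complex.I / 2) * f00 +
      (1 / 2 : ℂ) * (G 0 1 * (q' * (l : ℂ)⁻¹ + conj q' * l) -
        G 1 0 * (p * (l : ℂ)⁻¹ + conj p * l)) * hI2)
  have b00 : conj q' * G 0 1 = G 1 0 * conj p := cancel2 (by
    linear_combination (1 / 2 : ℂ) * e00 + (Complex.I / 2) * f00 +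
      (1 / 2 : ℂ) * (G 0 1 * (q' * (l : ℂ)⁻¹ + conj q' * l) -
        G 1 0 * (p * (l : ℂ)⁻¹ + conj p * l)) * hI2)
  have a11 : p' * G 1 0 = G 0 1 * q := cancel1 (by
    linear_combination (-1 / 2 : ℂ) * e11 + (Complex.I / 2) * f11 +
      (1 / 2 : ℂ) * (G 1 0 * (p' * (l : ℂ)⁻¹ + conj p' * l) -
        G 0 1 * (q * (l : ℂ)⁻¹ + conj q * l)) * hI2)
  -- If `G 0 0` and `G 0 1` were both nonzero, p' and q' would both have the argument of p modulo π
  -- and be dependent over ℝ.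
  have key : (p' * conj q' - conj p' * q') * (G 0 0 * G 0 1) = 0 := by
    linear_combination (conj q' * G 0 1) * a01 - (q' * G 0 1) * b01 +
      (G 1 1 * p) * b00 - (G 1 1 * conj p) * a00
  have key2 := (mul_eq_zero.1 key).resolve_left (sub_ne_zero.2 hind)
  rcases mul_eq_zero.1 key2 with h00 | h01
  · right
    refine ⟨h00, ?_⟩
    rw [h00, mul_zero] at a01
    exact (mul_eq_zero.1 a01.symm).resolve_right hp
  · left
    have h10 : G 1 0 = 0 := by
      rw [h01, mul_zero] at a00
      exact (mul_eq_zero.1 a00.symm).resolve_right hp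
    exact ⟨h01, h10, a01, a10, b01, b10⟩

/-- A function on a connected open set whose directional derivatives vanish is constant. -/
theorem eq_of_dirDeriv_eq_zero {U : Set ℂ} (hU : IsOpen U) (hUc : IsPreconnected U) {g : ℂ → ℂ}
    (hg : ∀ w ∈ U, ∀ v : ℂ, HasDerivAt (fun s : ℝ => g (w + s * v)) 0 0) {w w₀ : ℂ}
    (hw : w ∈ U) (hw₀ : w₀ ∈ U) : g w = g w₀ := by
  refine hUc.induction₂ (fun x y => g x = g y) (fun x hx => ?_)
    (fun x y z _ _ _ h1 h2 => h1.trans h2) (fun x y _ _ h => h.symm) hw hw₀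
  apply mem_nhdsWithin_of_mem_nhds
  obtain ⟨r, hr, hrU⟩ := Metric.isOpen_iff.1 hU x hx
  filter_upwards [Metric.ball_mem_nhds x hr] with y hy
  have hd : ∀ s ∈ Set.Icc (0 : ℝ) 1, HasDerivAt (fun s : ℝ => g (x + s * (y - x))) 0 s := by
    intro s hs
    have hmem : x + s * (y - x) ∈ U := by
      apply hrU
      rw [mem_ball_iff_norm] at hy ⊢
      rw [add_sub_cancel_left, norm_mul, Complex.norm_real, Real.norm_eq_abs, abs_of_nonneg hs.1]
      nlinarith [norm_nonneg (y - x), hs.2]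
    have h1 := hg _ hmem (y - x)
    have h2 : HasDerivAt (fun s' : ℝ => s' - s) 1 s := (hasDerivAt_id' s).sub_const s
    have h3 := HasDerivAt.scomp s (h := fun s' : ℝ => s' - s)
      (g₁ := fun s' : ℝ => g (x + s * (y - x) + s' * (y - x))) (by simpa using h1) h2
    rw [smul_zero] at h3
    refine h3.congr_of_eventuallyEq (Filter.Eventually.of_forall fun s' => ?_)
    simp only [Function.comp_def]
    congr 1; push_cast; ring
  have h4 := constant_of_has_deriv_right_zero (f := fun s : ℝ => g (x + s * (y - x))) (a := 0)
    (b := 1) (fun s hs => (hd s hs).continuousAt.continuousWithinAt)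
    (fun s hs => (hd s ⟨hs.1, hs.2.le⟩).hasDerivWithinAt) 1 (by simp)
  simp at h4
  exact h4.symm

/-! ### From a period of the surface to a diagonal gauge of the frame -/

namespace SplitData

variable {T : SurfaceClass} {c : ℂ} {U : Set ℂ} {L F B : ℂ → Loop} (D : SplitData T c U L F B)

include D

/-- The coefficient functions of the Maurer-Cartan form. -/
theorem exists_form_fun : ∃ p q : ℂ → ℂ, ∀ w ∈ U, p w * q w = c * Complex.exp w ∧
    ∀ v, ∃ a, ∀ l, (F w l).adjugate * dirDeriv F v w l = formMat T (p w) (q w) v a l := by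
  choose! p q h using fun w (hw : w ∈ U) => D.exists_form hw
  exact ⟨p, q, h⟩

section Periodic

variable {p q : ℂ → ℂ} (hpq : ∀ w ∈ U, p w * q w = c * Complex.exp w ∧
    ∀ v, ∃ a, ∀ l, (F w l).adjugate * dirDeriv F v w l = formMat T (p w) (q w) v a l)
  {τ : ℂ} {H : ℝ} {l : Circle}

include hpq

/-- Periodicity makes df(v) equal at w and w+τ. Each value is a tangent matrix conjugated by the
frame at that point, and the quotient of the two frames intertwines the tangent matrices. -/
theorem tangentMat_intertwine (hτ : ∀ w ∈ U, w + τ ∈ U)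
    (hf : ∀ w ∈ U, symMap H T (F (w + τ)) l = symMap H T (F w) l) {w : ℂ} (hw : w ∈ U) (v : ℂ) :
    (F w l).adjugate * F (w + τ) l * tangentMat H T (p (w + τ)) (q (w + τ)) v l =
      tangentMat H T (p w) (q w) v l * ((F w l).adjugate * F (w + τ) l) := by
  obtain ⟨a, ha⟩ := (hpq w hw).2 v
  obtain ⟨a', ha'⟩ := (hpq _ (hτ w hw)).2 v
  have h1 := D.hasMatDerivAt_symMap hw ha H l
  have h2 := D.hasMatDerivAt_symMap (hτ w hw) ha' H l
  have h3 := h2.unique (h1.congr ((D.line_mem hw v).mono fun s hs => by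
    rw [← hf _ hs]; congr 2; ring))
  have e1 := mul_adjugate_of_det (D.det_F hw l)
  have e2 := adjugate_mul_of_det (D.det_F hw l)
  have e3 := adjugate_mul_of_det (D.det_F (hτ w hw) l)
  calc _ = (F w l).adjugate * (F (w + τ) l * tangentMat H T (p (w + τ)) (q (w + τ)) v l *
        (F (w + τ) l).adjugate) * F (w + τ) l := by
          simp only [mul_assoc]; rw [e3, mul_one]
    _ = _ := by
      rw [h3]; simp only [← mul_assoc]; rw [e2, one_mul]

theorem linearIndependent_of_immersion (hc : c ≠ 0) (hT : T = .cgcTimelike)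
    (himm : IsImmersionOn U fun w => symMap H T (F w) l) {w : ℂ} (hw : w ∈ U) :
    p w * conj (q w) ≠ conj (p w) * q w := by
  intro hdep
  have hl : (l : ℂ) ≠ 0 := l.coe_ne_zero
  have hp : p w ≠ 0 := by
    have := (hpq w hw).1
    exact left_ne_zero_of_mul (this ▸ mul_ne_zero hc (Complex.exp_ne_zero w))
  -- With v = l conj p the number v p l⁻¹ is real, so the upper entry of the tangent matrix, a
  -- difference of conjugates, vanishes; dependence of p and q kills the lower entry. A nonzero
  -- tangent vector would lie in the kernel of df.
  obtain ⟨a, ha⟩ := (hpq w hw).2 (l * conj (p w))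
  have h1 := D.hasMatDerivAt_symMap hw ha H l
  have hll : conj (l : ℂ) * l = 1 := by
    rw [mul_comm, Complex.mul_conj, Circle.normSq_coe, Complex.ofReal_one]
  have hzero : tangentMat H T (p w) (q w) (l * conj (p w)) l = 0 := by
    subst hT
    simp only [tangentMat, diffMat, hatP, hatQ]
    ext i j
    fin_cases i <;> fin_cases j <;> simp
    · field_simp
      linear_combination (p w * conj (p w)) * hll
    · field_simp
      linear_combination (p w * conj (q w)) * hll + hdep
  rw [hzero, mul_zero, zero_mul] at h1
  obtain ⟨hdiff, hinj⟩ := himm w hw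
  have h2 : HasDerivAt (fun s : ℝ => w + (s : ℂ) * (l * conj (p w))) (l * conj (p w)) 0 := by
    have := ((Complex.ofRealCLM.hasDerivAt (x := (0 : ℝ))).mul_const
      ((l : ℂ) * conj (p w))).const_add w
    simpa using this
  have hd0 : HasFDerivAt (fun v => (fun i j => symMap H T (F v) l i j : Fin 2 → Fin 2 → ℂ))
      (fderiv ℝ (fun v => (fun i j => symMap H T (F v) l i j : Fin 2 → Fin 2 → ℂ)) w)
      (w + ((0 : ℝ) : ℂ) * (l * conj (p w))) := by
    simpa using hdiff.hasFDerivAt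
  have h3 := hd0.comp_hasDerivAt (0 : ℝ) h2
  have h4 : fderiv ℝ (fun v => (fun i j => symMap H T (F v) l i j : Fin 2 → Fin 2 → ℂ)) w
      (l * conj (p w)) = 0 := by
    ext i j
    have h5 := hasDerivAt_pi.1 (hasDerivAt_pi.1 h3 i) j
    exact h5.unique (h1 i j)
  have h6 := hinj (h4.trans (map_zero _).symm)
  simp [hp, hl] at h6

end Periodic

end SplitData

namespace SplitData

variable {T : SurfaceClass} {c : ℂ} {U : Set ℂ} {L F B : ℂ → Loop} (D : SplitData T c U L F B)

include D

theorem continuousOn_entry {τ : ℂ} (hτ : ∀ w ∈ U, w + τ ∈ U) (l : Circle) (i j : Fin 2) :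
    ContinuousOn (fun w => ((F w l).adjugate * F (w + τ) l) i j) U := by
  have h : ∀ i j, ContinuousOn (fun w => F w l i j) U := fun i j w hw =>
    ((D.smooth.continuousAt D.isOpen hw l i j).comp (f := fun w => (w, l))
      (by fun_prop)).continuousWithinAt
  have h' : ∀ i j, ContinuousOn (fun w => F (w + τ) l i j) U := fun i j =>
    (h i j).comp (f := fun w => w + τ) (by fun_prop) hτ
  simp only [mul_apply, Fin.sum_univ_two, adjugate_fin_two]
  refine ContinuousOn.add (ContinuousOn.mul ?_ (h' 0 j)) (ContinuousOn.mul ?_ (h' 1 j))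
  · fin_cases i
    · exact h 1 1
    · exact (h 1 0).neg
  · fin_cases i
    · exact (h 0 1).neg
    · exact h 0 0

theorem det_adjugate_mul {w w' : ℂ} (hw : w ∈ U) (hw' : w' ∈ U) (l : Circle) :
    ((F w l).adjugate * F w' l).det = 1 := by
  rw [det_mul, det_adjugate, D.det_F hw, D.det_F hw']; simp

theorem isRealMat_adjugate_mul {w w' : ℂ} (hw : w ∈ U) (hw' : w' ∈ U) (l : Circle) :
    IsRealMat T ((F w l).adjugate * F w' l) :=
  (D.isRealMat_F hw l).adjugate_mul (D.isRealMat_F hw' l)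

/-- If the surface is invariant under the translation by `τ`, then the frame at `λ = l` changes by
a diagonal gauge under the translation by `τ` or by `2 τ`. -/
theorem exists_gauge {p q : ℂ → ℂ} (hpq : ∀ w ∈ U, p w * q w = c * Complex.exp w ∧
      ∀ v, ∃ a, ∀ l, (F w l).adjugate * dirDeriv F v w l = formMat T (p w) (q w) v a l)
    {τ : ℂ} (hτ : ∀ w ∈ U, w + τ ∈ U) (hexp : Complex.exp τ = 1) {H : ℝ} (hH : H ≠ 0)
    {l : Circle} (hf : ∀ w ∈ U, symMap H T (F (w + τ)) l = symMap H T (F w) l)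
    (himm : T = .cgcTimelike → IsImmersionOn U fun w => symMap H T (F w) l) :
    ∃ m : ℕ, m ≠ 0 ∧ ∀ w ∈ U, w + m * τ ∈ U ∧ IsGauge T (p w) (q w) (p (w + m * τ))
      (q (w + m * τ)) ((F w l).adjugate * F (w + m * τ) l) := by
  have hne : ∀ w ∈ U, p w * q w ≠ 0 := fun w hw => by
    rw [(hpq w hw).1]; exact mul_ne_zero D.ne_zero (Complex.exp_ne_zero w)
  by_cases hT : T = .cgcTimelike
  · subst hT
    have alt : ∀ σ : ℂ, (∀ w ∈ U, w + σ ∈ U) →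
        (∀ w ∈ U, symMap H .cgcTimelike (F (w + σ)) l = symMap H .cgcTimelike (F w) l) →
        ∀ w ∈ U, IsGauge .cgcTimelike (p w) (q w) (p (w + σ)) (q (w + σ))
          ((F w l).adjugate * F (w + σ) l) ∨
          (((F w l).adjugate * F (w + σ) l) 0 0 = 0 ∧ ((F w l).adjugate * F (w + σ) l) 1 1 = 0) :=
      fun σ hσ hfσ w hw => isGauge_or_of_timelike (hne w hw)
        (D.linearIndependent_of_immersion hpq D.ne_zero rfl (himm rfl) (hσ w hw))
        (D.tangentMat_intertwine hpq hσ hfσ hw)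
    have alt1 := alt τ hτ hf
    set G : ℂ → Mat2 := fun w => (F w l).adjugate * F (w + τ) l with hG
    have hdet : ∀ w ∈ U, G w 0 0 * G w 1 1 - G w 0 1 * G w 1 0 = 1 := fun w hw => by
      rw [← det_fin_two]; exact D.det_adjugate_mul hw (hτ w hw) l
    have ho : ∀ i j, IsOpen (U ∩ (fun w => G w i j) ⁻¹' {0}ᶜ) := fun i j =>
      (D.continuousOn_entry hτ l i j).isOpen_inter_preimage D.isOpen isOpen_compl_singleton
    -- Determinant one keeps the first row nonzero, and the alternative makes the two open sets
    -- disjoint. By connectedness the quotient is diagonal everywhere or antidiagonal everywhere.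
    rcases isPreconnected_iff_subset_of_disjoint.1 D.isPreconnected _ _ (ho 0 0) (ho 0 1)
      (by
        intro w hw
        by_cases h0 : G w 0 0 = 0
        · refine Or.inr ⟨hw, fun h1 : G w 0 1 = 0 => ?_⟩
          have := hdet w hw
          rw [h0, h1] at this
          simp at this
        · exact Or.inl ⟨hw, h0⟩)
      (by
        ext w
        simp only [Set.mem_inter_iff, Set.mem_preimage, Set.mem_compl_iff, Set.mem_singleton_iff,
          Set.mem_empty_iff_false, iff_false]
        rintro ⟨hw, ⟨-, h0⟩, -, h1⟩
        rcases alt1 w hw with h | h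
        · exact h1 h.1
        · exact h0 h.1) with hcase | hcase
    · refine ⟨1, one_ne_zero, fun w hw => ?_⟩
      rw [Nat.cast_one, one_mul]
      exact ⟨hτ w hw, (alt1 w hw).resolve_right fun h => (hcase hw).2 h.1⟩
    -- The product of two antidiagonal quotients is diagonal, so the doubled period falls into the
    -- first alternative.
    · have h2τ : ∀ w ∈ U, w + 2 * τ ∈ U := fun w hw => by
        have := hτ _ (hτ w hw)
        rwa [add_assoc, ← two_mul] at this
      have hf2 : ∀ w ∈ U, symMap H .cgcTimelike (F (w + 2 * τ)) l =
          symMap H .cgcTimelike (F w) l := fun w hw => by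
        rw [← hf w hw, ← hf _ (hτ w hw), add_assoc, ← two_mul]
      refine ⟨2, two_ne_zero, fun w hw => ?_⟩
      rw [Nat.cast_ofNat]
      refine ⟨h2τ w hw, (alt (2 * τ) h2τ hf2 w hw).resolve_right fun h => ?_⟩
      have hw' := hτ w hw
      have anti : ∀ w ∈ U, G w 0 0 = 0 ∧ G w 1 1 = 0 := fun w hw =>
        (alt1 w hw).resolve_left fun h => (hcase hw).2 h.1
      have hprod : (F w l).adjugate * F (w + 2 * τ) l = G w * G (w + τ) := by
        simp only [hG]
        rw [mul_assoc, ← mul_assoc (F (w + τ) l), mul_adjugate_of_det (D.det_F hw' l), one_mul,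
          add_assoc w τ τ, ← two_mul]
      have h0 := h.1
      rw [hprod, mul_apply, Fin.sum_univ_two, (anti w hw).1, zero_mul, zero_add] at h0
      have hd := hdet _ hw'
      rw [(anti _ hw').1, zero_mul, zero_sub] at hd
      rcases mul_eq_zero.1 h0 with h1 | h1
      · exact (hcase hw).2 h1
      · rw [h1] at hd; simp at hd
  · refine ⟨1, one_ne_zero, fun w hw => ?_⟩
    rw [Nat.cast_one, one_mul]
    refine ⟨hτ w hw, isGauge_of_cmc hT hH ?_ (hne w hw)
      (D.isRealMat_adjugate_mul hw (hτ w hw) l) (D.tangentMat_intertwine hpq hτ hf hw)⟩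
    rw [(hpq w hw).1, (hpq _ (hτ w hw)).1, Complex.exp_add, hexp, mul_one]

/-- The loop that relates the translated frame to the gauged frame does not depend on the point. -/
theorem gauge_loop_const {p q : ℂ → ℂ} (hpq : ∀ w ∈ U, p w * q w = c * Complex.exp w ∧
      ∀ v, ∃ a, ∀ l, (F w l).adjugate * dirDeriv F v w l = formMat T (p w) (q w) v a l)
    {τ : ℂ} (hτ : ∀ w ∈ U, w + τ ∈ U) {l : Circle}
    (hgauge : ∀ w ∈ U, IsGauge T (p w) (q w) (p (w + τ)) (q (w + τ))
      ((F w l).adjugate * F (w + τ) l)) (l' : Circle) {w w₀ : ℂ} (hw : w ∈ U) (hw₀ : w₀ ∈ U) :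
    F (w + τ) l' * ((F w l).adjugate * F (w + τ) l).adjugate * (F w l').adjugate =
      F (w₀ + τ) l' * ((F w₀ l).adjugate * F (w₀ + τ) l).adjugate * (F w₀ l').adjugate := by
  suffices hd : ∀ w ∈ U, ∀ v : ℂ, HasMatDerivAt (fun s : ℝ => F (w + s * v + τ) l' *
      ((F (w + s * v) l).adjugate * F (w + s * v + τ) l).adjugate *
        (F (w + s * v) l').adjugate) 0 0 by
    ext i j
    exact eq_of_dirDeriv_eq_zero D.isOpen D.isPreconnected
      (g := fun w => (F (w + τ) l' * ((F w l).adjugate * F (w + τ) l).adjugate *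
        (F w l').adjugate) i j) (fun w hw v => hd w hw v i j) hw hw₀
  intro w hw v
  obtain ⟨a, ha⟩ := (hpq w hw).2 v
  obtain ⟨a', ha'⟩ := (hpq _ (hτ w hw)).2 v
  have hdir : ∀ m, dirDeriv F v w m = F w m * formMat T (p w) (q w) v a m := fun m => by
    rw [← ha, ← mul_assoc, mul_adjugate_of_det (D.det_F hw m), one_mul]
  have hdir' : ∀ m, dirDeriv F v (w + τ) m =
      F (w + τ) m * formMat T (p (w + τ)) (q (w + τ)) v a' m := fun m => by
    rw [← ha', ← mul_assoc, mul_adjugate_of_det (D.det_F (hτ w hw) m), one_mul]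
  have h1 : ∀ m, HasMatDerivAt (fun s : ℝ => F (w + s * v) m)
      (F w m * formMat T (p w) (q w) v a m) 0 := fun m => by
    rw [← hdir]; exact D.hasMatDerivAt_F hw v m
  have h2 : ∀ m, HasMatDerivAt (fun s : ℝ => F (w + s * v + τ) m)
      (F (w + τ) m * formMat T (p (w + τ)) (q (w + τ)) v a' m) 0 := fun m => by
    rw [← hdir']
    exact (D.hasMatDerivAt_F (hτ w hw) v m).congr
      (Filter.Eventually.of_forall fun s => by congr 1; ring)
  have h3 := ((h2 l').mul ((h1 l).adjugate.mul (h2 l)).adjugate).mul (h1 l').adjugate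
  have e0 : ∀ m, (formMat T (p w) (q w) v a m).adjugate = -formMat T (p w) (q w) v a m :=
    fun m => adjugate_eq_neg_of_trace_eq_zero (trace_formMat _ _ _ _ _ _)
  have e0' : ∀ m, (formMat T (p (w + τ)) (q (w + τ)) v a' m).adjugate =
      -formMat T (p (w + τ)) (q (w + τ)) v a' m :=
    fun m => adjugate_eq_neg_of_trace_eq_zero (trace_formMat _ _ _ _ _ _)
  simp only [Complex.ofReal_zero, zero_mul, add_zero, adjugate_mul_distrib, adjugate_add_fin_two,
    e0, e0', adjugate_neg_fin_two, neg_neg, adjugate_adjugate_fin_two] at h3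
  have hK := hgauge w hw
  set G := (F w l).adjugate * F (w + τ) l with hG
  have hGK : (F (w + τ) l).adjugate * F w l = G.adjugate := by
    rw [hG, adjugate_mul_distrib, adjugate_adjugate_fin_two]
  -- The unknown diagonal entries a and a' cancel in the difference of two values of λ. The
  -- off-diagonal coefficients do not depend on λ, so the gauge relations found at l apply at l' as
  -- well.
  have hrel : (formMat T (p (w + τ)) (q (w + τ)) v a' l' -
      formMat T (p (w + τ)) (q (w + τ)) v a' l) * G.adjugate =
      G.adjugate * (formMat T (p w) (q w) v a l' - formMat T (p w) (q w) v a l) := by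
    obtain ⟨g01, g10, r1, r2, r3, r4⟩ := hK
    rw [adjugate_fin_two, g01, g10]
    ext i j
    fin_cases i <;> fin_cases j <;> simp [formMat, mul_apply, Fin.sum_univ_two]
    · linear_combination (v * (l' : ℂ)⁻¹ - v * (l : ℂ)⁻¹) * r1 + (conj v * l' - conj v * l) * r3
    · linear_combination (v * (l' : ℂ)⁻¹ - v * (l : ℂ)⁻¹) * r2 + (conj v * l' - conj v * l) * r4
  have hrel' := congrArg (fun M => F (w + τ) l' * M * (F w l').adjugate) hrel
  have hz : ∀ {X : Mat2} {g : ℝ → Mat2}, HasMatDerivAt g X 0 → X = 0 → HasMatDerivAt g 0 0 :=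
    fun h e => e ▸ h
  simp only [adjugate_mul_distrib, adjugate_adjugate_fin_two]
  refine hz h3 ?_
  rw [← sub_eq_zero] at hrel'
  rw [← hrel', ← hGK]
  noncomm_ring

end SplitData

/-! ### Killing fields of the potential in the disk algebra -/

/-- The potential in the coordinate `w = log z` as a matrix of functions of `λ`. -/
def potMat (c w : ℂ) : Matrix (Fin 2) (Fin 2) CircFun := lamInv • constMat (coeffMat c w)

theorem trace_potMat (c w : ℂ) : (potMat c w).trace = 0 := by
  ext l
  have h : (constMat (coeffMat c w)).trace = 0 := by
    simp [constMat, coeffMat, trace_fin_two]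
  rw [potMat, trace_smul, h, smul_zero]

theorem coefMat_lamInv_smul (n : ℤ) (M : Matrix (Fin 2) (Fin 2) CircFun) :
    coefMat n (lamInv • M) = coefMat (n + 1) M := by
  have := coefMat_lam_smul (n + 1) (lamInv • M)
  rw [smul_smul, lam_mul_lamInv, one_smul, add_sub_cancel_right] at this
  exact this.symm

/-- A trace free solution of `dX = [X, ξ]` with values in the matrices over the disk algebra. -/
def IsKilling (c : ℂ) (U : Set ℂ) (X : ℂ → Matrix (Fin 2) (Fin 2) CircFun) : Prop :=
  ∀ w ∈ U, InDisk (X w) ∧ (X w).trace = 0 ∧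
    HasMatDerivAt X (X w * potMat c w - potMat c w * X w) w

/-- The factor λ⁻¹ in the potential turns the equation into a ladder: the n-th coefficient is driven
by the (n+1)-st. -/
theorem IsKilling.hasMatDerivAt_coefMat {c : ℂ} {U : Set ℂ}
    {X : ℂ → Matrix (Fin 2) (Fin 2) CircFun} (hX : IsKilling c U X) {w : ℂ} (hw : w ∈ U) (n : ℤ) :
    HasMatDerivAt (fun w => coefMat n (X w))
      (coefMat (n + 1) (X w) * coeffMat c w - coeffMat c w * coefMat (n + 1) (X w)) w := by
  have e : coefMat (n + 1) (X w) * coeffMat c w - coeffMat c w * coefMat (n + 1) (X w) =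
      coefMat n (X w * potMat c w - potMat c w * X w) := by
    rw [coefMat_sub, potMat, mul_smul_comm, smul_mul_assoc, coefMat_lamInv_smul,
      coefMat_lamInv_smul, coefMat_mul_constMat, coefMat_constMat_mul]
  rw [e]
  intro i j
  exact (coef n).hasFDerivAt.comp_hasDerivAt w ((hX w hw).2.2 i j)

theorem coefMat_eq_zero_of_neg {M : Matrix (Fin 2) (Fin 2) CircFun} (hM : InDisk M) {n : ℤ}
    (hn : n < 0) : coefMat n M = 0 := by
  ext i j; exact coef_eq_zero_of_neg (hM i j) hn

theorem eq_zero_of_coefMat {M : Matrix (Fin 2) (Fin 2) CircFun} (hM : InDisk M)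
    (h : ∀ n : ℕ, coefMat n M = 0) : M = 0 := by
  refine Matrix.ext fun i j => circFun_eq_zero fun n => ?_
  rcases lt_or_ge n 0 with hn | hn
  · exact coef_eq_zero_of_neg (hM i j) hn
  · lift n to ℕ using hn
    exact congrFun (congrFun (h n) i) j

theorem trace_coefMat {M : Matrix (Fin 2) (Fin 2) CircFun} (h : M.trace = 0) (n : ℤ) :
    (coefMat n M).trace = 0 := by
  rw [trace_fin_two] at h ⊢
  rw [coefMat_apply, coefMat_apply, ← map_add, h, map_zero]

/-- The leading coefficient of a nonzero Killing field is a nonvanishing multiple of the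
coefficient matrix of the potential. -/
theorem IsKilling.exists_leading {c : ℂ} (hc : c ≠ 0) {U : Set ℂ} (hU : IsOpen U)
    (hUc : IsPreconnected U) {X : ℂ → Matrix (Fin 2) (Fin 2) CircFun} (hX : IsKilling c U X)
    {w₁ : ℂ} (hw₁ : w₁ ∈ U) (hne : X w₁ ≠ 0) :
    ∃ (m : ℕ) (a : ℂ → ℂ), ∀ w ∈ U, a w ≠ 0 ∧ (∀ k < m, coefMat k (X w) = 0) ∧
      coefMat m (X w) = a w • coeffMat c w := by
  classical
  have hex : ∃ k : ℕ, ∃ w ∈ U, coefMat k (X w) ≠ 0 := by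
    by_contra! h
    exact hne (eq_zero_of_coefMat (hX w₁ hw₁).1 fun n => h n w₁ hw₁)
  -- The order is minimal over all of U, so the lower coefficients vanish identically and their
  -- derivatives vanish too.
  set m := Nat.find hex with hm
  obtain ⟨w₂, hw₂, hne₂⟩ := Nat.find_spec hex
  have hlow : ∀ w ∈ U, ∀ k < m, coefMat k (X w) = 0 := by
    intro w hw k hk
    by_contra h
    exact Nat.find_min hex hk ⟨w, hw, h⟩
  have hlow' : ∀ w ∈ U, coefMat ((m : ℤ) - 1) (X w) = 0 := by
    intro w hw
    rcases Nat.eq_zero_or_pos m with h0 | h0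
    · exact coefMat_eq_zero_of_neg (hX w hw).1 (by omega)
    · have := hlow w hw (m - 1) (by omega)
      rwa [Nat.cast_sub h0, Nat.cast_one] at this
  -- This is the equation in degree m − 1. For m = 0 it concerns the coefficient of λ⁻¹, which
  -- vanishes in the disk algebra.
  have hcomm : ∀ w ∈ U, coefMat m (X w) * coeffMat c w = coeffMat c w * coefMat m (X w) := by
    intro w hw
    have h1 := hX.hasMatDerivAt_coefMat hw ((m : ℤ) - 1)
    rw [sub_add_cancel] at h1
    have h2 := h1.unique ((hasMatDerivAt_const 0 w).congr
      (Filter.mem_of_superset (hU.mem_nhds hw) fun y hy => hlow' y hy))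
    exact sub_eq_zero.1 h2
  have hexp := Complex.exp_ne_zero
  have hentry : ∀ w ∈ U, coefMat m (X w) 0 0 = 0 ∧ coefMat m (X w) 1 1 = 0 ∧
      coefMat m (X w) 0 1 = Complex.exp w * coefMat m (X w) 1 0 / c := by
    intro w hw
    have h00 := congrFun (congrFun (hcomm w hw) 0) 0
    have h01 := congrFun (congrFun (hcomm w hw) 0) 1
    simp only [mul_apply, Fin.sum_univ_two, coeffMat, of_apply, cons_val', cons_val_zero,
      cons_val_one, cons_val_fin_one, mul_zero, zero_mul, zero_add, add_zero] at h00 h01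
    have htr := trace_coefMat (hX w hw).2.1 m
    rw [trace_fin_two] at htr
    have h0 : coefMat m (X w) 0 0 = 0 := by
      have : (2 * Complex.exp w) * coefMat m (X w) 0 0 = 0 := by
        linear_combination h01 + Complex.exp w * htr
      exact (mul_eq_zero.1 this).resolve_left (mul_ne_zero two_ne_zero (hexp w))
    refine ⟨h0, by rw [h0, zero_add] at htr; exact htr, ?_⟩
    field_simp
    linear_combination h00
  -- The unknown coefficient m + 1 enters both off-diagonal entries through the same difference of
  -- its diagonal entries. As these two entries are proportional by `hentry`, it can be eliminated.
  have hder : ∀ w ∈ U, HasDerivAt (fun w => coefMat m (X w) 1 0)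
      (-(coefMat m (X w) 1 0) / 2) w := by
    intro w hw
    have h1 := hX.hasMatDerivAt_coefMat hw m
    have h10 := h1 1 0
    have h01 := h1 0 1
    have h01' := ((Complex.hasDerivAt_exp w).fun_mul h10).div_const c
    have heq := h01.unique (h01'.congr_of_eventuallyEq
      (Filter.mem_of_superset (hU.mem_nhds hw) fun y hy => (hentry y hy).2.2))
    refine h10.congr_deriv ?_
    simp only [Matrix.sub_apply, mul_apply, Fin.sum_univ_two, coeffMat, of_apply, cons_val',
      cons_val_zero, cons_val_one, cons_val_fin_one, mul_zero, zero_mul, zero_add, add_zero]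
      at heq ⊢
    rw [eq_div_iff hc] at heq
    have h2 : Complex.exp w * 2 * (coefMat ((m : ℤ) + 1) (X w) 1 1 * c -
        c * coefMat ((m : ℤ) + 1) (X w) 0 0) =
        Complex.exp w * 2 * (-(coefMat m (X w) 1 0) / 2) := by
      linear_combination -heq
    exact mul_left_cancel₀ (mul_ne_zero (hexp w) two_ne_zero) h2
  -- Up to the factor 2 / c this is the trace of the square of the leading coefficient. Being
  -- constant, it is nonzero everywhere once it is nonzero at w₂.
  have hconst : ∀ w ∈ U, coefMat m (X w) 1 0 ^ 2 * Complex.exp w =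
      coefMat m (X w₂) 1 0 ^ 2 * Complex.exp w₂ := by
    intro w hw
    have hd : ∀ w ∈ U, HasDerivAt (fun w => coefMat m (X w) 1 0 ^ 2 * Complex.exp w) 0 w := by
      intro w hw
      refine (((hder w hw).fun_pow 2).fun_mul (Complex.hasDerivAt_exp w)).congr_deriv ?_
      push_cast; ring
    exact hU.is_const_of_deriv_eq_zero hUc
      (fun w hw => (hd w hw).differentiableAt.differentiableWithinAt)
      (fun w hw => (hd w hw).deriv) hw hw₂
  have hne10 : coefMat m (X w₂) 1 0 ≠ 0 := by
    intro h
    apply hne₂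
    obtain ⟨e1, e2, e3⟩ := hentry w₂ hw₂
    rw [h, mul_zero, zero_div] at e3
    ext i j; fin_cases i <;> fin_cases j
    · exact e1
    · exact e3
    · exact h
    · exact e2
  refine ⟨m, fun w => coefMat m (X w) 1 0 / c, fun w hw => ⟨?_, hlow w hw, ?_⟩⟩
  · refine div_ne_zero (fun h => ?_) hc
    have := hconst w hw
    rw [h, zero_pow two_ne_zero, zero_mul] at this
    exact mul_ne_zero (pow_ne_zero 2 hne10) (hexp w₂) this.symm
  · obtain ⟨e1, e2, e3⟩ := hentry w hw
    ext i j; fin_cases i <;> fin_cases j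
    · simpa [coeffMat] using e1
    · simp [coeffMat]; rw [e3]; ring
    · simp [coeffMat]; field_simp
    · simpa [coeffMat] using e2

/-- Two Killing fields have a nonzero trace pairing unless one of them vanishes. -/
theorem IsKilling.trace_mul_ne_zero {c : ℂ} (hc : c ≠ 0) {U : Set ℂ} (hU : IsOpen U)
    (hUc : IsPreconnected U) {X Y : ℂ → Matrix (Fin 2) (Fin 2) CircFun} (hX : IsKilling c U X)
    (hY : IsKilling c U Y) {w₁ w₂ w : ℂ} (hw₁ : w₁ ∈ U) (hXne : X w₁ ≠ 0) (hw₂ : w₂ ∈ U)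
    (hYne : Y w₂ ≠ 0) (hw : w ∈ U) : (X w * Y w).trace ≠ 0 := by
  obtain ⟨m, a, ha⟩ := hX.exists_leading hc hU hUc hw₁ hXne
  obtain ⟨n, b, hb⟩ := hY.exists_leading hc hU hUc hw₂ hYne
  obtain ⟨ha0, ha1, ha2⟩ := ha w hw
  obtain ⟨hb0, hb1, hb2⟩ := hb w hw
  intro h
  -- In lowest degree m + n the product is a b A², whose trace is 2 a b c exp w.
  have hmul : ∀ i j k, coef ((m + n : ℕ) : ℤ) (X w i k * Y w k j) =
      (a w • coeffMat c w) i k * (b w • coeffMat c w) k j := by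
    intro i j k
    rw [← ha2, ← hb2]
    exact coef_add_mul ((hX w hw).1 i k) ((hY w hw).1 k j)
      (fun r hr => congrFun (congrFun (ha1 r hr) i) k)
      (fun r hr => congrFun (congrFun (hb1 r hr) k) j)
  have h1 := congrArg (coef ((m + n : ℕ) : ℤ)) h
  rw [trace_fin_two, mul_apply, mul_apply, Fin.sum_univ_two, Fin.sum_univ_two, map_zero] at h1
  simp only [map_add, hmul] at h1
  simp [coeffMat] at h1
  have h2 : 2 * (a w * b w * (c * Complex.exp w)) = 0 := by linear_combination h1
  simp [ha0, hb0, hc] at h2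

theorem IsKilling.commutator {c : ℂ} {U : Set ℂ} {X Y : ℂ → Matrix (Fin 2) (Fin 2) CircFun}
    (hX : IsKilling c U X) (hY : IsKilling c U Y) :
    IsKilling c U fun w => X w * Y w - Y w * X w := by
  intro w hw
  obtain ⟨h1, h2, h3⟩ := hX w hw
  obtain ⟨h4, h5, h6⟩ := hY w hw
  refine ⟨(h1.mul h4).sub (h4.mul h1), ?_, ?_⟩
  · rw [trace_sub, trace_mul_comm, sub_self]
  · have := (h3.mul h6).sub (h6.mul h3)
    refine cast (congrArg (fun M => HasMatDerivAt _ M w) ?_) this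
    noncomm_ring

/-- Any two Killing fields commute. -/
theorem IsKilling.commute {c : ℂ} (hc : c ≠ 0) {U : Set ℂ} (hU : IsOpen U)
    (hUc : IsPreconnected U) {X Y : ℂ → Matrix (Fin 2) (Fin 2) CircFun} (hX : IsKilling c U X)
    (hY : IsKilling c U Y) {w₁ w : ℂ} (hw₁ : w₁ ∈ U) (hXne : X w₁ ≠ 0) (hw : w ∈ U) :
    X w * Y w = Y w * X w := by
  by_contra hne
  -- The commutator is itself a Killing field, and tr([X, Y] X) = 0, so it must vanish.
  refine (hX.commutator hY).trace_mul_ne_zero hc hU hUc hX hw (sub_ne_zero.2 hne) hw₁ hXne hw ?_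
  rw [sub_mul, trace_sub, mul_assoc, trace_mul_comm, sub_self]

/-- A unipotent matrix that conjugates a regular trace free matrix into its commutant is
trivial. -/
theorem eq_zero_of_conj_commute {X N : Mat2} (htr : X.trace = 0) (hdet : X.det ≠ 0)
    (hN : N * N = 0) (hcomm : X * ((1 + N).adjugate * X * (1 + N)) =
      (1 + N).adjugate * X * (1 + N) * X) : N = 0 := by
  -- Conceptually, a trace free conjugate of X in the commutant of X is X or −X. The sign −1 would
  -- make 1 + N similar to −(1 + N), and the sign +1 makes the nilpotent N commute with a matrix
  -- with distinct eigenvalues. The computation below reaches N = 0 from the anticommutator XN + NX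
  -- = tr(XN).
  have hNdet : N.det = 0 := by
    have := congrArg det hN
    rw [det_mul, det_zero] at this
    exact mul_self_eq_zero.1 this
  have hNtr : N.trace = 0 := by
    have h1 : N * N = N.trace • N - N.det • 1 := by
      ext i j
      fin_cases i <;> fin_cases j <;>
        simp [mul_apply, Fin.sum_univ_two, trace_fin_two, det_fin_two] <;> ring
    rw [hN, hNdet, zero_smul, sub_zero] at h1
    rcases smul_eq_zero.1 h1.symm with h | h
    · exact h
    · rw [h, trace_zero]
  have hXX : X * X = -(X.det • 1) := by
    ext i j
    rw [trace_fin_two] at htr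
    have h11 : X 1 1 = -X 0 0 := by linear_combination htr
    fin_cases i <;> fin_cases j <;>
      simp [mul_apply, Fin.sum_univ_two, det_fin_two, h11] <;> ring
  have hanti : X * N = (X * N).trace • 1 - N * X := by
    rw [trace_fin_two] at htr hNtr
    have h11 : X 1 1 = -X 0 0 := by linear_combination htr
    have n11 : N 1 1 = -N 0 0 := by linear_combination hNtr
    ext i j
    fin_cases i <;> fin_cases j <;>
      simp [mul_apply, Fin.sum_univ_two, trace_fin_two, h11, n11] <;> ring
  set t := (X * N).trace
  have hadj : (1 + N).adjugate = 1 - N := by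
    rw [adjugate_add_fin_two, adjugate_one, adjugate_eq_neg_of_trace_eq_zero hNtr, sub_eq_add_neg]
  rw [hadj] at hcomm
  have hNXN : N * X * N = t • N := by
    rw [mul_assoc, hanti, mul_sub, ← mul_assoc, hN, zero_mul, sub_zero, mul_smul_comm, mul_one]
  have hY : (1 - N) * X * (1 + N) = X + t • 1 - (2 : ℂ) • (N * X) - t • N := by
    have : (1 - N) * X * (1 + N) = X + X * N - N * X - N * X * N := by noncomm_ring
    rw [this, hNXN, hanti, two_smul]; abel
  have hNXX : N * X * X = -(X.det • N) := by
    rw [mul_assoc, hXX, mul_neg, mul_smul_comm, mul_one]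
  have hXNX : X * (N * X) = t • X + X.det • N := by
    rw [← mul_assoc, hanti, sub_mul, hNXX, smul_mul_assoc, one_mul, sub_neg_eq_add]
  rw [hY] at hcomm
  simp only [mul_add, mul_sub, add_mul, sub_mul, mul_smul_comm, smul_mul_assoc, mul_one, one_mul,
    hXNX, hNXX, hanti] at hcomm
  -- Multiplying this by N on the left and then on the right leaves 2t² N = 0, and for t = 0 the
  -- relation itself reads 4 det(X) N = 0.
  have hrel : (2 * t) • (N * X) = (2 * t) • X + (4 * X.det) • N + (t * t) • (1 : Mat2) := by
    rw [← sub_eq_zero] at hcomm ⊢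
    rw [← hcomm]
    module
  have h1 : (t * t) • N = -((2 * t) • (N * X)) := by
    have := congrArg (N * ·) hrel
    simp only [mul_add, mul_smul_comm, ← mul_assoc, hN, zero_mul, smul_zero, mul_one,
      add_zero] at this
    rw [eq_neg_iff_add_eq_zero, add_comm]
    exact this.symm
  have h2 : (2 * t * t) • N = 0 := by
    have := congrArg (· * N) h1
    simp only [neg_mul, smul_mul_assoc, hN, smul_zero, hNXN, smul_smul] at this
    exact neg_eq_zero.1 this.symm
  rcases smul_eq_zero.1 h2 with ht | hN0
  · have ht0 : t = 0 := by
      rcases mul_eq_zero.1 ht with h | h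
      · exact (mul_eq_zero.1 h).resolve_left two_ne_zero
      · exact h
    rw [ht0] at hrel
    simp only [mul_zero, zero_smul, zero_add, add_zero] at hrel
    exact (smul_eq_zero.1 hrel.symm).resolve_left (mul_ne_zero (by norm_num) hdet)
  · exact hN0

/-! ### The gauge contradicts the logarithmic monodromy -/

namespace SplitData

variable {T : SurfaceClass} {c : ℂ} {U : Set ℂ} {L F B : ℂ → Loop} (D : SplitData T c U L F B)

include D

theorem hasMatDerivAt_L_add {n : ℤ} (hτ : ∀ w ∈ U, w + 2 * Real.pi * Complex.I * n ∈ U)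
    (l : Circle) {w : ℂ} (hw : w ∈ U) :
    HasMatDerivAt (fun w => L (w + 2 * Real.pi * Complex.I * n) l)
      (L (w + 2 * Real.pi * Complex.I * n) l * ((l : ℂ)⁻¹ • coeffMat c w)) w := by
  intro i j
  have h := D.hasMatDerivAt_L l (hτ w hw) i j
  rw [coeffMat_periodic] at h
  exact HasDerivAt.comp_add_const w _ h

theorem hasMatDerivAt_loopFun_L_add {n : ℤ}
    (hτ : ∀ w ∈ U, w + 2 * Real.pi * Complex.I * n ∈ U) {w : ℂ} (hw : w ∈ U) :
    HasMatDerivAt (fun w => loopFun (L (w + 2 * Real.pi * Complex.I * n)))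
      (loopFun (L (w + 2 * Real.pi * Complex.I * n)) * potMat c w) w := by
  intro i j
  have h := D.hasMatDerivAt_loopFun_L (hτ w hw) i j
  rw [coeffMat_periodic] at h
  exact HasDerivAt.comp_add_const w _ h

/-- The frame at a fixed `λ` cannot change by a diagonal gauge under a deck transformation. -/
theorem not_gauge (hne : U.Nonempty) {n : ℤ} (hn : n ≠ 0)
    (hτ : ∀ w ∈ U, w + 2 * Real.pi * Complex.I * n ∈ U) {p q : ℂ → ℂ}
    (hpq : ∀ w ∈ U, p w * q w = c * Complex.exp w ∧
      ∀ v, ∃ a, ∀ l, (F w l).adjugate * dirDeriv F v w l = formMat T (p w) (q w) v a l)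
    {l : Circle}
    (hgauge : ∀ w ∈ U, IsGauge T (p w) (q w) (p (w + 2 * Real.pi * Complex.I * n))
      (q (w + 2 * Real.pi * Complex.I * n))
      ((F w l).adjugate * F (w + 2 * Real.pi * Complex.I * n) l)) : False := by
  obtain ⟨w₀, hw₀⟩ := hne
  have hLτ := fun w hw => D.hasMatDerivAt_loopFun_L_add hτ (w := w) hw
  have hLτl := fun l w hw => D.hasMatDerivAt_L_add hτ l (w := w) hw
  have hcp := fun w => coeffMat_periodic c w n
  have hmon := fun (l : Circle) (w : ℂ) (hw : w ∈ U) => solution_monodromy D.ne_zero D.isOpen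
    D.isPreconnected (fun w hw => D.hasMatDerivAt_L l hw) hn hw (hτ w hw)
  set τ : ℂ := 2 * Real.pi * Complex.I * n with hτdef
  set k : ℂ → Mat2 := fun w => (F w l).adjugate * F (w + τ) l with hk
  set R : Circle → Mat2 := fun l' => F (w₀ + τ) l' * (k w₀).adjugate * (F w₀ l').adjugate with hR
  set S : Matrix (Fin 2) (Fin 2) CircFun := (loopFun (F (w₀ + τ)) * constMat (k w₀).adjugate *
    (loopFun (F w₀)).adjugate).adjugate with hS
  have hSl : ∀ l', S.map (ev l') = (R l').adjugate := by
    intro l'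
    rw [hS, map_ev_adjugate, map_ev_mul, map_ev_mul, map_ev_adjugate, map_constMat,
      map_loopFun (D.isContLoop_F (hτ w₀ hw₀)), map_loopFun (D.isContLoop_F hw₀)]
  have hRl : R l = 1 := by
    simp only [hR, hk]
    rw [adjugate_mul_distrib, adjugate_adjugate_fin_two, ← mul_assoc,
      mul_adjugate_of_det (D.det_F (hτ w₀ hw₀) l), one_mul, mul_adjugate_of_det (D.det_F hw₀ l)]
  set h : ℂ → Matrix (Fin 2) (Fin 2) CircFun :=
    fun w => (loopFun (L w)).adjugate * S * loopFun (L (w + τ)) with hh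
  have hhl : ∀ w ∈ U, ∀ l', (h w).map (ev l') =
      (L w l').adjugate * (R l').adjugate * L (w + τ) l' := by
    intro w hw l'
    rw [hh, map_ev_mul, map_ev_mul, map_ev_adjugate, map_loopFun (D.isContLoop_L hw),
      map_loopFun (D.isContLoop_L (hτ w hw)), hSl]
  have hdisk : ∀ w ∈ U, InDisk (h w) := by
    intro w hw
    -- Since R can be written with w in place of w₀, the frames in L = FB cancel. Only positive
    -- loops and a matrix constant in λ remain.
    have e : h w = (loopFun (B w)).adjugate * constMat (k w) * loopFun (B (w + τ)) := by
      apply circMat_ext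
      intro l'
      rw [hhl w hw, map_ev_mul, map_ev_mul, map_ev_adjugate, map_loopFun (D.isContLoop_B hw),
        map_loopFun (D.isContLoop_B (hτ w hw)), map_constMat, D.split w hw, D.split _ (hτ w hw)]
      have hRw : R l' = F (w + τ) l' * (k w).adjugate * (F w l').adjugate :=
        D.gauge_loop_const hpq hτ hgauge l' hw₀ hw
      rw [hRw]
      simp only [adjugate_mul_distrib, adjugate_adjugate_fin_two, mul_assoc]
      rw [← mul_assoc (F (w + τ) l').adjugate, adjugate_mul_of_det (D.det_F (hτ w hw) l'),
        one_mul, ← mul_assoc (F w l').adjugate, adjugate_mul_of_det (D.det_F hw l'), one_mul]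
    rw [e]
    exact ((D.inDisk_B hw).adjugate.mul (inDisk_constMat _)).mul (D.inDisk_B (hτ w hw))
  have hder : ∀ w ∈ U, HasMatDerivAt h (h w * potMat c w - potMat c w * h w) w := by
    intro w hw
    have h1 := ((D.hasMatDerivAt_loopFun_L hw).adjugate.mul (hasMatDerivAt_const S w)).mul
      (hLτ w hw)
    rw [adjugate_mul_distrib, ← potMat, adjugate_eq_neg_of_trace_eq_zero (trace_potMat c w)] at h1
    refine cast (congrArg (fun M => HasMatDerivAt _ M w) ?_) h1
    simp only [hh]
    noncomm_ring
  -- This is twice the trace free part of h.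
  set X : ℂ → Matrix (Fin 2) (Fin 2) CircFun := fun w => h w - (h w).adjugate with hX
  have hXK : IsKilling c U X := by
    intro w hw
    refine ⟨(hdisk w hw).sub (hdisk w hw).adjugate, ?_, ?_⟩
    · simp only [hX, trace_fin_two, adjugate_fin_two, Matrix.sub_apply, of_apply, cons_val',
        cons_val_zero, cons_val_one, cons_val_fin_one]
      ring
    · have h1 := (hder w hw).sub (hder w hw).adjugate
      rw [sub_eq_add_neg (h w * potMat c w), adjugate_add_fin_two, adjugate_neg_fin_two,
        adjugate_mul_distrib (h w) (potMat c w), adjugate_mul_distrib (potMat c w) (h w),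
        adjugate_eq_neg_of_trace_eq_zero (trace_potMat c w)] at h1
      refine cast (congrArg (fun M => HasMatDerivAt _ M w) ?_) h1
      simp only [hX]
      noncomm_ring
  -- The potential has period 2πi in w, so translates of Killing fields are Killing fields.
  have hYK : IsKilling c U fun w => X (w + τ) := by
    intro w hw
    obtain ⟨h1, h2, h3⟩ := hXK _ (hτ w hw)
    refine ⟨h1, h2, fun i j => ?_⟩
    have h4 := h3 i j
    rw [potMat, hcp, ← potMat] at h4
    exact HasDerivAt.comp_add_const w τ h4
  have hXl : ∀ w l', (X w).map (ev l') = (h w).map (ev l') - ((h w).map (ev l')).adjugate := by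
    intro w l'
    rw [← map_ev_adjugate]
    ext i j; simp [hX]
  by_cases hX0 : ∃ w₁ ∈ U, X w₁ ≠ 0
  · obtain ⟨w₁, hw₁, hne₁⟩ := hX0
    have htr := hXK.trace_mul_ne_zero D.ne_zero D.isOpen D.isPreconnected hXK hw₁ hne₁ hw₁ hne₁ hw₁
    -- For a trace free matrix tr X² = −2 det X, so X is regular at this l'. The value l' need not
    -- be l, because the monodromy is nontrivial at every λ.
    obtain ⟨l', hl'⟩ : ∃ l', (X w₁ * X w₁).trace l' ≠ 0 := by
      by_contra! hz
      exact htr (ContinuousMap.ext hz)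
    have hcomm := hXK.commute D.ne_zero D.isOpen D.isPreconnected hYK hw₁ hne₁ hw₁
    obtain ⟨N, hN0, hN2, hNL⟩ := hmon l' w₁ hw₁
    apply hN0
    have hconst := solution_mul_adjugate_const D.isOpen D.isPreconnected (hLτl l')
      (fun w hw => D.hasMatDerivAt_L l' hw) hw₁ (hτ w₁ hw₁)
    -- The left monodromy L(w+τ)L(w)⁻¹ is constant, so the right factor 1 + N found at w₁ also leads
    -- from w₁ + τ to w₁ + 2τ.
    have hL2 : L (w₁ + τ + τ) l' = L (w₁ + τ) l' * (1 + N) := by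
      have e1 := congrArg (· * L (w₁ + τ) l') hconst
      simp only [mul_assoc] at e1
      rw [adjugate_mul_of_det (D.det_L (hτ w₁ hw₁) l'), mul_one] at e1
      rw [← e1]
      nth_rewrite 2 [hNL]
      rw [← mul_assoc (L w₁ l').adjugate, adjugate_mul_of_det (D.det_L hw₁ l'), one_mul]
    have hhY : (h (w₁ + τ)).map (ev l') = (1 + N).adjugate * (h w₁).map (ev l') * (1 + N) := by
      rw [hhl _ (hτ w₁ hw₁), hhl _ hw₁, hL2]
      nth_rewrite 1 [hNL]
      rw [adjugate_mul_distrib]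
      simp only [mul_assoc]
    have hXY : (X (w₁ + τ)).map (ev l') = (1 + N).adjugate * (X w₁).map (ev l') * (1 + N) := by
      rw [hXl, hXl, hhY]
      simp only [adjugate_mul_distrib, adjugate_adjugate_fin_two, mul_sub, sub_mul, mul_assoc]
    have hXtr : ((X w₁).map (ev l')).trace = 0 := by
      have := congrArg (ev l') (hXK w₁ hw₁).2.1
      rw [trace_fin_two, map_add, map_zero] at this
      rw [trace_fin_two]
      exact this
    refine eq_zero_of_conj_commute hXtr (fun hdet => hl' ?_) hN2 ?_
    · have e : (X w₁ * X w₁).trace l' = ((X w₁).map (ev l') * (X w₁).map (ev l')).trace := by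
        rw [← map_ev_mul, trace_fin_two, trace_fin_two]; rfl
      rw [e]
      rw [trace_fin_two] at hXtr
      rw [det_fin_two] at hdet
      rw [trace_fin_two, mul_apply, mul_apply, Fin.sum_univ_two, Fin.sum_univ_two]
      linear_combination ((X w₁).map (ev l') 0 0 + (X w₁).map (ev l') 1 1) * hXtr - 2 * hdet
    · rw [← hXY, ← map_ev_mul, ← map_ev_mul]
      exact congrArg (fun M : Matrix (Fin 2) (Fin 2) CircFun => M.map (ev l')) hcomm
  -- Here h equals its adjugate. At λ = l, where R = 1, it is the right monodromy 1 + N, so N equals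
  -- its adjugate; together with N² = 0 this gives N = 0.
  · push Not at hX0
    obtain ⟨N, hN0, hN2, hNL⟩ := hmon l w₀ hw₀
    have e1 := hXl w₀ l
    rw [hX0 w₀ hw₀, hhl w₀ hw₀, hRl, adjugate_one, mul_one, hNL, ← mul_assoc,
      adjugate_mul_of_det (D.det_L hw₀ l), one_mul, adjugate_add_fin_two, adjugate_one] at e1
    have e2 : N = N.adjugate := by
      have e3 : (0 : Matrix (Fin 2) (Fin 2) CircFun).map (ev l) = 0 := by ext i j; simp
      rw [e3] at e1
      rw [← sub_eq_zero, e1]; abel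
    have h01 := congrFun (congrFun e2 0) 1
    have h10 := congrFun (congrFun e2 1) 0
    have h00 := congrFun (congrFun e2 0) 0
    have hsq := congrFun (congrFun hN2 0) 0
    rw [adjugate_fin_two] at h01 h10 h00
    simp [mul_apply, Fin.sum_univ_two] at h01 h10 h00 hsq
    have z01 : N 0 1 = 0 := by linear_combination (1 / 2 : ℂ) * h01
    have z10 : N 1 0 = 0 := by linear_combination (1 / 2 : ℂ) * h10
    rw [z01, zero_mul, add_zero] at hsq
    have z00 : N 0 0 = 0 := mul_self_eq_zero.1 hsq
    apply hN0
    ext i j; fin_cases i <;> fin_cases j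
    · exact z00
    · exact z01
    · exact z10
    · exact h00.symm.trans z00

/-- The surface is not invariant under a nontrivial deck transformation. -/
theorem not_periodic (hne : U.Nonempty) {n : ℤ} (hn : n ≠ 0)
    (hτ : ∀ w ∈ U, w + 2 * Real.pi * Complex.I * n ∈ U) {H : ℝ} (hH : H ≠ 0) {l : Circle}
    (himm : T = .cgcTimelike → IsImmersionOn U fun w => symMap H T (F w) l) :
    ¬ ∀ w ∈ U, symMap H T (F (w + 2 * Real.pi * Complex.I * n)) l = symMap H T (F w) l := by
  intro hf
  obtain ⟨p, q, hpq⟩ := D.exists_form_fun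
  have hexp : Complex.exp (2 * Real.pi * Complex.I * n) = 1 :=
    Complex.exp_eq_one_iff.2 ⟨n, by ring⟩
  -- The multiple mτ is again the translation of a nontrivial deck transformation, with n replaced
  -- by mn.
  obtain ⟨m, hm, hgauge⟩ := D.exists_gauge hpq hτ hexp hH hf himm
  have e : (m : ℂ) * (2 * Real.pi * Complex.I * n) = 2 * Real.pi * Complex.I * ((m * n : ℤ) : ℂ) := by
    push_cast; ring
  rw [e] at hgauge
  exact D.not_gauge hne (mul_ne_zero (by exact_mod_cast hm) hn) (fun w hw => (hgauge w hw).1) hpq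
    fun w hw => (hgauge w hw).2

end SplitData

/-! ### The two Iwasawa cells and the universal cover -/

theorem omega_det (l : Circle) : (omega l).det = 1 := by
  simp [omega, det_fin_two_of]

theorem omega_inv (l : Circle) : (omega l)⁻¹ = !![0, (l : ℂ); -(l : ℂ)⁻¹, 0] := by
  rw [inv_eq_adjugate (omega_det l), omega, adjugate_fin_two_of]
  simp

theorem omega_conj_entries (l : Circle) (M : Mat2) :
    (omega l)⁻¹ * M * omega l =
      !![M 1 1, -((l : ℂ) ^ 2 * M 1 0); -((l : ℂ)⁻¹ ^ 2 * M 0 1), M 0 0] := by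
  have hl : (l : ℂ) ≠ 0 := l.coe_ne_zero
  rw [omega_inv, omega, eta_fin_two M]
  ext i j
  fin_cases i <;> fin_cases j <;> simp <;> field_simp

theorem contDiff_circleExp : ContDiff ℝ ∞ fun t : ℝ => ((Circle.exp t : Circle) : ℂ) := by
  simp only [Circle.coe_exp]
  exact (Complex.ofRealCLM.contDiff.mul contDiff_const).cexp

theorem contDiff_circleExp_inv : ContDiff ℝ ∞ fun t : ℝ => ((Circle.exp t : Circle) : ℂ)⁻¹ :=
  contDiff_circleExp.inv fun t => (Circle.exp t).coe_ne_zero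

theorem exp_pi_mul_coe (l : Circle) : ((Circle.exp Real.pi * l : Circle) : ℂ) = -l := by
  rw [Circle.coe_mul, Circle.coe_exp, Complex.exp_pi_mul_I, neg_one_mul]

/-- Conjugation by `ω` preserves the twisted loop group of `SU(1,1)`. -/
theorem omega_conj_mem {g : Loop} (hg : g ∈ loopReal .cmcSpacelike) :
    (fun l => (omega l)⁻¹ * g l * omega l) ∈ loopReal .cmcSpacelike := by
  obtain ⟨⟨hsm, htw, hdet⟩, hreal⟩ := hg
  have hdet' : ∀ l, ((omega l)⁻¹ * g l * omega l).det = 1 := fun l => by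
    rw [inv_eq_adjugate (omega_det l), det_mul, det_mul, det_adjugate, omega_det, hdet]; simp
  refine ⟨⟨?_, ?_, hdet'⟩, fun l => ⟨hdet' l, ?_⟩⟩
  · intro i j
    simp only [omega_conj_entries]
    have h1 := contDiff_circleExp
    have h2 := contDiff_circleExp_inv
    fin_cases i <;> fin_cases j
    · exact hsm 1 1
    · exact ((h1.pow 2).mul (hsm 1 0)).neg
    · exact ((h2.pow 2).mul (hsm 0 1)).neg
    · exact hsm 0 0
  · intro l
    obtain ⟨a1, a2, a3, a4⟩ := htw l
    simp only [omega_conj_entries, exp_pi_mul_coe]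
    simp [a1, a2, a3, a4]
  · obtain ⟨h1, h2⟩ := isRealMat_of_mem_realForm (hreal l)
    have hd := hdet l
    have hl : (l : ℂ) ≠ 0 := l.coe_ne_zero
    have h3 : conj (g l 1 1) = g l 0 0 := by rw [← h1, Complex.conj_conj]
    have h4 : conj (g l 1 0) = g l 0 1 := by rw [← h2, Complex.conj_conj]
    have hcl : conj (l : ℂ) = (l : ℂ)⁻¹ := (Circle.coe_inv_eq_conj l).symm
    rw [det_fin_two] at hd
    simp only [omega_conj_entries]
    ext i j
    fin_cases i <;> fin_cases j <;>
      simp [mul_apply, Fin.sum_univ_two, sigma3, conjTranspose_apply, h1, h2, h3, h4, hcl]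
    · field_simp; linear_combination hd
    · field_simp; ring
    · field_simp; ring
    · field_simp; linear_combination -hd

/-- Left multiplication by `ω⁻¹` preserves the twisted loop group. -/
theorem omega_inv_mul_mem {g : Loop} (hg : g ∈ loopSL2) :
    (fun l => (omega l)⁻¹ * g l) ∈ loopSL2 := by
  obtain ⟨hsm, htw, hdet⟩ := hg
  have e : ∀ l, (omega l)⁻¹ * g l =
      !![l * g l 1 0, l * g l 1 1; -((l : ℂ)⁻¹ * g l 0 0), -((l : ℂ)⁻¹ * g l 0 1)] := by
    intro l
    rw [omega_inv]
    ext i j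
    fin_cases i <;> fin_cases j <;> simp [mul_apply, Fin.sum_univ_two]
  refine ⟨?_, ?_, ?_⟩
  · intro i j
    simp only [e]
    have h1 := contDiff_circleExp
    have h2 := contDiff_circleExp_inv
    fin_cases i <;> fin_cases j
    · exact h1.mul (hsm 1 0)
    · exact h1.mul (hsm 1 1)
    · exact (h2.mul (hsm 0 0)).neg
    · exact (h2.mul (hsm 0 1)).neg
  · intro l
    obtain ⟨a1, a2, a3, a4⟩ := htw l
    simp only [e, exp_pi_mul_coe]
    simp [a1, a2, a3, a4, inv_neg]
  · intro l
    show ((omega l)⁻¹ * g l).det = 1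
    rw [inv_eq_adjugate (omega_det l), det_mul, det_adjugate, omega_det, hdet]; simp

theorem isSolution_omega_inv_mul {c : ℂ} {U : Set ℂ} {L : ℂ → Loop} (hL : IsSolution c U L) :
    IsSolution c U fun w l => (omega l)⁻¹ * L w l := by
  refine ⟨fun w hw => omega_inv_mul_mem (hL.1 w hw), fun w hw l i j => ?_⟩
  have h : HasMatDerivAt (fun v => L v l) _ w := hL.2 w hw l
  have h1 := ((hasMatDerivAt_const (omega l)⁻¹ w).mul h) i j
  rwa [zero_mul, zero_add, ← mul_assoc] at h1

theorem isSmoothFamily_omega_conj {U : Set ℂ} {F : ℂ → Loop} (hF : IsSmoothFamily U F) :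
    IsSmoothFamily U fun w l => (omega l)⁻¹ * F w l * omega l := by
  intro i j
  simp only [omega_conj_entries]
  have h1 : ContDiffOn ℝ ∞ (fun p : ℂ × ℝ => ((Circle.exp p.2 : Circle) : ℂ) ^ 2)
      (U ×ˢ Set.univ) := ((contDiff_circleExp.comp contDiff_snd).pow 2).contDiffOn
  have h2 : ContDiffOn ℝ ∞ (fun p : ℂ × ℝ => ((Circle.exp p.2 : Circle) : ℂ)⁻¹ ^ 2)
      (U ×ˢ Set.univ) := ((contDiff_circleExp_inv.comp contDiff_snd).pow 2).contDiffOn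
  fin_cases i <;> fin_cases j
  · exact hF 1 1
  · exact (h1.mul (hF 1 0)).neg
  · exact (h2.mul (hF 0 1)).neg
  · exact hF 0 0

/-- Both Iwasawa cells lead to a splitting in the first cell with the same extended frame. -/
theorem IsFrame.exists_splitData {T : SurfaceClass} {c : ℂ} (hc : c ≠ 0) {U V : Set ℂ}
    (hVU : V ⊆ U) (hV : IsOpen V) (hVc : IsPreconnected V) {L F : ℂ → Loop}
    (hL : IsSolution c U L) (hF : IsFrame T U L F) :
    ∃ L' F' B : ℂ → Loop, SplitData T c V L' F' B ∧ ∀ w ∈ V, F' w = F w := by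
  obtain ⟨F₀, B, hsm, hre, hpos, hcase⟩ := hF
  have hL' : IsSolution c V L := ⟨fun w hw => hL.1 w (hVU hw), fun w hw => hL.2 w (hVU hw)⟩
  have hsm' : IsSmoothFamily V F₀ := fun i j => (hsm i j).mono (Set.prod_mono hVU subset_rfl)
  rcases hcase with h | ⟨rfl, h⟩
  · exact ⟨L, F₀, B, ⟨hV, hVc, hc, hL', hsm', fun w hw => hre w (hVU hw),
      fun w hw => hpos w (hVU hw), fun w hw l => (h w (hVU hw) l).1⟩,
      fun w hw => funext fun l => (h w (hVU hw) l).2.symm⟩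
  -- From L = F₀ωB follows ω⁻¹L = (ω⁻¹F₀ω)B. The left factor does not depend on w, so the
  -- differential equation persists, and the real factor is exactly the frame F of the second cell.
  · refine ⟨fun w l => (omega l)⁻¹ * L w l, fun w l => (omega l)⁻¹ * F₀ w l * omega l, B,
      ⟨hV, hVc, hc, isSolution_omega_inv_mul hL', isSmoothFamily_omega_conj hsm',
      fun w hw => omega_conj_mem (hre w (hVU hw)), fun w hw => hpos w (hVU hw), fun w hw l => ?_⟩,
      fun w hw => funext fun l => (h w (hVU hw) l).2.symm⟩
    rw [(h w (hVU hw) l).1]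
    simp only [mul_assoc]

/-- The universal cover of an annular domain around zero contains a connected open set that is
invariant under a nontrivial deck transformation. -/
theorem IsAnnularAroundZero.exists_component {S : Set ℂ} (hS : IsAnnularAroundZero S) :
    ∃ (V : Set ℂ) (n : ℤ), V ⊆ logCover S ∧ IsOpen V ∧ IsPreconnected V ∧ V.Nonempty ∧ n ≠ 0 ∧
      ∀ w ∈ V, w + 2 * Real.pi * Complex.I * n ∈ V := by
  obtain ⟨hSo, -, -, z, γ, n, hγ, ⟨θ, hθ, hθn⟩, hn⟩ := hS
  have hmem : ∀ t, θ t ∈ logCover S := fun t => by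
    rw [logCover, Set.mem_preimage, hθ]; exact hγ t
  have hopen : IsOpen (logCover S) := hSo.preimage Complex.continuous_exp
  refine ⟨connectedComponentIn (logCover S) (θ 0), n, connectedComponentIn_subset _ _,
    hopen.connectedComponentIn, isPreconnected_connectedComponentIn,
    ⟨θ 0, mem_connectedComponentIn (hmem 0)⟩, hn, ?_⟩
  set τ : ℂ := 2 * Real.pi * Complex.I * n
  -- The logarithm of the loop stays in the cover and joins θ 0 to θ 0 + τ, so translation by τ maps
  -- this component into itself. Connectedness of the whole cover is not needed.
  have h1 : θ 1 ∈ connectedComponentIn (logCover S) (θ 0) :=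
    (isPreconnected_range θ.continuous).subset_connectedComponentIn (Set.mem_range_self 0)
      (Set.range_subset_iff.2 hmem) (Set.mem_range_self 1)
  have h2 : θ 1 = θ 0 + τ := by rw [← hθn]; ring
  have hinv : ∀ w ∈ logCover S, w + τ ∈ logCover S := fun w hw => by
    have : Complex.exp (w + τ) = Complex.exp w :=
      Complex.exp_eq_exp_iff_exists_int.2 ⟨n, by simp only [τ]; ring⟩
    rw [logCover, Set.mem_preimage, this]; exact hw
  have h3 : (fun w => w + τ) '' connectedComponentIn (logCover S) (θ 0) ⊆
      connectedComponentIn (logCover S) (θ 1) := by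
    refine (isPreconnected_connectedComponentIn.image _
      (by fun_prop)).subset_connectedComponentIn ?_ ?_
    · exact ⟨θ 0, mem_connectedComponentIn (hmem 0), h2.symm⟩
    · rintro _ ⟨w, hw, rfl⟩
      exact hinv w (connectedComponentIn_subset _ _ hw)
  intro w hw
  rw [connectedComponentIn_eq h1]
  exact h3 ⟨w, hw, rfl⟩

end DPW

end

/-! ### Conclusion: a map defined on the annulus would give a periodic surface -/

theorem theorem4p1 (T : DPW.SurfaceClass) (c : ℂ) (hc : c ≠ 0) (H : ℝ) (hH : H ≠ 0)
    (S : Set ℂ) (hS : DPW.IsAnnularAroundZero S)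
    (L F : ℂ → DPW.Loop)
    (hL : DPW.IsSolution c (DPW.logCover S) L)
    (hF : DPW.IsFrame T (DPW.logCover S) L F)
    (l : Circle)
    (himm : T = DPW.SurfaceClass.cgcTimelike →
      DPW.IsImmersionOn (DPW.logCover S) (fun w => DPW.symMap H T (F w) l)) :
    ¬ DPW.IsWellDefinedOn S (fun w => DPW.symMap H T (F w) l) := by
  rintro ⟨fS, hfS⟩
  obtain ⟨V, n, hVS, hV, hVc, hVne, hn, hτ⟩ := hS.exists_component
  obtain ⟨L', F', B, D, hF'⟩ := hF.exists_splitData hc hVS hV hVc hL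
  refine D.not_periodic hVne hn hτ hH (l := l) (fun hT w hw => ?_) fun w hw => ?_
  · have h := himm hT w (hVS hw)
    -- The frames F' and F agree only on V; since V is open, the derivatives of the immersions agree
    -- there as well.
    have heq : (fun v => (fun i j => DPW.symMap H T (F' v) l i j : Fin 2 → Fin 2 → ℂ)) =ᶠ[nhds w]
        fun v => (fun i j => DPW.symMap H T (F v) l i j : Fin 2 → Fin 2 → ℂ) := by
      filter_upwards [hV.mem_nhds hw] with v hv
      rw [hF' v hv]
    refine ⟨heq.differentiableAt_iff.2 h.1, ?_⟩
    rw [heq.fderiv_eq]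
    exact h.2
  · rw [hF' w hw, hF' _ (hτ w hw)]
    have h1 := hfS _ (hVS (hτ w hw))
    have h2 := hfS _ (hVS hw)
    rw [Complex.exp_eq_exp_iff_exists_int.2 ⟨n, by ring⟩] at h1
    exact h1.trans h2.symm
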